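/- Let $K$ be an algebraically closed field. A noncommutative variety $(X,\mathcal A)$ over $K$ is a reduced separated scheme $X$ of finite type over $K$ with a sheaf $\mathcal A$ of $\mathcal O_X$-algebras that is coherent as an $\mathcal O_X$-module. It is a noncommutative curve if all irreducible components of $X$ are one-dimensional and $\mathcal A$ has no nonzero nilpotent ideals. A vector bundle over $(X,\mathcal A)$ is a coherent sheaf $\mathcal F$ of $\mathcal A$-modules such that $\mathcal F_x$ is a projective $\mathcal A_x$-module for every $x\in X$; let $\mathrm{VB}(\mathcal A)$ be the category of vector bundles over $(X,\mathcal A)$. Let $\mathcal K(\mathcal A)=\mathcal A\otimes_{\mathcal O_X}\mathcal K_X$, where $\mathcal K_X$ is the sheaf of total rings of fractions of $\mathcal O_X$. A noncommutative curve $(X,\mathcal A)$ is normal if for every $x$ the natural map $\mathcal A_x\to\mathcal K(\mathcal A)_x$ is injective and no $\mathcal O_{X,x}$-subalgebra of $\mathcal K(\mathcal A)_x$ that is finitely generated as an $\mathcal O_{X,x}$-module strictly contains $\mathcal A_x$. Let $(X,\mathcal A)$ be a noncommutative curve with a normalization $\pi:(\tilde X,\tilde{\mathcal A})\to(X,\mathcal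 A)$. That is, $\pi:\tilde X\to X$ is a finite morphism over $K$, $(\tilde X,\tilde{\mathcal A})$ is a normal noncommutative curve which is central ($\mathcal O_{\tilde X,y}$ is the centre of $\tilde{\mathcal A}_y$ for every $y\in\tilde X$), $\mathcal A\to\pi_*\tilde{\mathcal A}$ is a homomorphism of sheaves of algebras over $\mathcal O_X\to\pi_*\mathcal O_{\tilde X}$, and $\mathcal A_x\subseteq(\pi_*\tilde{\mathcal A})_x\subseteq\mathcal K(\mathcal A)_x$ for every $x\in X$. Let $\mathrm{Sing}=\{x\in X:\mathcal A_x\neq(\pi_*\tilde{\mathcal A})_x\}$ and $\widetilde{\mathrm{Sing}}=\pi^{-1}(\mathrm{Sing})$. Let $\mathcal J$ be the conductor of $\tilde{\mathcal A}$ in $\mathcal A$, i.e. the largest sheaf of two-sided $\pi_*\tilde{\mathcal A}$-ideals contained in $\mathcal A$, and let $\mathcal J_y$ ($y\in\tilde X$) be the ideal of $\tilde{\mathcal A}_y$ generated by $\mathcal J_{\pi(y)}$. Put $$\mathbf S=\prod_{x\in\mathrm{Sing}}\mathcal A_x/\mathcal J_x,\qquad \tilde{\mathbf S}=\prod_{y\in\widetilde{\mathrm{Sing}}}\tilde{\mathcal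 A}_y/\mathcal J_y,$$ $$\iota^*\mathcal F=\prod_{x\in\mathrm{Sing}}\mathcal F_x/\mathcal J_x\mathcal F_x,\qquad \tilde\iota^*\mathcal G=\prod_{y\in\widetilde{\mathrm{Sing}}}\mathcal G_y/\mathcal J_y\mathcal G_y.$$ Let $\mathcal T(\mathcal A)$ be the category of triples $(\mathcal G,P,\theta)$, where $\mathcal G$ is a vector bundle over $(\tilde X,\tilde{\mathcal A})$, $P$ is a finitely generated projective $\mathbf S$-module and $\theta:\tilde{\mathbf S}\otimes_{\mathbf S}P\to\tilde\iota^*\mathcal G$ is an isomorphism of $\tilde{\mathbf S}$-modules. A morphism $(\mathcal G,P,\theta)\to(\mathcal G',P',\theta')$ is a pair of homomorphisms $\Phi:\mathcal G\to\mathcal G'$ and $\varphi:P\to P'$ with $\theta'\circ(1\otimes\varphi)=\tilde\iota^*\Phi\circ\theta$. **Theorem 1.1.** For every vector bundle $\mathcal F$ over $(X,\mathcal A)$, let $\theta_{\mathcal F}:\tilde{\mathbf S}\otimes_{\mathbf S}\iota^*\mathcal F\to\tilde\iota^*\pi^*\mathcal F$ be the natural homomorphism. Then $(\pi^*\mathcal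 F,\iota^*\mathcal F,\theta_{\mathcal F})$ is an object of $\mathcal T(\mathcal A)$, and the functor $$\mathbf F:\mathrm{VB}(\mathcal A)\to\mathcal T(\mathcal A),\qquad \mathcal F\mapsto(\pi^*\mathcal F,\iota^*\mathcal F,\theta_{\mathcal F})$$ is an equivalence of categories. For every triple $(\mathcal G,P,\theta)$, the preimage in $\pi_*\mathcal G$ of the $\mathbf S$-submodule $\theta(1\otimes P)\subseteq\tilde\iota^*\mathcal G$ is a vector bundle over $(X,\mathcal A)$, and the functor $\mathbf G:\mathcal T(\mathcal A)\to\mathrm{VB}(\mathcal A)$ that sends $(\mathcal G,P,\theta)$ to this preimage is inverse to $\mathbf F$. -/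

import Mathlib

open CategoryTheory AlgebraicGeometry TopologicalSpace Opposite
open scoped TensorProduct

universe u

noncomputable section

namespace NCCurve

/-! ### Extension of scalars for noncommutative rings -/

section ExtendScalars

variable {R S : Type u} [Ring R] [Ring S] (f : R →+* S)

/-- The relations `(s * f r) ⊗ m = s ⊗ (r • m)` that turn `S ⊗_ℤ M` into `S ⊗_R M`. -/
def balanced (M : Type u) [AddCommGroup M] [Module R M] : Submodule S (S ⊗[ℤ] M) :=
  Submodule.span S {z | ∃ (s : S) (r : R) (m : M), z = (s * f r) ⊗ₜ[ℤ] m - s ⊗ₜ[ℤ] (r • m)}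

/-- The left `S`-module `S ⊗_R M`, for a ring homomorphism `f : R → S` and a left `R`-module `M`. -/
abbrev Extend (M : Type u) [AddCommGroup M] [Module R M] : Type u :=
  (S ⊗[ℤ] M) ⧸ balanced f M

variable {M M' : Type u} [AddCommGroup M] [Module R M] [AddCommGroup M'] [Module R M']
variable {N : Type u} [AddCommGroup N] [Module S N]

/-- The pure tensor `s ⊗ m` in `S ⊗_R M`. -/
def Extend.tmul (s : S) (m : M) : Extend f M := (balanced f M).mkQ (s ⊗ₜ[ℤ] m)

lemma Extend.smul_tmul (s t : S) (m : M) : s • tmul f t m = tmul f (s * t) m := rfl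

lemma Extend.tmul_add (s : S) (m n : M) : tmul f s (m + n) = tmul f s m + tmul f s n := by
  simp [tmul, TensorProduct.tmul_add]

lemma Extend.tmul_smul (s : S) (r : R) (m : M) : tmul f s (r • m) = tmul f (s * f r) m := by
  symm
  rw [← sub_eq_zero, tmul, tmul, ← map_sub]
  exact (Submodule.Quotient.mk_eq_zero _).2 (Submodule.subset_span ⟨s, r, m, rfl⟩)

lemma Extend.hom_ext {g h : Extend f M →ₗ[S] N} (H : ∀ m, g (tmul f 1 m) = h (tmul f 1 m)) :
    g = h := by
  refine Submodule.linearMap_qext _ (TensorProduct.AlgebraTensorModule.ext fun s m => ?_)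
  have e : (balanced f M).mkQ (s ⊗ₜ[ℤ] m) = s • tmul f (1 : S) m := by
    rw [Extend.smul_tmul, mul_one]; rfl
  simp only [LinearMap.comp_apply, e, map_smul, H]

/-- The universal property: an `f`-semilinear map `g : M → N` induces `s ⊗ m ↦ s • g m`. -/
def Extend.lift (g : M →+ N) (hg : ∀ (r : R) (m : M), g (r • m) = f r • g m) :
    Extend f M →ₗ[S] N :=
  (balanced f M).liftQ
    (TensorProduct.AlgebraTensorModule.lift
      (LinearMap.toSpanSingleton S (M →ₗ[ℤ] N) g.toIntLinearMap)) (by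
    rw [balanced, Submodule.span_le]
    rintro _ ⟨s, r, m, rfl⟩
    simp [hg, mul_smul])

lemma Extend.lift_tmul (g : M →+ N) (hg : ∀ (r : R) (m : M), g (r • m) = f r • g m)
    (s : S) (m : M) : Extend.lift f g hg (tmul f s m) = s • g m := by
  change s • g.toIntLinearMap m = s • g m
  rfl

/-- The map `M → S ⊗_R M`, `m ↦ 1 ⊗ m`. -/
def Extend.one : M →+ Extend f M where
  toFun m := tmul f 1 m
  map_zero' := by
    rw [tmul, TensorProduct.tmul_zero, map_zero]
  map_add' := tmul_add f 1

lemma Extend.one_smul (r : R) (m : M) : one f (r • m) = f r • one f m := by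
  change tmul f 1 (r • m) = f r • tmul f 1 m
  rw [tmul_smul, smul_tmul, one_mul, mul_one]

/-- The homomorphism `s ⊗ m ↦ s ⊗ φ m`. -/
def Extend.map (φ : M →ₗ[R] M') : Extend f M →ₗ[S] Extend f M' :=
  Extend.lift f ((Extend.one f).comp φ.toAddMonoidHom) (fun r m =>
    (congrArg (Extend.one f) (φ.map_smul r m)).trans (Extend.one_smul f r (φ m)))

lemma Extend.map_one (φ : M →ₗ[R] M') (m : M) :
    Extend.map f φ (Extend.one f m) = Extend.one f (φ m) :=
  (Extend.lift_tmul f _ _ 1 m).trans (_root_.one_smul S _)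

/-- The functor `M ↦ S ⊗_R M` on left modules. -/
def extendScalars : ModuleCat.{u} R ⥤ ModuleCat.{u} S where
  obj M := ModuleCat.of S (Extend f M)
  map φ := ModuleCat.ofHom (Extend.map f φ.hom)
  map_id M := by
    ext1
    exact Extend.hom_ext f fun m => Extend.map_one f _ m
  map_comp φ ψ := by
    ext1
    refine Extend.hom_ext f fun m => (Extend.map_one f _ m).trans ?_
    exact ((congrArg (Extend.map f ψ.hom) (Extend.map_one f φ.hom m)).trans
      (Extend.map_one f ψ.hom _)).symm

/-- The map `P → S ⊗_R P`, `p ↦ 1 ⊗ p`. -/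
def oneTensor (P : ModuleCat.{u} R) : P →+ (extendScalars f).obj P := Extend.one f

lemma oneTensor_smul (P : ModuleCat.{u} R) (r : R) (p : P) :
    oneTensor f P (r • p) = f r • oneTensor f P p := Extend.one_smul f r p

lemma extendScalars_hom_ext {P : ModuleCat.{u} R} {Q : ModuleCat.{u} S}
    {g h : (extendScalars f).obj P ⟶ Q}
    (H : ∀ p, g.hom (oneTensor f P p) = h.hom (oneTensor f P p)) : g = h := by
  ext1
  exact Extend.hom_ext f H

lemma extendScalars_map_oneTensor {P P' : ModuleCat.{u} R} (φ : P ⟶ P') (p : P) :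
    ((extendScalars f).map φ).hom (oneTensor f P p) = oneTensor f P' (φ.hom p) :=
  Extend.map_one f φ.hom p

/-- The homomorphism `S ⊗_R P → Q`, `s ⊗ p ↦ s • g p`, induced by a semilinear map `g`. -/
def extendHom {P : ModuleCat.{u} R} {Q : ModuleCat.{u} S} (g : P →+ Q)
    (hg : ∀ (r : R) (p : P), g (r • p) = f r • g p) : (extendScalars f).obj P ⟶ Q :=
  ModuleCat.ofHom (Extend.lift f g hg)

lemma extendHom_oneTensor {P : ModuleCat.{u} R} {Q : ModuleCat.{u} S} (g : P →+ Q)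
    (hg : ∀ (r : R) (p : P), g (r • p) = f r • g p) (p : P) :
    (extendHom f g hg).hom (oneTensor f P p) = g p :=
  (Extend.lift_tmul f g hg 1 p).trans (one_smul _ _)

end ExtendScalars

/-! ### Stalks and fibres of sheaves of modules over a sheaf of (noncommutative) rings -/

section Fibres

variable {X : TopCat.{u}}

/-- The stalk of a sheaf of rings. -/
abbrev ringStalk (A : Sheaf (Opens.grothendieckTopology X) RingCat.{u}) (x : X) : RingCat.{u} :=
  TopCat.Presheaf.stalk A.obj x

variable {A : Sheaf (Opens.grothendieckTopology X) RingCat.{u}}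

/-- The stalk of a sheaf of `A`-modules; it is a module over the stalk of `A`. -/
abbrev modStalk (F : SheafOfModules.{u} A) (x : X) : Ab.{u} :=
  TopCat.Presheaf.stalk F.val.presheaf x

/-- The germ at `x` of a section of a sheaf of rings. -/
def germR (A : Sheaf (Opens.grothendieckTopology X) RingCat.{u}) (U : Opens X) (x : X) (hx : x ∈ U) :
    A.obj.obj (op U) →+* ringStalk A x :=
  (TopCat.Presheaf.germ A.obj U x hx).hom

/-- The germ at `x` of a section of a sheaf of modules. -/
def germM (F : SheafOfModules.{u} A) (U : Opens X) (x : X) (hx : x ∈ U) :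
    F.val.obj (op U) →+ modStalk F x :=
  (TopCat.Presheaf.germ F.val.presheaf U x hx).hom

lemma germM_smul (F : SheafOfModules.{u} A) (U : Opens X) (x : X) (hx : x ∈ U)
    (a : A.obj.obj (op U)) (m : F.val.obj (op U)) :
    germM F U x hx (a • m) = germR A U x hx a • germM F U x hx m :=
  PresheafOfModules.germ_ringCat_smul F.val x U hx a m

lemma exists_germR (x : X) (a : ringStalk A x) :
    ∃ (U : Opens X) (hx : x ∈ U) (s : A.obj.obj (op U)), germR A U x hx s = a :=
  TopCat.Presheaf.exists_germ_eq A.obj a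

lemma exists_germM (F : SheafOfModules.{u} A) (x : X) (m : modStalk F x) :
    ∃ (U : Opens X) (hx : x ∈ U) (s : F.val.obj (op U)), germM F U x hx s = m :=
  TopCat.Presheaf.exists_germ_eq F.val.presheaf m

lemma germR_res {U V : Opens X} (i : U ⟶ V) (x : X) (hx : x ∈ U) (s : A.obj.obj (op V)) :
    germR A U x hx (A.obj.map i.op s) = germR A V x (i.le hx) s :=
  TopCat.Presheaf.germ_res_apply A.obj i x hx s

lemma germM_res (F : SheafOfModules.{u} A) {U V : Opens X} (i : U ⟶ V) (x : X) (hx : x ∈ U)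
    (s : F.val.obj (op V)) :
    germM F U x hx (F.val.map i.op s) = germM F V x (i.le hx) s :=
  TopCat.Presheaf.germ_res_apply F.val.presheaf i x hx s

/-- Two germs, one of a section of `A` and one of a section of `F`, come from a common
neighbourhood. -/
lemma exists_germ₂ (F : SheafOfModules.{u} A) (x : X) (a : ringStalk A x) (m : modStalk F x) :
    ∃ (U : Opens X) (hx : x ∈ U) (s : A.obj.obj (op U)) (t : F.val.obj (op U)),
      germR A U x hx s = a ∧ germM F U x hx t = m := by
  obtain ⟨U, hU, s, rfl⟩ := exists_germR x a
  obtain ⟨V, hV, t, rfl⟩ := exists_germM F x m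
  exact ⟨U ⊓ V, ⟨hU, hV⟩, A.obj.map (Opens.infLELeft U V).op s,
    F.val.map (Opens.infLERight U V).op t, germR_res _ _ _ _, germM_res _ _ _ _ _⟩

/-- The map induced on stalks by a morphism of sheaves of modules. -/
def stalkMapM {F F' : SheafOfModules.{u} A} (φ : F ⟶ F') (x : X) :
    modStalk F x →ₗ[ringStalk A x] modStalk F' x where
  toFun := ((TopCat.Presheaf.stalkFunctor Ab.{u} x).map
    ((SheafOfModules.toSheaf A).map φ).hom).hom
  map_add' := map_add _
  map_smul' a m := by
    obtain ⟨U, hx, s, t, rfl, rfl⟩ := exists_germ₂ F x a m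
    have key : ∀ t : F.val.obj (op U),
        ((TopCat.Presheaf.stalkFunctor Ab.{u} x).map
          ((SheafOfModules.toSheaf A).map φ).hom).hom (germM F U x hx t) =
          germM F' U x hx (φ.val.app (op U) t) := fun t =>
      TopCat.Presheaf.stalkFunctor_map_germ_apply U x hx ((SheafOfModules.toSheaf A).map φ).hom t
    rw [← germM_smul, key, key, map_smul, germM_smul]
    rfl

lemma stalkMapM_germ {F F' : SheafOfModules.{u} A} (φ : F ⟶ F') (U : Opens X) (x : X) (hx : x ∈ U)
    (t : F.val.obj (op U)) :
    stalkMapM φ x (germM F U x hx t) = germM F' U x hx (φ.val.app (op U) t) :=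
  TopCat.Presheaf.stalkFunctor_map_germ_apply U x hx ((SheafOfModules.toSheaf A).map φ).hom t

/-- The fibre `F_x / I F_x` at a two-sided ideal `I` of the stalk `A_x`; it is a module
over `A_x / I`. -/
abbrev Fib (F : SheafOfModules.{u} A) (x : X) (I : Ideal (ringStalk A x)) : Type u :=
  modStalk F x ⧸ (I • (⊤ : Submodule (ringStalk A x) (modStalk F x)))

/-- The map induced on fibres by a morphism of sheaves of modules. -/
def fibMap {F F' : SheafOfModules.{u} A} (φ : F ⟶ F') (x : X) (I : Ideal (ringStalk A x))
    [I.IsTwoSided] : Fib F x I →ₗ[ringStalk A x ⧸ I] Fib F' x I where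
  toFun := Submodule.mapQ _ _ (stalkMapM φ x) (by
    rw [← Submodule.map_le_iff_le_comap, Submodule.map_smul'']
    exact smul_le_smul_left I le_top)
  map_add' := map_add _
  map_smul' a m := by
    obtain ⟨a, rfl⟩ := Ideal.Quotient.mk_surjective a
    obtain ⟨m, rfl⟩ := Submodule.Quotient.mk_surjective _ m
    rw [Module.Quotient.mk_smul_mk]
    simp only [Submodule.mapQ_apply, map_smul, RingHom.id_apply]
    rw [Module.Quotient.mk_smul_mk]

lemma fibMap_mk {F F' : SheafOfModules.{u} A} (φ : F ⟶ F') (x : X) (I : Ideal (ringStalk A x))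
    [I.IsTwoSided] (m : modStalk F x) :
    fibMap φ x I (Submodule.Quotient.mk m) = Submodule.Quotient.mk (stalkMapM φ x m) := rfl

variable {ι : Type u} (p : ι → X) (I : ∀ i, Ideal (ringStalk A (p i))) [∀ i, (I i).IsTwoSided]

/-- For a family of points `p i` and two-sided ideals `I i` of the stalks `A_{p i}`, the ring
`∏ A_{p i} / I i`. -/
abbrev FibRing : Type u := ∀ i, ringStalk A (p i) ⧸ I i

/-- The functor `F ↦ ∏ F_{p i} / I i F_{p i}` from sheaves of `A`-modules to modules over
`∏ A_{p i} / I i`. -/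
def fibFunctor : SheafOfModules.{u} A ⥤ ModuleCat.{u} (FibRing p I) where
  obj F := ModuleCat.of (FibRing p I) (∀ i, Fib F (p i) (I i))
  map φ := ModuleCat.ofHom
    { toFun := fun v i => fibMap φ (p i) (I i) (v i)
      map_add' := fun v w => by ext i; simp
      map_smul' := fun a v => by
        ext i
        exact map_smul (fibMap φ (p i) (I i)) (a i) (v i) }
  map_id F := by
    ext1
    refine LinearMap.ext fun v => funext fun i => ?_
    obtain ⟨m, hm⟩ := Submodule.Quotient.mk_surjective _ (v i)
    obtain ⟨U, hx, t, rfl⟩ := exists_germM F (p i) m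
    change fibMap (𝟙 F) (p i) (I i) (v i) = v i
    rw [← hm, fibMap_mk, stalkMapM_germ]
    rfl
  map_comp {F F' F''} φ ψ := by
    ext1
    refine LinearMap.ext fun v => funext fun i => ?_
    obtain ⟨m, hm⟩ := Submodule.Quotient.mk_surjective _ (v i)
    obtain ⟨U, hx, t, rfl⟩ := exists_germM F (p i) m
    change fibMap (φ ≫ ψ) (p i) (I i) (v i) =
      fibMap ψ (p i) (I i) (fibMap φ (p i) (I i) (v i))
    rw [← hm, fibMap_mk, fibMap_mk, fibMap_mk, stalkMapM_germ, stalkMapM_germ, stalkMapM_germ]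
    rfl

end Fibres

/-! ### Noncommutative varieties and curves -/

section Varieties

/-- A coherent sheaf of `A`-modules, where `A` is a sheaf of algebras over a (locally Noetherian)
scheme `X`: the underlying sheaf of `𝒪_X`-modules is quasi-coherent, with finitely generated
modules of sections over the affine open sets. -/
structure IsCoherent {X : Scheme.{u}} {A : Sheaf (Opens.grothendieckTopology X) RingCat.{u}}
    (str : X.ringCatSheaf ⟶ A) (F : SheafOfModules.{u} A) : Prop where
  quasicoherent : SheafOfModules.IsQuasicoherent.{u}
    ((SheafOfModules.restrictScalars.{u} str).obj F)
  finite : ∀ U : X.Opens, IsAffineOpen U → Module.Finite (X.ringCatSheaf.obj.obj (op U))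
    (((SheafOfModules.restrictScalars.{u} str).obj F).val.obj (op U))

/-- A noncommutative variety `(X, A)` over the field `K`: a reduced separated scheme `X` of finite
type over `K`, and a sheaf `A` of `𝒪_X`-algebras which is coherent as an `𝒪_X`-module. -/
structure NCVariety (K : Type u) [Field K] where
  /-- the underlying variety -/
  space : Scheme.{u}
  /-- the structure morphism of the underlying variety -/
  toSpec : space ⟶ Spec (CommRingCat.of K)
  reduced : IsReduced space
  separated : IsSeparated toSpec
  quasiCompact : QuasiCompact toSpec
  locallyOfFiniteType : LocallyOfFiniteType toSpec
  /-- the sheaf of rings `A` -/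
  sheaf : Sheaf (Opens.grothendieckTopology space) RingCat.{u}
  /-- the structure map `𝒪_X ⟶ A` -/
  str : space.ringCatSheaf ⟶ sheaf
  commute : ∀ (U : space.Opens) (f : space.ringCatSheaf.obj.obj (op U))
    (a : sheaf.obj.obj (op U)), Commute ((str.hom.app (op U)).hom f) a
  coherent : IsCoherent str (SheafOfModules.unit sheaf)

namespace NCVariety

variable {K : Type u} [Field K] (𝒳 : NCVariety K)

/-- The algebra structure map `𝒪_{X,x} → A_x` on stalks. -/
def strStalk (x : 𝒳.space) : 𝒳.space.presheaf.stalk x →+* ringStalk 𝒳.sheaf x :=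
  ((preservesColimitIso (forget₂ CommRingCat.{u} RingCat.{u})
      ((OpenNhds.inclusion x).op ⋙ 𝒳.space.presheaf)).hom ≫
    (TopCat.Presheaf.stalkFunctor RingCat.{u} x).map 𝒳.str.hom).hom

lemma strStalk_germ (x : 𝒳.space) (U : 𝒳.space.Opens) (hx : x ∈ U)
    (f : 𝒳.space.presheaf.obj (op U)) :
    𝒳.strStalk x (𝒳.space.presheaf.germ U x hx f) =
      germR 𝒳.sheaf U x hx ((𝒳.str.hom.app (op U)).hom f) := by
  have h : (forget₂ CommRingCat.{u} RingCat.{u}).map (𝒳.space.presheaf.germ U x hx) ≫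
      (preservesColimitIso (forget₂ CommRingCat.{u} RingCat.{u})
        ((OpenNhds.inclusion x).op ⋙ 𝒳.space.presheaf)).hom =
      TopCat.Presheaf.germ 𝒳.space.ringCatSheaf.obj U x hx :=
    ι_preservesColimitIso_hom (forget₂ CommRingCat.{u} RingCat.{u})
      ((OpenNhds.inclusion x).op ⋙ 𝒳.space.presheaf) (op ⟨U, hx⟩)
  have h' := congrArg (fun φ => φ ≫ (TopCat.Presheaf.stalkFunctor RingCat.{u} x).map 𝒳.str.hom) h
  have h'' := h'.trans (TopCat.Presheaf.stalkFunctor_map_germ U x hx 𝒳.str.hom)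
  exact congrArg (fun φ => RingCat.Hom.hom φ f) h''

lemma strStalk_commute (x : 𝒳.space) (f : 𝒳.space.presheaf.stalk x) (a : ringStalk 𝒳.sheaf x) :
    𝒳.strStalk x f * a = a * 𝒳.strStalk x f := by
  obtain ⟨U, hU, s, rfl⟩ := 𝒳.space.presheaf.exists_germ_eq f
  obtain ⟨V, hV, t, rfl⟩ := exists_germR x a
  have hx : x ∈ U ⊓ V := ⟨hU, hV⟩
  have hs : 𝒳.strStalk x (𝒳.space.presheaf.germ U x hU s) =
      germR 𝒳.sheaf (U ⊓ V) x hx ((𝒳.str.hom.app (op (U ⊓ V))).hom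
        (𝒳.space.presheaf.map (Opens.infLELeft U V).op s)) := by
    rw [← TopCat.Presheaf.germ_res_apply 𝒳.space.presheaf (Opens.infLELeft U V) x hx s]
    exact 𝒳.strStalk_germ x (U ⊓ V) hx _
  have ht := germR_res (A := 𝒳.sheaf) (Opens.infLERight U V) x hx t
  rw [hs, ← ht, ← map_mul, ← map_mul]
  exact congrArg _ (𝒳.commute _ _ _)

instance (x : 𝒳.space) : Algebra (𝒳.space.presheaf.stalk x) (ringStalk 𝒳.sheaf x) :=
  RingHom.toAlgebra' (𝒳.strStalk x) (𝒳.strStalk_commute x)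

/-- The stalk at `x` of `K(A) = A ⊗ K_X`, where the stalk of `K_X` is the total ring of fractions
of `𝒪_{X,x}`. -/
abbrev FracStalk (x : 𝒳.space) : Type u :=
  FractionRing (𝒳.space.presheaf.stalk x) ⊗[𝒳.space.presheaf.stalk x] ringStalk 𝒳.sheaf x

/-- The natural map `A_x → K(A)_x`. -/
def toFrac (x : 𝒳.space) : ringStalk 𝒳.sheaf x →ₐ[𝒳.space.presheaf.stalk x] 𝒳.FracStalk x :=
  Algebra.TensorProduct.includeRight

/-- A noncommutative curve: every irreducible component of `X` is one-dimensional, and `A` is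
reduced, i.e. has no nonzero nilpotent two-sided ideals. -/
structure IsNCCurve : Prop where
  dim_one : ∀ Z ∈ irreducibleComponents 𝒳.space, topologicalKrullDim Z = 1
  noNilpotents : ∀ (x : 𝒳.space) (I : Ideal (ringStalk 𝒳.sheaf x)), I.IsTwoSided →
    (∃ n : ℕ, I ^ n = ⊥) → I = ⊥

/-- `A` is central: `𝒪_{X,x}` is the centre of `A_x` for every point `x`. -/
def IsCentral : Prop :=
  ∀ x : 𝒳.space, Function.Injective (𝒳.strStalk x) ∧
    (𝒳.strStalk x).range = Subring.center (ringStalk 𝒳.sheaf x)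

/-- `A` is normal: every `A_x` is a maximal `𝒪_{X,x}`-order, i.e. it is contained in `K(A)_x`, and
`K(A)_x` has no `𝒪_{X,x}`-subalgebra that strictly contains `A_x` and is finitely generated as an
`𝒪_{X,x}`-module. -/
def IsNormal : Prop :=
  ∀ x : 𝒳.space, Function.Injective (𝒳.toFrac x) ∧
    ∀ B : Subalgebra (𝒳.space.presheaf.stalk x) (𝒳.FracStalk x),
      (𝒳.toFrac x).range ≤ B → B.toSubmodule.FG → B = (𝒳.toFrac x).range

/-- A vector bundle over `(X, A)`: a coherent sheaf of `A`-modules with projective stalks. -/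
def isVectorBundle : ObjectProperty (SheafOfModules.{u} 𝒳.sheaf) := fun F =>
  IsCoherent 𝒳.str F ∧
    ∀ x : 𝒳.space, Module.Projective (ringStalk 𝒳.sheaf x) (modStalk F x)

/-- The category of vector bundles over `(X, A)`. -/
abbrev VB : Type (u + 1) := 𝒳.isVectorBundle.FullSubcategory

end NCVariety

end Varieties

/-! ### Morphisms and normalizations -/

section Morphisms

variable {K : Type u} [Field K]

/-- A morphism `(Y, B) → (X, A)` of noncommutative varieties over `K`: a morphism `Y → X` of
`K`-schemes together with a homomorphism `A → π_* B` of sheaves of algebras over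
`𝒪_X → π_* 𝒪_Y`. -/
structure NCHom (𝒴 𝒳 : NCVariety K) where
  /-- the morphism of underlying schemes -/
  base : 𝒴.space ⟶ 𝒳.space
  base_toSpec : base ≫ 𝒳.toSpec = 𝒴.toSpec
  /-- the homomorphism of sheaves of rings -/
  sharp : 𝒳.sheaf ⟶ ((Opens.map base.base).sheafPushforwardContinuous RingCat.{u}
    (Opens.grothendieckTopology 𝒳.space) (Opens.grothendieckTopology 𝒴.space)).obj 𝒴.sheaf
  str_sharp : 𝒳.str ≫ sharp = base.toRingCatSheafHom ≫
    ((Opens.map base.base).sheafPushforwardContinuous RingCat.{u}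
      (Opens.grothendieckTopology 𝒳.space) (Opens.grothendieckTopology 𝒴.space)).map 𝒴.str

namespace NCHom

variable {𝒴 𝒳 : NCVariety K} (π : NCHom 𝒴 𝒳)

/-- The sheaf of rings `π_* B` on `X`. -/
abbrev pushRing : Sheaf (Opens.grothendieckTopology 𝒳.space) RingCat.{u} :=
  ((Opens.map π.base.base).sheafPushforwardContinuous RingCat.{u}
    (Opens.grothendieckTopology 𝒳.space) (Opens.grothendieckTopology 𝒴.space)).obj 𝒴.sheaf

/-- The homomorphism `A(U) → B(π⁻¹ U)`. -/
def sharpApp (U : 𝒳.space.Opens) :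
    𝒳.sheaf.obj.obj (op U) →+* 𝒴.sheaf.obj.obj (op (π.base ⁻¹ᵁ U)) :=
  (π.sharp.hom.app (op U)).hom

lemma sharpApp_res {U V : 𝒳.space.Opens} (i : U ⟶ V) (a : 𝒳.sheaf.obj.obj (op V)) :
    π.sharpApp U (𝒳.sheaf.obj.map i.op a) =
      𝒴.sheaf.obj.map ((Opens.map π.base.base).map i).op (π.sharpApp V a) :=
  congrArg (fun φ => RingCat.Hom.hom φ a) (π.sharp.hom.naturality i.op)

/-- The homomorphism `A_x → (π_* B)_x`. -/
def sharpStalk (x : 𝒳.space) : ringStalk 𝒳.sheaf x →+* ringStalk π.pushRing x :=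
  ((TopCat.Presheaf.stalkFunctor RingCat.{u} x).map π.sharp.hom).hom

/-- The homomorphism `A_{π y} → B_y`. -/
def stalkMap (y : 𝒴.space) : ringStalk 𝒳.sheaf (π.base y) →+* ringStalk 𝒴.sheaf y :=
  (TopCat.Presheaf.stalkPushforward RingCat.{u} π.base.base 𝒴.sheaf.obj y).hom.comp
    (π.sharpStalk (π.base y))

lemma stalkMap_germ (U : 𝒳.space.Opens) (y : 𝒴.space) (hy : π.base y ∈ U)
    (a : 𝒳.sheaf.obj.obj (op U)) :
    π.stalkMap y (germR 𝒳.sheaf U (π.base y) hy a) =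
      germR 𝒴.sheaf (π.base ⁻¹ᵁ U) y hy (π.sharpApp U a) := by
  have h1 : π.sharpStalk (π.base y) (germR 𝒳.sheaf U (π.base y) hy a) =
      germR π.pushRing U (π.base y) hy (π.sharpApp U a) :=
    TopCat.Presheaf.stalkFunctor_map_germ_apply U (π.base y) hy π.sharp.hom a
  have h2 := TopCat.Presheaf.stalkPushforward_germ RingCat.{u} π.base.base 𝒴.sheaf.obj U y hy
  exact (congrArg (TopCat.Presheaf.stalkPushforward RingCat.{u} π.base.base 𝒴.sheaf.obj y).hom
    h1).trans (congrArg (fun φ => RingCat.Hom.hom φ (π.sharpApp U a)) h2)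

/-- `π : (Y, B) → (X, A)` is a normalization of the noncommutative curve `(X, A)`: `A ⊆ π_* B`
inside `K(A)`, `(Y, B)` is a normal noncommutative curve, `Y` is finite over `X` and `B` is central
over `Y` (so that `Y` is the spectrum of the centre of `π_* B`). -/
structure IsNormalization : Prop where
  finite : IsFinite π.base
  isNCCurve : 𝒴.IsNCCurve
  central : 𝒴.IsCentral
  normal : 𝒴.IsNormal
  toFrac_injective : ∀ x : 𝒳.space, Function.Injective (𝒳.toFrac x)
  exists_embedding : ∀ x : 𝒳.space, ∃ j : ringStalk π.pushRing x →+* 𝒳.FracStalk x,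
    Function.Injective j ∧ ∀ a : ringStalk 𝒳.sheaf x, j (π.sharpStalk x a) = 𝒳.toFrac x a

/-! ### The conductor and the singular points -/

/-- The set of points `x` of `X` where `A_x ≠ (π_* B)_x`. -/
def sing : Set 𝒳.space := {x | ¬ Function.Bijective (π.sharpStalk x)}

/-- The preimage in `Y` of the set of singular points. -/
def singAbove : Set 𝒴.space := {y | π.base y ∈ π.sing}

/-- The sections over `U` of the conductor `J`, the largest sheaf of two-sided `π_* B`-ideals
contained in `A`: those `a ∈ A(U)` such that, on all smaller open sets, `A` contains the two-sided
`π_* B`-ideal generated by `a`. -/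
def IsConductorSection (U : 𝒳.space.Opens) (a : 𝒳.sheaf.obj.obj (op U)) : Prop :=
  ∀ (V : 𝒳.space.Opens) (i : V ⟶ U) (b c : 𝒴.sheaf.obj.obj (op (π.base ⁻¹ᵁ V))),
    b * π.sharpApp V (𝒳.sheaf.obj.map i.op a) * c ∈ (π.sharpApp V).range

/-- The germs at `x` of the sections of the conductor. -/
def conductorGerms (x : 𝒳.space) : Set (ringStalk 𝒳.sheaf x) :=
  {s | ∃ (U : 𝒳.space.Opens) (hx : x ∈ U) (a : 𝒳.sheaf.obj.obj (op U)),
    π.IsConductorSection U a ∧ germR 𝒳.sheaf U x hx a = s}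

/-- The stalk `J_x` of the conductor, as an ideal of `A_x`. -/
def conductor (x : 𝒳.space) : Ideal (ringStalk 𝒳.sheaf x) :=
  (TwoSidedIdeal.span (π.conductorGerms x)).asIdeal

/-- The stalk `J_y` of the conductor, as an ideal of `B_y`. -/
def conductorAbove (y : 𝒴.space) : Ideal (ringStalk 𝒴.sheaf y) :=
  (TwoSidedIdeal.span (π.stalkMap y '' π.conductorGerms (π.base y))).asIdeal

instance (x : 𝒳.space) : (π.conductor x).IsTwoSided :=
  inferInstanceAs (TwoSidedIdeal.asIdeal _).IsTwoSided

instance (y : 𝒴.space) : (π.conductorAbove y).IsTwoSided :=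
  inferInstanceAs (TwoSidedIdeal.asIdeal _).IsTwoSided

lemma conductor_le_comap (y : 𝒴.space) :
    π.conductor (π.base y) ≤ (π.conductorAbove y).comap (π.stalkMap y) := by
  intro a ha
  have h : TwoSidedIdeal.span (π.conductorGerms (π.base y)) ≤
      (TwoSidedIdeal.span (π.stalkMap y '' π.conductorGerms (π.base y))).comap
        (π.stalkMap y) := by
    rw [TwoSidedIdeal.span_le]
    intro s hs
    exact (TwoSidedIdeal.mem_comap _).2 (TwoSidedIdeal.subset_span ⟨s, hs, rfl⟩)
  exact TwoSidedIdeal.mem_asIdeal.2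
    ((TwoSidedIdeal.mem_comap _).1 (h (TwoSidedIdeal.mem_asIdeal.1 ha)))

/-- The ring `S = ∏ A_x / J_x`, the product over the singular points `x`. -/
abbrev ringS : Type u := FibRing (A := 𝒳.sheaf) (fun x : π.sing => x.1) (fun x => π.conductor x.1)

/-- The ring `S' = ∏ B_y / J_y`, the product over the points `y` above the singular points. -/
abbrev ringS' : Type u :=
  FibRing (A := 𝒴.sheaf) (fun y : π.singAbove => y.1) (fun y => π.conductorAbove y.1)

/-- The homomorphism `S → S'`. -/
def ringSMap : π.ringS →+* π.ringS' :=
  RingHom.pi fun y : π.singAbove =>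
    (Ideal.quotientMap (π.conductorAbove y.1) (π.stalkMap y.1) (π.conductor_le_comap y.1)).comp
      (Pi.evalRingHom (fun x : π.sing => ringStalk 𝒳.sheaf x.1 ⧸ π.conductor x.1)
        ⟨π.base y.1, y.2⟩)

lemma ringSMap_apply (s : π.ringS) (y : π.singAbove) (a : ringStalk 𝒳.sheaf (π.base y.1))
    (ha : s ⟨π.base y.1, y.2⟩ = Ideal.Quotient.mk _ a) :
    π.ringSMap s y = Ideal.Quotient.mk _ (π.stalkMap y.1 a) := by
  change Ideal.quotientMap (π.conductorAbove y.1) (π.stalkMap y.1) (π.conductor_le_comap y.1)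
    (s ⟨π.base y.1, y.2⟩) = _
  rw [ha, Ideal.quotientMap_mk]

/-! ### The functors between sheaves of modules -/

/-- The direct image functor `π_*`. -/
abbrev push : SheafOfModules.{u} 𝒴.sheaf ⥤ SheafOfModules.{u} 𝒳.sheaf :=
  SheafOfModules.pushforward.{u} π.sharp

instance : (PresheafOfModules.pushforward.{u} π.sharp.hom).IsRightAdjoint :=
  PresheafOfModules.instIsRightAdjointPushforward π.sharp.hom

instance : (SheafOfModules.pushforward.{u} π.sharp).IsRightAdjoint :=
  (SheafOfModules.PullbackConstruction.adjunction.{u} π.sharp).isRightAdjoint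

/-- The inverse image functor `π^*`, left adjoint to `π_*`. -/
abbrev pull : SheafOfModules.{u} 𝒳.sheaf ⥤ SheafOfModules.{u} 𝒴.sheaf :=
  SheafOfModules.pullback.{u} π.sharp

/-- The functor `ι^*` of restriction to the singular points, with values in `S`-modules:
`F ↦ ∏ F_x / J_x F_x`. -/
abbrev restrict : SheafOfModules.{u} 𝒳.sheaf ⥤ ModuleCat.{u} π.ringS :=
  fibFunctor (fun x : π.sing => x.1) (fun x => π.conductor x.1)

/-- The functor of restriction to the points above the singular points, with values in
`S'`-modules: `G ↦ ∏ G_y / J_y G_y`. -/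
abbrev restrictAbove : SheafOfModules.{u} 𝒴.sheaf ⥤ ModuleCat.{u} π.ringS' :=
  fibFunctor (fun y : π.singAbove => y.1) (fun y => π.conductorAbove y.1)

/-- The functor `P ↦ S' ⊗_S P`. -/
abbrev extend : ModuleCat.{u} π.ringS ⥤ ModuleCat.{u} π.ringS' := extendScalars π.ringSMap

/-- The natural map `(π_* G)_{π y} → G_y`. -/
def pushStalk (G : SheafOfModules.{u} 𝒴.sheaf) (y : 𝒴.space) :
    modStalk (π.push.obj G) (π.base y) →ₛₗ[π.stalkMap y] modStalk G y where
  toFun := (TopCat.Presheaf.stalkPushforward Ab.{u} π.base.base G.val.presheaf y).hom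
  map_add' := map_add _
  map_smul' a m := by
    obtain ⟨U, hx, s, t, rfl, rfl⟩ := exists_germ₂ (π.push.obj G) (π.base y) a m
    have key : ∀ t : (π.push.obj G).val.obj (op U),
        (TopCat.Presheaf.stalkPushforward Ab.{u} π.base.base G.val.presheaf y).hom
          (germM (π.push.obj G) U (π.base y) hx t) = germM G (π.base ⁻¹ᵁ U) y hx t := fun t =>
      congrArg (fun φ => AddCommGrpCat.Hom.hom φ t)
        (TopCat.Presheaf.stalkPushforward_germ Ab.{u} π.base.base G.val.presheaf U y hx)
    rw [← germM_smul, key, key, stalkMap_germ]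
    exact germM_smul G (π.base ⁻¹ᵁ U) y hx (π.sharpApp U s) t

lemma pushStalk_germ (G : SheafOfModules.{u} 𝒴.sheaf) (U : 𝒳.space.Opens) (y : 𝒴.space)
    (hy : π.base y ∈ U) (t : (π.push.obj G).val.obj (op U)) :
    π.pushStalk G y (germM (π.push.obj G) U (π.base y) hy t) = germM G (π.base ⁻¹ᵁ U) y hy t :=
  congrArg (fun φ => AddCommGrpCat.Hom.hom φ t)
    (TopCat.Presheaf.stalkPushforward_germ Ab.{u} π.base.base G.val.presheaf U y hy)

/-- The natural map `F_{π y} → (π^* F)_y`. -/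
def pullStalk (F : SheafOfModules.{u} 𝒳.sheaf) (y : 𝒴.space) :
    modStalk F (π.base y) →ₛₗ[π.stalkMap y] modStalk (π.pull.obj F) y :=
  (π.pushStalk (π.pull.obj F) y).comp
    (stalkMapM ((SheafOfModules.pullbackPushforwardAdjunction.{u} π.sharp).unit.app F) (π.base y))

lemma pullStalk_germ (F : SheafOfModules.{u} 𝒳.sheaf) (U : 𝒳.space.Opens) (y : 𝒴.space)
    (hy : π.base y ∈ U) (t : F.val.obj (op U)) :
    π.pullStalk F y (germM F U (π.base y) hy t) = germM (π.pull.obj F) (π.base ⁻¹ᵁ U) y hy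
      (((SheafOfModules.pullbackPushforwardAdjunction.{u} π.sharp).unit.app F).val.app
        (op U) t) := by
  refine Eq.trans (congrArg (π.pushStalk (π.pull.obj F) y) (stalkMapM_germ _ U _ hy t)) ?_
  exact π.pushStalk_germ (π.pull.obj F) U y hy _

/-- The natural map `F_{π y} / J_{π y} F_{π y} → (π^* F)_y / J_y (π^* F)_y`. -/
def pullFib (F : SheafOfModules.{u} 𝒳.sheaf) (y : 𝒴.space) :
    Fib F (π.base y) (π.conductor (π.base y)) →ₛₗ[π.stalkMap y]
      Fib (π.pull.obj F) y (π.conductorAbove y) :=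
  Submodule.mapQ _ _ (π.pullStalk F y) (by
    refine Submodule.smul_le.2 fun a ha m _ => ?_
    rw [Submodule.mem_comap, LinearMap.map_smulₛₗ]
    exact Submodule.smul_mem_smul (π.conductor_le_comap y ha) trivial)

lemma pullFib_smul (F : SheafOfModules.{u} 𝒳.sheaf) (y : 𝒴.space)
    (a : ringStalk 𝒳.sheaf (π.base y)) (v : Fib F (π.base y) (π.conductor (π.base y))) :
    π.pullFib F y (Ideal.Quotient.mk (π.conductor (π.base y)) a • v) =
      Ideal.Quotient.mk (π.conductorAbove y) (π.stalkMap y a) • π.pullFib F y v :=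
  LinearMap.map_smulₛₗ (π.pullFib F y) a v

lemma pullFib_naturality {F F' : SheafOfModules.{u} 𝒳.sheaf} (φ : F ⟶ F') (y : 𝒴.space)
    (v : Fib F (π.base y) (π.conductor (π.base y))) :
    π.pullFib F' y (fibMap φ (π.base y) (π.conductor (π.base y)) v) =
      fibMap (π.pull.map φ) y (π.conductorAbove y) (π.pullFib F y v) := by
  obtain ⟨m, rfl⟩ := Submodule.Quotient.mk_surjective _ v
  obtain ⟨U, hx, t, rfl⟩ := exists_germM F (π.base y) m
  refine congrArg (Submodule.Quotient.mk (p := π.conductorAbove y •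
    (⊤ : Submodule (ringStalk 𝒴.sheaf y) (modStalk (π.pull.obj F') y)))) ?_
  let adj := SheafOfModules.pullbackPushforwardAdjunction.{u} π.sharp
  change π.pullStalk F' y (stalkMapM φ (π.base y) (germM F U (π.base y) hx t)) =
    stalkMapM (π.pull.map φ) y (π.pullStalk F y (germM F U (π.base y) hx t))
  rw [stalkMapM_germ, pullStalk_germ, pullStalk_germ]
  refine Eq.trans ?_ (stalkMapM_germ (π.pull.map φ) (π.base ⁻¹ᵁ U) y hx _).symm
  refine congrArg (germM (π.pull.obj F') (π.base ⁻¹ᵁ U) y hx) ?_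
  exact congrArg (fun ψ : F ⟶ π.push.obj (π.pull.obj F') => ψ.val.app (op U) t)
    (adj.unit.naturality φ)

/-- The product of the natural maps `F_{π y} / J_{π y} F_{π y} → (π^* F)_y / J_y (π^* F)_y`. -/
def pullFibs (F : SheafOfModules.{u} 𝒳.sheaf) :
    π.restrict.obj F →+ π.restrictAbove.obj (π.pull.obj F) where
  toFun := fun v (y : π.singAbove) => π.pullFib F y.1 (v ⟨π.base y.1, y.2⟩)
  map_zero' := funext fun y => map_zero (π.pullFib F y.1)
  map_add' := fun _ _ => funext fun y => map_add (π.pullFib F y.1) _ _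

lemma pullFibs_smul (F : SheafOfModules.{u} 𝒳.sheaf) (s : π.ringS) (v : π.restrict.obj F) :
    π.pullFibs F (s • v) = π.ringSMap s • π.pullFibs F v := by
  refine funext fun y : π.singAbove => ?_
  obtain ⟨a, ha⟩ := Ideal.Quotient.mk_surjective (s ⟨π.base y.1, y.2⟩)
  have h1 : (π.ringSMap s) y = Ideal.Quotient.mk _ (π.stalkMap y.1 a) :=
    π.ringSMap_apply s y a ha.symm
  change π.pullFib F y.1 (s ⟨π.base y.1, y.2⟩ • v ⟨π.base y.1, y.2⟩) =
    π.ringSMap s y • π.pullFib F y.1 (v ⟨π.base y.1, y.2⟩)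
  rw [h1, ← ha, pullFib_smul]

/-- The natural homomorphism `θ_F : S' ⊗_S ι^* F → ι'^* π^* F`. -/
def theta (F : SheafOfModules.{u} 𝒳.sheaf) :
    π.extend.obj (π.restrict.obj F) ⟶ π.restrictAbove.obj (π.pull.obj F) :=
  extendHom π.ringSMap (π.pullFibs F) (π.pullFibs_smul F)

lemma theta_oneTensor (F : SheafOfModules.{u} 𝒳.sheaf) (v : π.restrict.obj F) :
    (π.theta F).hom (oneTensor π.ringSMap _ v) = π.pullFibs F v :=
  extendHom_oneTensor π.ringSMap (π.pullFibs F) (π.pullFibs_smul F) v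

/-- The functor `F ↦ (π^* F, ι^* F, θ_F)` on all sheaves of `A`-modules. Its target is the category
of triples `(G, P, θ)` of a sheaf of `B`-modules `G` (the component `right`), an `S`-module `P`
(the component `left`) and a homomorphism `θ : S' ⊗_S P → ι'^* G` (the component `hom`); morphisms
are pairs of homomorphisms that make the evident square commute. -/
def toTriples : SheafOfModules.{u} 𝒳.sheaf ⥤ Comma π.extend π.restrictAbove where
  obj F := { left := π.restrict.obj F, right := π.pull.obj F, hom := π.theta F }
  map {F F'} φ :=
    { left := π.restrict.map φ
      right := π.pull.map φ
      w := by
        refine extendScalars_hom_ext π.ringSMap fun v => ?_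
        have h1 := extendScalars_map_oneTensor π.ringSMap (π.restrict.map φ) v
        change (π.theta F').hom ((π.extend.map (π.restrict.map φ)).hom
          (oneTensor π.ringSMap _ v)) = (π.restrictAbove.map (π.pull.map φ)).hom
            ((π.theta F).hom (oneTensor π.ringSMap _ v))
        rw [h1, theta_oneTensor, theta_oneTensor]
        exact funext fun y : π.singAbove => π.pullFib_naturality φ y.1 _ }
  map_id F := by
    apply CommaMorphism.ext
    · exact π.restrict.map_id F
    · exact π.pull.map_id F
  map_comp φ ψ := by
    apply CommaMorphism.ext
    · exact π.restrict.map_comp φ ψ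
    · exact π.pull.map_comp φ ψ

/-- The triples `(G, P, θ)` where `G` is a vector bundle over `(Y, B)`, `P` is a finitely generated
projective `S`-module and `θ` is an isomorphism. -/
def isTriple : ObjectProperty (Comma π.extend π.restrictAbove) := fun T =>
  𝒴.isVectorBundle T.right ∧ Module.Finite π.ringS T.left ∧ Module.Projective π.ringS T.left ∧
    IsIso T.hom

/-- The category of triples `T(A)`. -/
abbrev Triples : Type (u + 1) := π.isTriple.FullSubcategory

/-- The class of a section `g ∈ G(π⁻¹ U)` in `G_y / J_y G_y`. -/
def residue (G : SheafOfModules.{u} 𝒴.sheaf) (U : 𝒳.space.Opens) (y : 𝒴.space)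
    (hy : π.base y ∈ U) : (π.push.obj G).val.obj (op U) →+ Fib G y (π.conductorAbove y) :=
  (Submodule.mkQ (π.conductorAbove y •
    (⊤ : Submodule (ringStalk 𝒴.sheaf y) (modStalk G y)))).toAddMonoidHom.comp
      (germM G (π.base ⁻¹ᵁ U) y hy)

lemma residue_smul (G : SheafOfModules.{u} 𝒴.sheaf) (U : 𝒳.space.Opens) (y : 𝒴.space)
    (hy : π.base y ∈ U) (a : 𝒳.sheaf.obj.obj (op U)) (g : (π.push.obj G).val.obj (op U)) :
    π.residue G U y hy (a • g) = Ideal.Quotient.mk (π.conductorAbove y)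
      (π.stalkMap y (germR 𝒳.sheaf U (π.base y) hy a)) • π.residue G U y hy g := by
  rw [stalkMap_germ]
  exact congrArg (Submodule.Quotient.mk (p := π.conductorAbove y •
    (⊤ : Submodule (ringStalk 𝒴.sheaf y) (modStalk G y))))
    (germM_smul G (π.base ⁻¹ᵁ U) y hy (π.sharpApp U a) g)

lemma residue_res (G : SheafOfModules.{u} 𝒴.sheaf) {U V : 𝒳.space.Opens} (i : U ⟶ V) (y : 𝒴.space)
    (hy : π.base y ∈ U) (g : (π.push.obj G).val.obj (op V)) :
    π.residue G U y hy ((π.push.obj G).val.map i.op g) = π.residue G V y (i.le hy) g :=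
  congrArg (Submodule.Quotient.mk (p := π.conductorAbove y •
    (⊤ : Submodule (ringStalk 𝒴.sheaf y) (modStalk G y))))
    (germM_res G ((Opens.map π.base.base).map i) y hy g)

lemma residue_map {G G' : SheafOfModules.{u} 𝒴.sheaf} (Φ : G ⟶ G') (U : 𝒳.space.Opens)
    (y : 𝒴.space) (hy : π.base y ∈ U) (g : (π.push.obj G).val.obj (op U)) :
    π.residue G' U y hy ((π.push.map Φ).val.app (op U) g) =
      fibMap Φ y (π.conductorAbove y) (π.residue G U y hy g) :=
  congrArg (Submodule.Quotient.mk (p := π.conductorAbove y •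
    (⊤ : Submodule (ringStalk 𝒴.sheaf y) (modStalk G' y))))
    (stalkMapM_germ Φ (π.base ⁻¹ᵁ U) y hy g).symm

/-- A section `g ∈ (π_* G)(U)` lies in the preimage of `θ(1 ⊗ P)`: at each singular point `x ∈ U`,
the classes of `g` in the modules `G_y / J_y G_y`, for `π y = x`, are the components of
`θ(1 ⊗ p)` for some `p ∈ P`. -/
def InPreimage (T : Comma π.extend π.restrictAbove) (U : 𝒳.space.Opens)
    (g : (π.push.obj T.right).val.obj (op U)) : Prop :=
  ∀ x ∈ π.sing, x ∈ U → ∃ p : T.left, ∀ (y : π.singAbove) (hy : π.base y.1 ∈ U),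
    π.base y.1 = x →
      π.residue T.right U y.1 hy g = T.hom.hom (oneTensor π.ringSMap T.left p) y

/-- The subsheaf of `π_* G` given by the preimage of `θ(1 ⊗ P)`, as a presheaf of `A`-modules. -/
def gluePresheaf (T : Comma π.extend π.restrictAbove) :
    PresheafOfModules.Submodule (π.push.obj T.right).val where
  obj U :=
    { carrier := {g | π.InPreimage T U.unop g}
      zero_mem' := fun x hx hxU => ⟨0, fun y hy _ => by
        rw [map_zero, map_zero, map_zero]
        rfl⟩
      add_mem' := fun {g h} hg hh x hx hxU => by
        obtain ⟨p, hp⟩ := hg x hx hxU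
        obtain ⟨q, hq⟩ := hh x hx hxU
        refine ⟨p + q, fun y hy hyx => ?_⟩
        rw [map_add, hp y hy hyx, hq y hy hyx, map_add, map_add]
        rfl
      smul_mem' := fun a g hg x hx hxU => by
        obtain ⟨p, hp⟩ := hg x hx hxU
        classical
        let s : π.ringS := Pi.single ⟨x, hx⟩ (Ideal.Quotient.mk _ (germR 𝒳.sheaf U.unop x hxU a))
        refine ⟨s • p, fun y hy hyx => ?_⟩
        subst hyx
        have h1 : π.ringSMap s y = Ideal.Quotient.mk _
            (π.stalkMap y.1 (germR 𝒳.sheaf U.unop (π.base y.1) hxU a)) :=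
          π.ringSMap_apply s y _ (Pi.single_eq_same _ _)
        rw [oneTensor_smul, (T.hom.hom).map_smul]
        refine (π.residue_smul T.right U.unop y.1 hy a g).trans ?_
        rw [← h1, hp y hy rfl]
        rfl }
  map {U V} f g hg := fun x hx hxV => by
    obtain ⟨p, hp⟩ := hg x hx (f.unop.le hxV)
    refine ⟨p, fun y hy hyx => ?_⟩
    rw [← hp y (f.unop.le hy) hyx]
    exact π.residue_res T.right f.unop y.1 hy g

lemma gluePresheaf_isSheaf (T : Comma π.extend π.restrictAbove) :
    Presheaf.IsSheaf (Opens.grothendieckTopology 𝒳.space)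
      (π.gluePresheaf T).toPresheafOfModules.presheaf := by
  refine (TopCat.Presheaf.isSheaf_iff_isSheafUniqueGluing
    (π.gluePresheaf T).toPresheafOfModules.presheaf).2 fun κ U sf hsf => ?_
  have hM : TopCat.Presheaf.IsSheaf (π.push.obj T.right).val.presheaf :=
    (π.push.obj T.right).isSheaf
  obtain ⟨s, hs, hu⟩ := (TopCat.Presheaf.isSheaf_iff_isSheafUniqueGluing _).1 hM U
    (fun i => (sf i).1) (fun i j => congrArg Subtype.val (hsf i j))
  have hmem : π.InPreimage T (iSup U) s := fun x hx hxU => by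
    obtain ⟨i, hi⟩ := Opens.mem_iSup.1 hxU
    obtain ⟨p, hp⟩ := (sf i).2 x hx hi
    refine ⟨p, fun y hy hyx => ?_⟩
    have hyi : π.base y.1 ∈ U i := hyx ▸ hi
    rw [← hp y hyi hyx]
    refine (π.residue_res T.right (Opens.leSupr U i) y.1 hyi s).symm.trans ?_
    exact congrArg (π.residue T.right (U i) y.1 hyi) (hs i)
  exact ⟨⟨s, hmem⟩, fun i => Subtype.ext (hs i),
    fun t ht => Subtype.ext (hu t.1 fun i => congrArg Subtype.val (ht i))⟩

lemma inPreimage_map {T T' : Comma π.extend π.restrictAbove} (ψ : T ⟶ T') (U : 𝒳.space.Opens)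
    (g : (π.push.obj T.right).val.obj (op U)) (hg : π.InPreimage T U g) :
    π.InPreimage T' U ((π.push.map ψ.right).val.app (op U) g) := fun x hx hxU => by
  obtain ⟨p, hp⟩ := hg x hx hxU
  refine ⟨ψ.left.hom p, fun y hy hyx => ?_⟩
  rw [residue_map, hp y hy hyx, ← extendScalars_map_oneTensor]
  exact (congrFun (congrArg (fun φ => φ.hom (oneTensor π.ringSMap T.left p)) ψ.w) y).symm

/-- The functor that sends a triple `(G, P, θ)` to the preimage in `π_* G` of `θ(1 ⊗ P)`. On
morphisms it is given by restriction. -/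
def glue : Comma π.extend π.restrictAbove ⥤ SheafOfModules.{u} 𝒳.sheaf where
  obj T := { val := (π.gluePresheaf T).toPresheafOfModules, isSheaf := π.gluePresheaf_isSheaf T }
  map {T T'} ψ :=
    { val := PresheafOfModules.homMk
        { app := fun U => AddCommGrpCat.ofHom
            ({ toFun := fun g => ⟨(π.push.map ψ.right).val.app U g.1,
                  π.inPreimage_map ψ U.unop g.1 g.2⟩
               map_zero' := Subtype.ext (map_zero ((π.push.map ψ.right).val.app U).hom)
               map_add' := fun g h =>
                Subtype.ext (map_add ((π.push.map ψ.right).val.app U).hom g.1 h.1) } :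
              (π.gluePresheaf T).obj U →+ (π.gluePresheaf T').obj U)
          naturality := fun U V f => by
            ext g
            exact Subtype.ext (PresheafOfModules.naturality_apply (π.push.map ψ.right).val f g.1) }
        (fun U a g => Subtype.ext (map_smul ((π.push.map ψ.right).val.app U).hom a g.1)) }
  map_id T := rfl
  map_comp ψ ψ' := rfl

end NCHom

end Morphisms

end NCCurve

end

/-!
# Vector bundles over a noncommutative curve as gluing data

Over an affine open set `U ⊆ X` write `A = A(U)`, `B = B(π⁻¹ U)` for the sections of the two sheaves of
algebras, and let `I ⊆ A` be the conductor, a two-sided ideal of `B`. Then `A` is the fibre product of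
`B` and `A / I` over `B / I`, and the theorem is a global form of Milnor's description of projective
modules over such a square.

*Residues.* On a curve a point with a proper specialization is generic on a component, and there `A`
and `π_* B` have the same stalk, the latter being contained in `K(A)`. Hence the singular points, which
over `U` are the zeros of the conductor (`NCHom.mem_sing_iff`), are closed and finite in number
(`NCHom.finite_sing`). By the Chinese remainder theorem `A / I`, `B / I` and `G / I G`, for a coherent
sheaf `G` over `B`, are the products of the residues at the points of `Sing` in `U`, respectively above
them (`NCHom.exists_mk_germR_eq`, `NCHom.exists_residue_eq`, `NCHom.mem_of_residue_eq_zero`).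

*Modules.* By a local-global principle for modules that are finite over a Noetherian algebra
(`projective_of_locAt`) the sections of a vector bundle over an affine open set form a finitely
generated projective module. The stalks of an inverse image are extensions of scalars, as one sees by
mapping into skyscraper sheaves (`isBC_pullStalk`), and for vector bundles the same follows for the
sections over affine open sets (`NCHom.isBC_pullUnit`). In particular `θ_F` is an isomorphism.

*Gluing.* For a triple `(G, P, θ)` a dual basis of `P` is lifted to finitely many elements of the glued
module `H ⊆ G(π⁻¹ U)` and functionals on `G(π⁻¹ U)` that map `H` to `A`. They form a dual basis of
`G(π⁻¹ U)` modulo `I`, which can be corrected to a dual basis by elements of `I G` and functionals with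
values in `I` (`isBC_of_dualBasis_mod`). So `H` is finitely generated projective and `B ⊗_A H = G(π⁻¹ U)`
(`NCHom.glue_projective`). Glued sections over a basic open set `D(f)` extend to `U` up to a power of `f`
(`NCHom.exists_glue_extension`), because such a power kills the residues at the zeros of `f`; hence the
glued sheaf is coherent, and it is a vector bundle.

*The equivalence.* The unit `F → G(F(F))` is bijective over affine open sets (`NCHom.isIso_toGlue`), since
both sides contain `I · π^* F` and have the same residues. The counit is the morphism `π^* H → G`
adjoint to the inclusion of the glued sheaf, an isomorphism because `B ⊗_A H = G`; on the other
component it identifies the residues of `H` with `P` (`NCHom.exists_counitIso`). A morphism of triples is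
determined by its component in `G` (`NCHom.comma_hom_ext`), since `P → S̃ ⊗_S P` is injective for `P`
projective and `S ⊆ S̃`; this yields the naturality of the counit.
-/

noncomputable section

namespace NCCurve

/-! ### Quasi-coherent sheaves over basic open sets -/

/-- The open subset `D(f)` of `Spec R`. -/
def specBasic {R : CommRingCat.{u}} (f : R) : (Spec R).Opens := PrimeSpectrum.basicOpen f

/-- The global sections of a quasi-coherent sheaf over `Spec R` localize: sections over `D(f)` extend
after multiplication by a power of `f`, and global sections that vanish over `D(f)` are killed by one. -/
lemma spec_loc {R : CommRingCat.{u}} (M : (Spec R).Modules) [M.IsQuasicoherent] (f : R) :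
    (∀ s : Γ(M, specBasic f), ∃ (n : ℕ) (t : Γ(M, ⊤)),
      M.presheaf.map (specBasic f).leTop.op t = f ^ n • s) ∧
    ∀ t : Γ(M, ⊤), M.presheaf.map (specBasic f).leTop.op t = 0 → ∃ n : ℕ, f ^ n • t = 0 := by
  let φ := ((modulesSpecToSheaf.obj M).obj.map (specBasic f).leTop.op).hom
  have hf : IsLocalizedModule (.powers f) φ := (isIso_fromTildeΓ_iff_isLocalizing M).1 inferInstance f
  refine ⟨fun s => ?_, fun t ht => ?_⟩
  · obtain ⟨⟨y, ⟨_, n, rfl⟩⟩, hy⟩ := IsLocalizedModule.surj (.powers f) φ s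
    exact ⟨n, y, hy.symm⟩
  · obtain ⟨⟨_, n, rfl⟩, hn⟩ := (IsLocalizedModule.eq_zero_iff (.powers f) φ).mp ht
    exact ⟨n, hn⟩

/-- Under `Spec Γ(X, U) ≅ U`, an element of `Γ(X, U)` acts over `W` as its restriction to the image of `W`. -/
lemma qc_scalar {X : Scheme.{u}} {U : X.Opens} (hU : IsAffineOpen U)
    {W : (Spec Γ(X, U)).Opens} (h : hU.fromSpec ''ᵁ W ≤ U) :
    (Scheme.ΓSpecIso Γ(X, U)).inv ≫ (Spec Γ(X, U)).presheaf.map W.leTop.op =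
      X.presheaf.map (homOfLE h).op ≫ (hU.fromSpec.appIso W).hom := by
  rw [Scheme.Hom.appIso_hom', Scheme.Hom.map_appLE, Scheme.Hom.appLE, hU.fromSpec_app_self, Category.assoc, ← Functor.map_comp]
  rfl

open Scheme.Modules in
lemma qc_smul {X : Scheme.{u}} (M : X.Modules) {U : X.Opens} (hU : IsAffineOpen U)
    {W : (Spec Γ(X, U)).Opens} (h : hU.fromSpec ''ᵁ W ≤ U) (r : Γ(X, U)) (m : Γ(M.restrict hU.fromSpec, W)) :
    (M.restrictAppIso hU.fromSpec W).hom (r • m) =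
      X.presheaf.map (homOfLE h).op r • (M.restrictAppIso hU.fromSpec W).hom m := by
  rw [smul_Spec_def, smul_restrictAppIso_hom_apply]
  congr 1
  have := congr((hU.fromSpec.appIso W).inv ($(qc_scalar hU h) r))
  refine Eq.trans this ?_
  simp

/-- The statement of `qc_loc` for open sets that are equal to `U` and `D(f)`, but not definitionally. -/
lemma qc_transfer {X : Scheme.{u}} (M : X.Modules) {U W0 W1 : X.Opens} (f : Γ(X, U)) (e0 : W0 = U) (e1 : W1 = X.basicOpen f)
   (hle : W1 ≤ W0)
   (h1 : ∀ s : Γ(M, W1), ∃ (n : ℕ) (t : Γ(M, W0)),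
    M.presheaf.map (homOfLE hle).op t =
      (X.presheaf.map (homOfLE (e1.le.trans (X.basicOpen_le f))).op f) ^ n • s)
   (h2 : ∀ t : Γ(M, W0), M.presheaf.map (homOfLE hle).op t = 0 →
     ∃ n : ℕ, (X.presheaf.map (homOfLE e0.le).op f) ^ n • t = 0) :
    (∀ s : Γ(M, X.basicOpen f), ∃ (n : ℕ) (t : Γ(M, U)),
      M.presheaf.map (homOfLE (X.basicOpen_le f)).op t =
        (X.presheaf.map (homOfLE (X.basicOpen_le f)).op f) ^ n • s) ∧
    ∀ t : Γ(M, U), M.presheaf.map (homOfLE (X.basicOpen_le f)).op t = 0 → ∃ n : ℕ, f ^ n • t = 0 := by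
  subst e0 e1
  refine ⟨h1, fun t ht => ?_⟩
  obtain ⟨n, hn⟩ := h2 t ht
  refine ⟨n, ?_⟩
  have : X.presheaf.map (homOfLE (le_refl W0)).op f = f := by
    simp
  rwa [this] at hn

/-- Sections of a quasi-coherent sheaf over the basic open subset `D(f)` of an affine open set `U` are the
localization at `f` of the sections over `U`. -/
lemma qc_loc {X : Scheme.{u}} (M : X.Modules) [M.IsQuasicoherent] {U : X.Opens}
    (hU : IsAffineOpen U) (f : Γ(X, U)) :
    (∀ s : Γ(M, X.basicOpen f), ∃ (n : ℕ) (t : Γ(M, U)),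
      M.presheaf.map (homOfLE (X.basicOpen_le f)).op t =
        (X.presheaf.map (homOfLE (X.basicOpen_le f)).op f) ^ n • s) ∧
    ∀ t : Γ(M, U), M.presheaf.map (homOfLE (X.basicOpen_le f)).op t = 0 → ∃ n : ℕ, f ^ n • t = 0 := by
  have e0 : hU.fromSpec ''ᵁ ⊤ = U := by simp
  have e1 : hU.fromSpec ''ᵁ (specBasic f) = X.basicOpen f := hU.fromSpec_image_basicOpen f
  obtain ⟨h1, h2⟩ := spec_loc (M.restrict hU.fromSpec) f
  refine qc_transfer M f e0 e1 (hU.fromSpec.image_mono le_top) (fun s => ?_) (fun t ht => ?_)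
  · obtain ⟨n, t, ht⟩ := h1 s
    refine ⟨n, t, ?_⟩
    have := qc_smul M hU (e1.le.trans (X.basicOpen_le f)) (f ^ n) s
    rw [map_pow] at this
    exact Eq.trans ht this
  · obtain ⟨n, hn⟩ := h2 t ht
    refine ⟨n, ?_⟩
    have := qc_smul M hU e0.le (f ^ n) t
    rw [map_pow] at this
    exact this.symm.trans hn

/-! ### Maps from the sheaf associated with a module -/

open Scheme.Modules in
lemma isUnit_smul_injective {R : CommRingCat.{u}} (M : (Spec R).Modules) {W : (Spec R).Opens} (r : R) (h : W ≤ specBasic r)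
    (s : Γ(M, W)) (hs : r • s = 0) : s = 0 :=
  (isSMulRegular_of_le_basicOpen (M := M) (f := r) h).right_eq_zero_of_smul hs

/-- Every section over `D(r)` of the sheaf associated with `N` is a fraction `n / r ^ k`. -/
lemma tilde_surj {R : CommRingCat.{u}} (N : ModuleCat.{u} R) (r : R) (s : Γ(tilde N, specBasic r)) : ∃ (k : ℕ) (n : N), r ^ k • s = (tilde.toOpen N (specBasic r)).hom n := by
  have hf : IsLocalizedModule (.powers r) (tilde.toOpen N (specBasic r)).hom :=
    inferInstanceAs (IsLocalizedModule.Away r (tilde.toOpen N (PrimeSpectrum.basicOpen r)).hom)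
  obtain ⟨⟨y, ⟨_, n, rfl⟩⟩, hy⟩ := IsLocalizedModule.surj (.powers r) (tilde.toOpen N (specBasic r)).hom s
  exact ⟨n, y, hy⟩

/-- The morphism from the sheaf associated with `N` to `M` given by a map to the global sections. -/
def tildeDesc {R : CommRingCat.{u}} (M : (Spec R).Modules) (N : ModuleCat.{u} R) (φ : N →ₗ[R] Γ(M, ⊤)) : tilde N ⟶ M :=
  (tilde.adjunction.homEquiv N M).symm (ModuleCat.ofHom (Y := moduleSpecΓFunctor.obj M) φ)

lemma tildeDesc_app {R : CommRingCat.{u}} (M : (Spec R).Modules) (N : ModuleCat.{u} R) (φ : N →ₗ[R] Γ(M, ⊤)) (n : N) :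
   (tildeDesc M N φ).app ⊤ ((tilde.toOpen N ⊤).hom n) = φ n := by
  have h1 := (tilde.adjunction.homEquiv N M).apply_symm_apply
    (ModuleCat.ofHom (Y := moduleSpecΓFunctor.obj M) φ)
  have h2 := (tilde.adjunction.homEquiv_unit (X := N) (Y := M) (f := tildeDesc M N φ)).symm.trans h1
  exact congr(($h2).hom n)

lemma tildeDesc_app' {R : CommRingCat.{u}} (M : (Spec R).Modules) (N : ModuleCat.{u} R) (φ : N →ₗ[R] Γ(M, ⊤)) (W : (Spec R).Opens) (n : N) :
   (tildeDesc M N φ).app W ((tilde.toOpen N W).hom n) = M.presheaf.map W.leTop.op (φ n) := by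
  rw [← tildeDesc_app M N φ n]
  have := congr(($((tildeDesc M N φ).mapPresheaf.naturality W.leTop.op)) ((tilde.toOpen N ⊤).hom n))
  exact this

lemma exists_res_eq_zero {X : TopCat.{u}} (P : TopCat.Presheaf Ab.{u} X) {W : Opens X} {x : X} (hx : x ∈ W)
    (t : P.obj (op W)) (h : P.germ W x hx t = 0) : ∃ (W' : Opens X) (_ : x ∈ W') (i : W' ⟶ W), P.map i.op t = 0 := by
  obtain ⟨W', hx', i, i', h⟩ := P.germ_eq x hx hx t 0 (h.trans (map_zero (P.germ W x hx).hom).symm)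
  exact ⟨W', hx', i, h.trans (map_zero (P.map i'.op).hom)⟩

/-- A morphism of sheaves of modules is an isomorphism if it is injective and surjective on germs. -/
lemma Modules.isIso_of_stalk {X : Scheme.{u}} {M N : X.Modules} (ψ : M ⟶ N)
    (hinj : ∀ (x : X) (W : X.Opens) (hx : x ∈ W) (t : Γ(M, W)), ψ.app W t = 0 → M.presheaf.germ W x hx t = 0)
    (hsurj : ∀ (x : X) (W : X.Opens) (hx : x ∈ W) (s : Γ(N, W)),
       ∃ (W' : X.Opens) (hx' : x ∈ W') (t : Γ(M, W')),
        N.presheaf.germ W' x hx' (ψ.app W' t) = N.presheaf.germ W x hx s) : IsIso ψ := by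
  have h0 : ∀ x, IsIso ((TopCat.Presheaf.stalkFunctor Ab.{u} x).map ψ.mapPresheaf) := fun x => by
    rw [ConcreteCategory.isIso_iff_bijective]
    constructor
    · refine (injective_iff_map_eq_zero _).2 fun t ht => ?_
      obtain ⟨W, hx, t, rfl⟩ := M.presheaf.exists_germ_eq t
      have ht' := (TopCat.Presheaf.stalkFunctor_map_germ_apply W x hx ψ.mapPresheaf t).symm.trans ht
      obtain ⟨W', hx', i, h⟩ := exists_res_eq_zero _ hx _ ht'
      rw [← M.presheaf.germ_res_apply i x hx' t]
      refine hinj x W' hx' _ (Eq.trans ?_ h)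
      exact congr(($(ψ.mapPresheaf.naturality i.op)) t)
    · intro s
      obtain ⟨W, hx, s, rfl⟩ := N.presheaf.exists_germ_eq s
      obtain ⟨W', hx', t, ht⟩ := hsurj x W hx s
      refine ⟨M.presheaf.germ W' x hx' t, ?_⟩
      rw [TopCat.Presheaf.stalkFunctor_map_germ_apply W' x hx' ψ.mapPresheaf t]
      exact ht
  let ψ' : (⟨M.presheaf, M.isSheaf⟩ : TopCat.Sheaf Ab.{u} X) ⟶ ⟨N.presheaf, N.isSheaf⟩ := ⟨ψ.mapPresheaf⟩
  have : ∀ x, IsIso ((TopCat.Presheaf.stalkFunctor Ab.{u} x).map ψ'.hom) := h0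
  have h1 : IsIso ψ' := TopCat.Presheaf.isIso_of_stalkFunctor_map_iso ψ'
  have h2 : IsIso ψ.mapPresheaf := (sheafToPresheaf _ _).map_isIso ψ'
  rw [Scheme.Modules.Hom.isIso_iff_isIso_app]
  intro U
  exact (NatTrans.isIso_iff_isIso_app ψ.mapPresheaf).1 h2 (op U)

/-- A function that does not vanish at `x` is cancellable on germs. -/
lemma Spec.germ_smul_cancel {R : CommRingCat.{u}} (M : (Spec R).Modules) {W : (Spec R).Opens} {x : Spec R} (hx : x ∈ W)
    (r : R) (hr : W ≤ specBasic r) {s t : Γ(M, W)} (h : M.presheaf.germ W x hx (r • s) = M.presheaf.germ W x hx (r • t)) :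
    M.presheaf.germ W x hx s = M.presheaf.germ W x hx t := by
  obtain ⟨W', hx', i, i', h⟩ := M.presheaf.germ_eq x hx hx _ _ h
  obtain rfl : i = i' := Subsingleton.elim _ _
  rw [Scheme.Modules.map_smul_Spec, Scheme.Modules.map_smul_Spec] at h
  have := Scheme.Modules.isSMulRegular_of_le_basicOpen (M := M) (f := r) (i.le.trans hr) h
  rw [← M.presheaf.germ_res_apply i x hx', ← M.presheaf.germ_res_apply i x hx' t, this]

lemma specBasic_pow {R : CommRingCat.{u}} {W : (Spec R).Opens} {r : R} (h : W ≤ specBasic r) (k : ℕ) : W ≤ specBasic (r ^ k) := by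
  intro x hx hk
  exact h hx (x.isPrime.mem_of_pow_mem k hk)

/-- A map `N → Γ(M, ⊤)` identifies `M` with the sheaf associated with `N` if every stalk of `M` is the
localization of `N`; quasi-coherence of `M` is not assumed. -/
lemma tildeDesc_isIso {R : CommRingCat.{u}} (M : (Spec R).Modules) (N : ModuleCat.{u} R) (φ : N →ₗ[R] Γ(M, ⊤))
   (hsurj : ∀ (x : Spec R) (W : (Spec R).Opens) (hx : x ∈ W) (s : Γ(M, W)),
      ∃ (r : R) (_ : x ∈ specBasic r) (n : N),
        M.presheaf.germ ⊤ x trivial (φ n) = M.presheaf.germ W x hx (r • s))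
   (hinj : ∀ (x : Spec R) (n : N), M.presheaf.germ ⊤ x trivial (φ n) = 0 → ∃ (r : R) (_ : x ∈ specBasic r), r • n = 0) :
   IsIso (tildeDesc M N φ) := by
  refine Modules.isIso_of_stalk _ (fun x W hx t ht => ?_) (fun x W hx s => ?_)
  · obtain ⟨a, ⟨_, ⟨r, rfl⟩, rfl⟩, hxr, hrU⟩ :=
      PrimeSpectrum.isBasis_basic_opens.exists_subset_of_mem_open hx W.2
    have hrW : specBasic r ≤ W := hrU
    have hxr : x ∈ specBasic r := hxr
    set t' := (tilde N).presheaf.map (homOfLE hrW).op t with ht'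
    have htt : (tildeDesc M N φ).app (specBasic r) t' = 0 := by
      refine Eq.trans congr(($((tildeDesc M N φ).mapPresheaf.naturality (homOfLE hrW).op)) t) ?_
      refine Eq.trans (congrArg (M.presheaf.map (homOfLE hrW).op) ht) ?_
      exact map_zero (M.presheaf.map (homOfLE hrW).op).hom
    obtain ⟨k, n, hn⟩ := tilde_surj N r t'
    have h1 : M.presheaf.germ ⊤ x trivial (φ n) = 0 := by
      rw [← M.presheaf.germ_res_apply (specBasic r).leTop x hxr (φ n), ← tildeDesc_app', ← hn]
      have : (tildeDesc M N φ).app (specBasic r) (r ^ k • t') = 0 := by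
        rw [Scheme.Modules.smul_Spec_def, Scheme.Modules.Hom.app_smul, htt, smul_zero]
      rw [this]
      exact map_zero (M.presheaf.germ _ x hxr).hom
    obtain ⟨r', hr', h2⟩ := hinj x n h1
    rw [← (tilde N).presheaf.germ_res_apply (homOfLE hrW) x hxr t, ← ht']
    have h3 : r' • r ^ k • t' = 0 := by
      rw [hn]
      exact ((tilde.toOpen N (specBasic r)).hom.map_smul r' n).symm.trans
        ((congrArg (tilde.toOpen N (specBasic r)).hom h2).trans
          (map_zero (tilde.toOpen N (specBasic r)).hom))
    let W2 : (Spec R).Opens := specBasic r ⊓ specBasic r'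
    have hx2 : x ∈ W2 := ⟨hxr, hr'⟩
    rw [← (tilde N).presheaf.germ_res_apply (homOfLE (inf_le_left : W2 ≤ specBasic r)) x hx2 t']
    have h4 := congrArg ((tilde N).presheaf.map (homOfLE (inf_le_left : W2 ≤ specBasic r)).op) h3
    rw [Scheme.Modules.map_smul_Spec, Scheme.Modules.map_smul_Spec] at h4
    have h5 := isUnit_smul_injective (tilde N) r' (inf_le_right) _ (h4.trans (map_zero ((tilde N).presheaf.map _).hom))
    have h6 := isUnit_smul_injective (tilde N) _ (specBasic_pow inf_le_left k) _ h5
    rw [h6]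
    exact map_zero ((tilde N).presheaf.germ _ x hx2).hom
  · obtain ⟨r, hr, n, hn⟩ := hsurj x W hx s
    let W' : (Spec R).Opens := W ⊓ specBasic r
    have hx' : x ∈ W' := ⟨hx, hr⟩
    have hu := Scheme.Modules.isUnit_algebraMap_end_of_le_basicOpen (M := tilde N) (U := W') r inf_le_right
    rw [Module.End.isUnit_iff] at hu
    obtain ⟨t, ht⟩ := hu.2 ((tilde.toOpen N W').hom n)
    have ht : r • t = (tilde.toOpen N W').hom n := ht
    refine ⟨W', hx', t, ?_⟩
    rw [← M.presheaf.germ_res_apply (homOfLE (inf_le_left : W' ≤ W)) x hx' s]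
    refine Spec.germ_smul_cancel M hx' r inf_le_right ?_
    have h1 : r • (tildeDesc M N φ).app W' t = M.presheaf.map W'.leTop.op (φ n) := by
      rw [← tildeDesc_app', ← ht, Scheme.Modules.smul_Spec_def, Scheme.Modules.smul_Spec_def,
        Scheme.Modules.Hom.app_smul]
    rw [h1, ← Scheme.Modules.map_smul_Spec, M.presheaf.germ_res_apply, M.presheaf.germ_res_apply]
    exact hn

/-! ### A stalkwise criterion for quasi-coherence and finiteness -/

open Scheme.Modules in
/-- Presentations on an affine cover make a sheaf quasi-coherent. -/
lemma qc_of_presentation {X : Scheme.{u}} (M : X.Modules) {I : Type u} (U : I → X.Opens)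
    (hU : ∀ i, IsAffineOpen (U i)) (hcov : ∀ x, ∃ i, x ∈ U i)
    (h : ∀ i, Nonempty ((M.restrict (hU i).fromSpec).Presentation)) : M.IsQuasicoherent := by
  refine SheafOfModules.QuasicoherentData.isQuasicoherent.{u, u, u, u}
    (SheafOfModules.QuasicoherentData.mk.{u, u, u, u} (R := X.ringCatSheaf) I U ?_ fun i => ?_)
  · rw [Opens.coversTop_iff, IsOpenCover, eq_top_iff]
    intro x _
    obtain ⟨i, hi⟩ := hcov x
    exact Opens.mem_iSup.2 ⟨i, hi⟩
  · let α := ((restrictFunctorComp (hU i).isoSpec.hom (hU i).fromSpec).symm ≪≫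
      restrictFunctorCongr (hU i).isoSpec_hom_fromSpec).app M
    have : IsIso (C := SheafOfModules.{u} (U i).toScheme.ringCatSheaf) α.hom := α.isIso_hom
    have e1 : (M.restrict (U i).ι).Presentation := SheafOfModules.Presentation.ofIsIso.{u, u, u} α.hom
      (presentationRestrict (hU i).isoSpec.hom (h i).some)
    let E := (U i).sheafOfModulesEquivOver X.ringCatSheaf
    let β : E.inverse.obj (M.restrict (U i).ι) ≅ SheafOfModules.over M (U i) :=
      (E.inverse.mapIso ((overFunctorEquiv (U i)).app M)).symm ≪≫
        (E.unitIso.app (SheafOfModules.over M (U i))).symm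
    have : Limits.PreservesColimitsOfSize.{u, u} E.inverse :=
      E.symm.toAdjunction.leftAdjoint_preservesColimits
    have e2 := SheafOfModules.Presentation.map.{u, u, u}
      (R := (U i).sheafRestrict.obj X.ringCatSheaf) (M := M.restrict (U i).ι) e1 E.inverse
      ((U i).sheafOfModulesEquivOverInverseUnit X.ringCatSheaf).symm
    exact SheafOfModules.Presentation.ofIsIso.{u, u, u} β.hom e2

/-- Germs of a sheaf restricted along an open immersion agree exactly if the germs of the sheaf do. -/
lemma Modules.restrict_germ_eq {X Y : Scheme.{u}} (f : Y ⟶ X) [IsOpenImmersion f] (M : X.Modules)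
    {W W' : Y.Opens} (y : Y) (hy : y ∈ W) (hy' : y ∈ W') (hfy : f y ∈ f ''ᵁ W) (hfy' : f y ∈ f ''ᵁ W')
    (s : Γ(M, f ''ᵁ W)) (s' : Γ(M, f ''ᵁ W')) :
    (M.restrict f).presheaf.germ W y hy ((M.restrictAppIso f W).inv s) =
      (M.restrict f).presheaf.germ W' y hy' ((M.restrictAppIso f W').inv s') ↔
    M.presheaf.germ _ (f y) hfy s = M.presheaf.germ _ (f y) hfy' s' := by
  have h1 := congr($(Scheme.Modules.germ_restrictStalkNatIso_hom_app f y M hy) ((M.restrictAppIso f W).inv s))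
  have h2 := congr($(Scheme.Modules.germ_restrictStalkNatIso_hom_app f y M hy') ((M.restrictAppIso f W').inv s'))
  have hinj : Function.Injective ((Scheme.Modules.restrictStalkNatIso f y).hom.app M) :=
    (ConcreteCategory.bijective_of_isIso _).1
  constructor
  · intro h
    exact h1.symm.trans ((congrArg _ h).trans h2)
  · intro h
    exact hinj (h1.trans (h.trans h2.symm))

/-- If all stalks of `M` at the points of an affine open set `U` are the localizations of a module `N`, via a
map `φ` to the sections, then `M` is over `U` the sheaf associated with `N`. -/
lemma fromSpec_presentation {X : Scheme.{u}} (M : X.Modules) {U : X.Opens} (hU : IsAffineOpen U)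
    (N : Type u) [AddCommGroup N] [Module Γ(X, U) N] (φ : N →ₗ[Γ(X, U)] Γ(M, U))
    (hsurj : ∀ (x : X) (hx : x ∈ U) (W : X.Opens) (hW : W ≤ U) (hxW : x ∈ W) (s : Γ(M, W)),
      ∃ (r : Γ(X, U)) (_ : x ∈ X.basicOpen r) (n : N),
        M.presheaf.germ U x hx (φ n) = M.presheaf.germ W x hxW (X.presheaf.map (homOfLE hW).op r • s))
    (hinj : ∀ (x : X) (hx : x ∈ U) (n : N), M.presheaf.germ U x hx (φ n) = 0 →
      ∃ (r : Γ(X, U)) (_ : x ∈ X.basicOpen r), r • n = 0) :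
    Nonempty ((M.restrict hU.fromSpec).Presentation) ∧ Function.Bijective φ := by
  have e0 : hU.fromSpec ''ᵁ ⊤ = U := by simp
  let M' := M.restrict hU.fromSpec
  let τ : Γ(M, U) →+ Γ(M', ⊤) := (M.presheaf.map (homOfLE e0.le).op ≫ (M.restrictAppIso hU.fromSpec ⊤).inv).hom
  have hτ : Function.Bijective τ := by
    have : IsIso (homOfLE e0.le) := inferInstanceAs (IsIso (eqToHom e0))
    exact ConcreteCategory.bijective_of_isIso
      (M.presheaf.map (homOfLE e0.le).op ≫ (M.restrictAppIso hU.fromSpec ⊤).inv)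
  let φ' : N →ₗ[Γ(X, U)] Γ(M', ⊤) :=
    { toFun := fun n => τ (φ n)
      map_add' := by simp
      map_smul' := fun r n => by
        rw [φ.map_smul]
        refine Eq.trans ?_ (qc_smul M hU e0.le r (τ (φ n))).symm
        exact Scheme.Modules.map_smul M (homOfLE e0.le) r (φ n) }
  have hle : ∀ W : (Spec Γ(X, U)).Opens, hU.fromSpec ''ᵁ W ≤ U :=
    fun W => (hU.fromSpec.image_mono le_top).trans e0.le
  have hmem' : ∀ x : Spec Γ(X, U), hU.fromSpec x ∈ hU.fromSpec ''ᵁ ⊤ := fun x => ⟨x, trivial, rfl⟩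
  have hmem : ∀ x : Spec Γ(X, U), hU.fromSpec x ∈ U := fun x => e0.le (hmem' x)
  have hxr : ∀ (x : Spec Γ(X, U)) (r : Γ(X, U)), hU.fromSpec x ∈ X.basicOpen r → x ∈ specBasic r :=
    fun x r h => (hU.fromSpec_preimage_basicOpen r).le h
  have key : IsIso (tildeDesc M' (ModuleCat.of _ N) φ') := by
    refine tildeDesc_isIso _ _ _ (fun x W hx s => ?_) (fun x n hn => ?_)
    · obtain ⟨r, hr, n, hn⟩ := hsurj (hU.fromSpec x) (hmem x) (hU.fromSpec ''ᵁ W) (hle W)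
        ⟨x, hx, rfl⟩ ((M.restrictAppIso hU.fromSpec W).hom s)
      refine ⟨r, hxr x r hr, n, ?_⟩
      have h1 := qc_smul M hU (hle W) r s
      have h2 := (Modules.restrict_germ_eq hU.fromSpec M x (W := ⊤) (W' := W) trivial hx (hmem' x) ⟨x, hx, rfl⟩
        (M.presheaf.map (homOfLE e0.le).op (φ n)) ((M.restrictAppIso hU.fromSpec W).hom (r • s))).2 (by
          rw [h1, M.presheaf.germ_res_apply]
          exact hn)
      exact h2
    · have h2 := (Modules.restrict_germ_eq hU.fromSpec M x (W := ⊤) (W' := ⊤) trivial trivial (hmem' x) (hmem' x)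
        (M.presheaf.map (homOfLE e0.le).op (φ n)) 0).1 (Eq.trans hn (by rw [map_zero, map_zero]))
      rw [M.presheaf.germ_res_apply, map_zero] at h2
      obtain ⟨r, hr, h⟩ := hinj _ (hmem x) n h2
      exact ⟨r, hxr x r hr, h⟩
  constructor
  · have : IsIso (C := SheafOfModules.{u} (Spec Γ(X, U)).ringCatSheaf) (tildeDesc M' (ModuleCat.of _ N) φ') := key
    exact ⟨SheafOfModules.Presentation.ofIsIso.{u, u, u} (tildeDesc M' (ModuleCat.of _ N) φ')
      (presentationTilde.{u} (ModuleCat.of _ N) .univ (by simp) _ (Submodule.span_eq _))⟩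
  · have : Function.Bijective φ' := by
      have h1 : Function.Bijective ((tildeDesc M' (ModuleCat.of _ N) φ').app ⊤) :=
        ConcreteCategory.bijective_of_isIso _
      have h2 : Function.Bijective (tilde.toOpen (ModuleCat.of Γ(X, U) N) ⊤).hom :=
        ConcreteCategory.bijective_of_isIso (tilde.toOpen (ModuleCat.of Γ(X, U) N) ⊤)
      have h3 := h1.comp h2
      convert h3 using 1
      funext n
      exact (tildeDesc_app M' (ModuleCat.of _ N) φ' n).symm
    exact (Function.Bijective.of_comp_iff' hτ φ).1 this

section Finiteness

variable {X : Scheme.{u}} (M : X.Modules) {U : X.Opens} (f : Γ(X, U))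

/-- Sections over `D(f)` as a module over the sections of the structure sheaf over `U`. -/
@[reducible] def modBasicOpen : Module Γ(X, U) Γ(M, X.basicOpen f) :=
  Module.compHom _ (algebraMap Γ(X, U) Γ(X, X.basicOpen f))

attribute [local instance] modBasicOpen

instance : IsScalarTower Γ(X, U) Γ(X, X.basicOpen f) Γ(M, X.basicOpen f) :=
  IsScalarTower.of_algebraMap_smul fun _ _ => rfl

/-- Restriction of sections to `D(f)` as a linear map. -/
def resBasicOpen : Γ(M, U) →ₗ[Γ(X, U)] Γ(M, X.basicOpen f) where
  toFun := M.presheaf.map (homOfLE (X.basicOpen_le f)).op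
  map_add' := map_add _
  map_smul' r m := Scheme.Modules.map_smul M (homOfLE (X.basicOpen_le f)) r m

lemma isLocalizedModule_resBasicOpen [M.IsQuasicoherent] (hU : IsAffineOpen U) :
    IsLocalizedModule.Away f (resBasicOpen M f) := by
  obtain ⟨h1, h2⟩ := qc_loc M hU f
  have hl := hU.isLocalization_basicOpen f
  refine IsLocalizedModule.Away.mk_of_addCommGroup ?_ ?_ ?_
  · have := (IsLocalization.Away.algebraMap_isUnit (S := Γ(X, X.basicOpen f)) f).map
      (algebraMap Γ(X, X.basicOpen f) (Module.End Γ(X, X.basicOpen f) Γ(M, X.basicOpen f)))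
    rw [Module.End.isUnit_iff] at this ⊢
    exact this
  · intro s
    obtain ⟨n, t, ht⟩ := h1 s
    refine ⟨n, t, Eq.trans ?_ ht.symm⟩
    change algebraMap Γ(X, U) Γ(X, X.basicOpen f) (f ^ n) • s = _
    rw [map_pow]
    rfl
  · exact fun t ht => h2 t ht

/-- Finiteness of the sections of a quasi-coherent sheaf over affine open sets can be checked
on an affine cover. -/
lemma qc_finite [M.IsQuasicoherent] {I : Type*} (U : I → X.Opens)
    (hU : ∀ i, IsAffineOpen (U i)) (hcov : ∀ x, ∃ i, x ∈ U i)
    (h : ∀ i, Module.Finite Γ(X, U i) Γ(M, U i)) {V : X.Opens} (hV : IsAffineOpen V) :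
    Module.Finite Γ(X, V) Γ(M, V) := by
  refine of_affine_open_cover (P := fun V => Module.Finite Γ(X, V.1) Γ(M, V.1))
    (fun i => ⟨U i, hU i⟩) ?_ ⟨V, hV⟩ ?_ ?_ h
  · rw [eq_top_iff]
    intro x _
    obtain ⟨i, hi⟩ := hcov x
    exact Opens.mem_iSup.2 ⟨i, hi⟩
  · intro W g hW
    have := isLocalizedModule_resBasicOpen M g W.2
    have := W.2.isLocalization_basicOpen g
    change Module.Finite Γ(X, X.basicOpen g) Γ(M, X.basicOpen g)
    exact Module.Finite.of_isLocalizedModule (Rₚ := Γ(X, X.basicOpen g)) (.powers g) (resBasicOpen M g)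
  · intro W s hs H
    have := fun g : s => isLocalizedModule_resBasicOpen M g.1 W.2
    have := fun g : s => W.2.isLocalization_basicOpen g.1
    have H' : ∀ g : s, Module.Finite Γ(X, X.basicOpen g.1) Γ(M, X.basicOpen g.1) := H
    exact Module.Finite.of_localizationSpan_finite' s hs (fun g => resBasicOpen M g.1) H'

end Finiteness

/-! ### Extension of scalars along ring homomorphisms, as a property -/

section BaseChange

variable {A B C : Type u} [Ring A] [Ring B] [Ring C] {f : A →+* B} {g : B →+* C}
variable {M N P : Type u} [AddCommGroup M] [Module A M] [AddCommGroup N] [Module B N]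
  [AddCommGroup P] [Module C P]

/-- The semilinear map `μ : M → N` over `f : A → B` identifies `N` with `B ⊗_A M`. -/
structure IsBC (f : A →+* B) (μ : M →+ N) : Prop where
  semi : ∀ (a : A) (m : M), μ (a • m) = f a • μ m
  bij : Function.Bijective (Extend.lift f μ semi)

lemma Extend.one_apply (m : M) : Extend.one f m = Extend.tmul f 1 m := rfl

lemma Extend.smul_one (b : B) (m : M) : b • Extend.one f m = Extend.tmul f b m := by
  rw [Extend.one_apply, Extend.smul_tmul, mul_one]

lemma Extend.lift_one (μ : M →+ N) (h : ∀ (a : A) (m : M), μ (a • m) = f a • μ m) (m : M) :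
    Extend.lift f μ h (Extend.one f m) = μ m :=
  (Extend.lift_tmul f μ h 1 m).trans (_root_.one_smul B _)

lemma Extend.span_one : Submodule.span B (Set.range (Extend.one f (M := M))) = ⊤ := by
  rw [eq_top_iff]
  intro z _
  obtain ⟨z, rfl⟩ := (balanced f M).mkQ_surjective z
  induction z using TensorProduct.induction_on with
  | zero => rw [map_zero]; exact zero_mem _
  | tmul b m =>
    have : (balanced f M).mkQ (b ⊗ₜ[ℤ] m) = b • Extend.one f m := (Extend.smul_one b m).symm
    rw [this]
    exact Submodule.smul_mem _ _ (Submodule.subset_span ⟨m, rfl⟩)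
  | add x y hx hy => rw [map_add]; exact add_mem (hx trivial) (hy trivial)

namespace IsBC

variable {μ : M →+ N}

lemma extend : IsBC f (Extend.one f (M := M)) := by
  refine ⟨Extend.one_smul f, ?_⟩
  have : Extend.lift f (Extend.one f (M := M)) (Extend.one_smul f) = LinearMap.id :=
    Extend.hom_ext f fun m => Extend.lift_one _ _ m
  rw [this]
  exact Function.bijective_id

/-- It suffices to give a section of `B ⊗_A M → N` on a generated module. -/
lemma mk' (semi : ∀ (a : A) (m : M), μ (a • m) = f a • μ m)
    (span : Submodule.span B (Set.range μ) = ⊤) (σ : N →ₗ[B] Extend f M)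
    (hσ : ∀ m, σ (μ m) = Extend.one f m) : IsBC f μ := by
  refine ⟨semi, Function.bijective_iff_has_inverse.2 ⟨σ, fun z => ?_, fun n => ?_⟩⟩
  · have : σ ∘ₗ Extend.lift f μ semi = LinearMap.id := Extend.hom_ext f fun m => by
      change σ (Extend.lift f μ semi (Extend.one f m)) = Extend.one f m
      rw [Extend.lift_one, hσ]
    exact congr($this z)
  · have : Extend.lift f μ semi ∘ₗ σ = LinearMap.id := LinearMap.ext_on_range span fun m => by
      change Extend.lift f μ semi (σ (μ m)) = μ m
      rw [hσ, Extend.lift_one]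
    exact congr($this n)

/-- The inverse of the isomorphism `B ⊗_A M → N`. -/
def inv (h : IsBC f μ) : N →ₗ[B] Extend f M := (LinearEquiv.ofBijective _ h.bij).symm.toLinearMap

lemma inv_apply (h : IsBC f μ) (m : M) : h.inv (μ m) = Extend.one f m := by
  refine (LinearEquiv.symm_apply_eq _).2 ?_
  exact (Extend.lift_one μ h.semi m).symm

lemma span (h : IsBC f μ) : Submodule.span B (Set.range μ) = ⊤ := by
  have h1 := congrArg (Submodule.map (Extend.lift f μ h.semi)) (Extend.span_one (f := f) (M := M))
  rw [Submodule.map_span, Submodule.map_top, LinearMap.range_eq_top.2 h.bij.2, ← Set.range_comp] at h1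
  rw [← h1]
  congr 2
  funext m
  exact (Extend.lift_one μ h.semi m).symm

variable {Q : Type u} [AddCommGroup Q] [Module B Q]

/-- The `B`-linear extension of an `A`-semilinear map `M → Q` to `N = B ⊗_A M`. -/
def lift (h : IsBC f μ) (ν : M →+ Q) (hν : ∀ (a : A) (m : M), ν (a • m) = f a • ν m) : N →ₗ[B] Q :=
  Extend.lift f ν hν ∘ₗ h.inv

lemma lift_apply (h : IsBC f μ) (ν : M →+ Q) (hν : ∀ (a : A) (m : M), ν (a • m) = f a • ν m) (m : M) :
    h.lift ν hν (μ m) = ν m := by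
  rw [lift, LinearMap.comp_apply, inv_apply, Extend.lift_one]

lemma ext (h : IsBC f μ) {φ ψ : N →ₗ[B] Q} (H : ∀ m, φ (μ m) = ψ (μ m)) : φ = ψ :=
  LinearMap.ext_on_range h.span H

lemma comp (h : IsBC f μ) {ν : N →+ P} (h' : IsBC g ν) : IsBC (g.comp f) (ν.comp μ) := by
  have semi : ∀ (a : A) (m : M), ν.comp μ (a • m) = (g.comp f) a • ν.comp μ m := fun a m => by
    change ν (μ (a • m)) = g (f a) • ν (μ m)
    rw [h.semi, h'.semi]
  let _ : Module B (Extend (g.comp f) M) := Module.compHom _ g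
  let σ₁ : N →ₗ[B] Extend (g.comp f) M := h.lift (Extend.one (g.comp f)) (Extend.one_smul (g.comp f))
  let σ : P →ₗ[C] Extend (g.comp f) M := h'.lift σ₁.toAddMonoidHom σ₁.map_smul
  refine mk' semi ?_ σ fun m => ?_
  · rw [eq_top_iff, ← h'.span, Submodule.span_le]
    rintro _ ⟨n, rfl⟩
    have hn : n ∈ Submodule.span B (Set.range μ) := h.span ▸ trivial
    induction hn using Submodule.span_induction with
    | mem x hx => obtain ⟨m, rfl⟩ := hx; exact Submodule.subset_span ⟨m, rfl⟩
    | zero => rw [map_zero]; exact zero_mem _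
    | add x y _ _ hx hy => rw [map_add]; exact add_mem hx hy
    | smul b x _ hx => rw [h'.semi]; exact Submodule.smul_mem _ _ hx
  · exact (h'.lift_apply σ₁.toAddMonoidHom σ₁.map_smul (μ m)).trans
      (h.lift_apply (Extend.one (g.comp f)) (Extend.one_smul (g.comp f)) m)

/-- Cancellation: if `M → N` and `M → P` are extensions of scalars, then so is `N → P`. -/
lemma of_comp (h : IsBC f μ) {ν : N →+ P} (hν : ∀ (b : B) (n : N), ν (b • n) = g b • ν n)
    (h' : IsBC (g.comp f) (ν.comp μ)) : IsBC g ν := by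
  let σ₁ : M →+ Extend g N := (Extend.one g).comp μ
  have hσ₁ : ∀ (a : A) (m : M), σ₁ (a • m) = (g.comp f) a • σ₁ m := fun a m => by
    change Extend.one g (μ (a • m)) = g (f a) • Extend.one g (μ m)
    rw [h.semi, Extend.one_smul]
  refine mk' hν ?_ (h'.lift σ₁ hσ₁) fun n => ?_
  · rw [eq_top_iff, ← h'.span]
    refine Submodule.span_mono ?_
    rintro _ ⟨m, rfl⟩
    exact ⟨μ m, rfl⟩
  · have hn : n ∈ Submodule.span B (Set.range μ) := h.span ▸ trivial
    induction hn using Submodule.span_induction with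
    | mem x hx => obtain ⟨m, rfl⟩ := hx; exact h'.lift_apply σ₁ hσ₁ m
    | zero => rw [map_zero, map_zero, map_zero]
    | add x y _ _ hx hy => rw [map_add, map_add, map_add, hx, hy]
    | smul b x _ hx => rw [hν, map_smul, hx, Extend.one_smul]

/-- If `M → N` and `M → N'` are extensions of scalars to `B`, then every compatible linear map
`N → N'` is bijective. -/
lemma bijective (h : IsBC f μ) {μ' : M →+ Q} (h' : IsBC f μ') (φ : N →ₗ[B] Q)
    (hφ : ∀ m, φ (μ m) = μ' m) : Function.Bijective φ := by
  let ψ : Q →ₗ[B] N := h'.lift μ h.semi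
  refine Function.bijective_iff_has_inverse.2 ⟨ψ, fun n => ?_, fun n => ?_⟩
  · have : ψ ∘ₗ φ = LinearMap.id := h.ext fun m => by
      change ψ (φ (μ m)) = μ m
      rw [hφ]
      exact h'.lift_apply μ h.semi m
    exact congr($this n)
  · have : φ ∘ₗ ψ = LinearMap.id := h'.ext fun m => by
      change φ (ψ (μ' m)) = μ' m
      exact (congrArg φ (h'.lift_apply μ h.semi m)).trans (hφ m)
    exact congr($this n)

end IsBC

/-- A finite dual basis of an `A`-module. -/
lemma exists_dualBasis (M : Type u) [AddCommGroup M] [Module A M] [Module.Finite A M] [Module.Projective A M] :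
    ∃ (n : ℕ) (φ : Fin n → M →ₗ[A] A) (v : Fin n → M), ∀ m, ∑ i, φ i m • v i = m := by
  obtain ⟨n, p, s, hp, hs, h⟩ := Module.Finite.exists_comp_eq_id_of_projective A M
  refine ⟨n, fun i => LinearMap.proj i ∘ₗ s, fun i => p (Pi.single i 1), fun m => ?_⟩
  have h1 : p (s m) = m := congr($h m)
  conv_rhs => rw [← h1]
  conv_rhs => rw [pi_eq_sum_univ' (s m), map_sum]
  refine Finset.sum_congr rfl fun i _ => ?_
  rw [map_smul]
  rfl

lemma projective_of_dualBasis {ι : Type*} [Fintype ι] (φ : ι → M →ₗ[A] A) (v : ι → M)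
    (h : ∀ m, ∑ i, φ i m • v i = m) : Module.Finite A M ∧ Module.Projective A M := by
  classical
  let p : (ι → A) →ₗ[A] M := Fintype.linearCombination A v
  have hp : p ∘ₗ LinearMap.pi φ = LinearMap.id := LinearMap.ext fun m => by
    simp [p, Fintype.linearCombination_apply, h]
  exact ⟨Module.Finite.of_surjective p fun m => ⟨LinearMap.pi φ m, congr($hp m)⟩,
    Module.Projective.of_split (LinearMap.pi φ) p hp⟩

namespace IsBC

variable {μ : M →+ N}

/-- Dual bases extend along an extension of scalars. -/
lemma exists_dualBasis (h : IsBC f μ) [Module.Finite A M] [Module.Projective A M] :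
    ∃ (n : ℕ) (φ : Fin n → M →ₗ[A] A) (v : Fin n → M) (φ' : Fin n → N →ₗ[B] B),
      (∀ m, ∑ i, φ i m • v i = m) ∧ (∀ i m, φ' i (μ m) = f (φ i m)) ∧
        ∀ x, ∑ i, φ' i x • μ (v i) = x := by
  obtain ⟨n, φ, v, hφ⟩ := NCCurve.exists_dualBasis (A := A) M
  have hs : ∀ i (a : A) (m : M), (f.toAddMonoidHom.comp (φ i).toAddMonoidHom) (a • m) =
      f a • (f.toAddMonoidHom.comp (φ i).toAddMonoidHom) m := fun i a m => by
    change f (φ i (a • m)) = f a * f (φ i m)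
    rw [map_smul, smul_eq_mul, map_mul]
  refine ⟨n, φ, v, fun i => h.lift (f.toAddMonoidHom.comp (φ i).toAddMonoidHom) (hs i), hφ,
    fun i m => h.lift_apply _ (hs i) m, fun x => ?_⟩
  have : ∑ i, (LinearMap.toSpanSingleton B N (μ (v i))) ∘ₗ h.lift _ (hs i) = LinearMap.id := h.ext fun m => by
    rw [LinearMap.sum_apply]
    simp only [LinearMap.comp_apply, h.lift_apply, LinearMap.toSpanSingleton_apply]
    conv_rhs => rw [LinearMap.id_apply, ← hφ m, map_sum]
    exact Finset.sum_congr rfl fun i _ => (h.semi _ _).symm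
  have := congr($this x)
  rwa [LinearMap.sum_apply] at this

lemma finite_projective (h : IsBC f μ) [Module.Finite A M] [Module.Projective A M] :
    Module.Finite B N ∧ Module.Projective B N := by
  obtain ⟨n, φ, v, φ', -, -, h3⟩ := h.exists_dualBasis
  exact projective_of_dualBasis φ' _ h3

/-- If every functional on the finitely generated projective module `M` extends to `N`, and `M`
generates `N`, then `N` is an extension of scalars of `M`. -/
lemma of_dual [Module.Finite A M] [Module.Projective A M]
    (semi : ∀ (a : A) (m : M), μ (a • m) = f a • μ m)
    (span : Submodule.span B (Set.range μ) = ⊤)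
    (hd : ∀ φ : M →ₗ[A] A, ∃ φ' : N →ₗ[B] B, ∀ m, φ' (μ m) = f (φ m)) : IsBC f μ := by
  obtain ⟨n, φ, v, hφ⟩ := NCCurve.exists_dualBasis (A := A) M
  choose φ' hφ' using fun i => hd (φ i)
  refine mk' semi span (∑ i, (LinearMap.toSpanSingleton B _ (Extend.one f (v i))) ∘ₗ φ' i) fun m => ?_
  rw [LinearMap.sum_apply]
  simp only [LinearMap.comp_apply, LinearMap.toSpanSingleton_apply, hφ', ← Extend.one_smul]
  rw [← map_sum, hφ]

end IsBC

end BaseChange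

/-! ### Localizations, and local criteria for modules over finite algebras -/

section Localization

variable {R : Type u} [CommRing R] {A A' : Type u} [Ring A] [Ring A']
  {M M' : Type u} [AddCommGroup M] [Module A M] [AddCommGroup M'] [Module A' M']

/-- The semilinear map `μ : M → M'` over `α : A → A'` is a localization at the image under
`ρ : R → A` of the multiplicative set `T`. -/
structure LocAt (T : Submonoid R) (ρ : R →+* A) (α : A →+* A') (μ : M →+ M') : Prop where
  semi : ∀ (a : A) (m : M), μ (a • m) = α a • μ m
  unit : ∀ t ∈ T, IsUnit (α (ρ t))
  surj : ∀ m' : M', ∃ t ∈ T, ∃ m, α (ρ t) • m' = μ m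
  inj : ∀ m : M, μ m = 0 → ∃ t ∈ T, ρ t • m = 0

namespace LocAt

variable {T : Submonoid R} {ρ : R →+* A} {α : A →+* A'} {μ : M →+ M'}

lemma exists_common {ι : Type*} [Finite ι] (h : LocAt T ρ α μ) (x : ι → M') :
    ∃ t ∈ T, ∃ m : ι → M, ∀ i, α (ρ t) • x i = μ (m i) := by
  classical
  cases nonempty_fintype ι
  choose t ht m hm using fun i => h.surj (x i)
  refine ⟨∏ i, t i, Submonoid.prod_mem _ fun i _ => ht i,
    fun i => ρ (∏ j ∈ Finset.univ.erase i, t j) • m i, fun i => ?_⟩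
  rw [h.semi, ← hm, ← mul_smul, ← map_mul, ← map_mul, Finset.prod_erase_mul _ _ (Finset.mem_univ i)]

lemma exists_kill {ι : Type*} [Finite ι] (h : LocAt T ρ α μ) (m : ι → M) (hm : ∀ i, μ (m i) = 0) :
    ∃ t ∈ T, ∀ i, ρ t • m i = 0 := by
  classical
  cases nonempty_fintype ι
  choose t ht h using fun i => h.inj (m i) (hm i)
  refine ⟨∏ i, t i, Submonoid.prod_mem _ fun i _ => ht i, fun i => ?_⟩
  rw [← Finset.prod_erase_mul _ _ (Finset.mem_univ i), map_mul, mul_smul, h, smul_zero]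

/-- Localizations are extensions of scalars. -/
lemma isBC (hA : LocAt T ρ α α.toAddMonoidHom) (h : LocAt T ρ α μ) : IsBC α μ := by
  have key : ∀ z : Extend α M, ∃ t ∈ T, ∃ m, α (ρ t) • z = Extend.one α m := by
    intro z
    have hz : z ∈ Submodule.span A' (Set.range (Extend.one α (M := M))) :=
      Extend.span_one (f := α) (M := M) ▸ trivial
    induction hz using Submodule.span_induction with
    | mem x hx => obtain ⟨m, rfl⟩ := hx; exact ⟨1, T.one_mem, m, by simp⟩
    | zero => exact ⟨1, T.one_mem, 0, by simp⟩
    | add x y _ _ hx hy =>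
      obtain ⟨t, ht, m, hm⟩ := hx
      obtain ⟨t', ht', m', hm'⟩ := hy
      refine ⟨t * t', T.mul_mem ht ht', ρ t' • m + ρ t • m', ?_⟩
      rw [map_add, Extend.one_smul, Extend.one_smul, ← hm, ← hm', smul_add, ← mul_smul, ← mul_smul,
        ← map_mul, ← map_mul, ← map_mul, ← map_mul, mul_comm t' t]
    | smul b x _ hx =>
      obtain ⟨t, ht, m, hm⟩ := hx
      obtain ⟨t', ht', a, ha⟩ := hA.surj (b * ↑(hA.unit t ht).unit⁻¹)
      refine ⟨t', ht', a • m, ?_⟩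
      have ha' : α (ρ t') * (b * ↑(hA.unit t ht).unit⁻¹) = α a := ha
      rw [Extend.one_smul, ← hm, ← ha', smul_smul, smul_smul, mul_assoc, mul_assoc,
        IsUnit.val_inv_mul, mul_one]
  refine ⟨h.semi, (injective_iff_map_eq_zero _).2 fun z hz => ?_, fun m' => ?_⟩
  · obtain ⟨t, ht, m, hm⟩ := key z
    have h1 : μ m = 0 := by
      rw [← Extend.lift_one μ h.semi, ← hm, map_smul, hz, smul_zero]
    obtain ⟨t', ht', h2⟩ := h.inj m h1
    have h3 : α (ρ t') • α (ρ t) • z = 0 := by rw [hm, ← Extend.one_smul, h2, map_zero]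
    exact (hA.unit t ht).smul_eq_zero.1 ((hA.unit t' ht').smul_eq_zero.1 h3)
  · obtain ⟨t, ht, m, hm⟩ := h.surj m'
    refine ⟨(↑(hA.unit t ht).unit⁻¹ : A') • Extend.one α m, ?_⟩
    rw [map_smul, Extend.lift_one, ← hm, smul_smul, IsUnit.val_inv_mul, one_smul]

end LocAt

/-- For finitely generated projective modules, extensions of scalars along a localization are
localizations. -/
lemma IsBC.locAt {T : Submonoid R} {ρ : R →+* A} {α : A →+* A'} {μ : M →+ M'}
    (h : IsBC α μ) (hA : LocAt T ρ α α.toAddMonoidHom) [Module.Finite A M] [Module.Projective A M] : LocAt T ρ α μ := by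
  obtain ⟨n, φ, v, φ', h1, h2, h3⟩ := h.exists_dualBasis
  refine ⟨h.semi, hA.unit, fun m' => ?_, fun m hm => ?_⟩
  · obtain ⟨t, ht, a, ha⟩ := hA.exists_common fun i => φ' i m'
    refine ⟨t, ht, ∑ i, a i • v i, ?_⟩
    conv_lhs => rw [← h3 m']
    rw [Finset.smul_sum, map_sum]
    refine Finset.sum_congr rfl fun i _ => ?_
    rw [h.semi, smul_smul]
    exact congrArg (· • μ (v i)) (ha i)
  · obtain ⟨t, ht, h4⟩ := hA.exists_kill (fun i => φ i m) fun i => by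
      change α (φ i m) = 0
      rw [← h2, hm, map_zero]
    refine ⟨t, ht, ?_⟩
    rw [← h1 m, Finset.smul_sum]
    refine Finset.sum_eq_zero fun i _ => ?_
    have h5 : ρ t * φ i m = 0 := h4 i
    rw [smul_smul, h5, zero_smul]

/-- The `A`-linear map `m ↦ ρ r • m`, for a central `ρ`. -/
def centralSMul (ρ : R →+* A) (hρ : ∀ r a, ρ r * a = a * ρ r) (r : R) : M →ₗ[A] M where
  toFun m := ρ r • m
  map_add' := smul_add _
  map_smul' a m := by rw [smul_smul, hρ, ← smul_smul, RingHom.id_apply]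

/-- Local-global principle: a finite module over a Noetherian algebra over a commutative ring is
projective if it is so locally at each maximal ideal of the base ring. -/
lemma projective_of_locAt [IsNoetherianRing A] [Module.Finite A M] (ρ : R →+* A)
    (hρ : ∀ r a, ρ r * a = a * ρ r)
    (h : ∀ p : Ideal R, p.IsMaximal → ∃ (T : Submonoid R) (_ : Disjoint (T : Set R) p)
      (A' M' : Type u) (_ : Ring A') (_ : AddCommGroup M') (_ : Module A' M') (α : A →+* A')
      (μ : M →+ M'), LocAt T ρ α α.toAddMonoidHom ∧ LocAt T ρ α μ ∧ Module.Projective A' M') :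
    Module.Projective A M := by
  obtain ⟨n, p, hp⟩ := Module.Finite.exists_fin' A M
  let 𝔞 : Ideal R :=
    { carrier := {r | ∃ s : M →ₗ[A] (Fin n → A), ∀ m, p (s m) = ρ r • m}
      zero_mem' := ⟨0, fun m => by simp⟩
      add_mem' := by
        rintro a b ⟨s, hs⟩ ⟨s', hs'⟩
        exact ⟨s + s', fun m => by rw [LinearMap.add_apply, map_add, hs, hs', map_add, add_smul]⟩
      smul_mem' := by
        rintro c a ⟨s, hs⟩
        refine ⟨s ∘ₗ centralSMul ρ hρ c, fun m => ?_⟩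
        rw [LinearMap.comp_apply, hs, smul_eq_mul, mul_comm c a, map_mul, mul_smul]
        rfl }
  -- The surjection `p` from a free module splits if and only if `1` belongs to the ideal `𝔞` of those `r` for
  -- which multiplication by `r` factors through `p`.
  have h1 : 𝔞 = ⊤ := by
    by_contra hne
    obtain ⟨q, hq, hle⟩ := Ideal.exists_le_maximal 𝔞 hne
    obtain ⟨T, hT, A', M', _, _, _, α, μ, hA, hM, hproj⟩ := h q hq
    have hbc := hA.isBC hM
    let e : Fin n → Fin n → A := fun i => Pi.single i 1
    let p' : (Fin n → A') →ₗ[A'] M' := Fintype.linearCombination A' fun i => μ (p (e i))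
    have hpe : ∀ w, p w = ∑ i, w i • p (e i) := fun w => by
      conv_lhs => rw [pi_eq_sum_univ' w, map_sum]
      exact Finset.sum_congr rfl fun i _ => map_smul _ _ _
    have hp'α : ∀ w : Fin n → A, p' (fun i => α (w i)) = μ (p w) := fun w => by
      rw [hpe, map_sum, Fintype.linearCombination_apply]
      exact Finset.sum_congr rfl fun i _ => (hM.semi _ _).symm
    have hp' : Function.Surjective p' := by
      rw [← LinearMap.range_eq_top, eq_top_iff, ← hbc.span, Submodule.span_le]
      rintro _ ⟨m, rfl⟩
      obtain ⟨w, rfl⟩ := hp m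
      exact ⟨_, hp'α w⟩
    obtain ⟨s', hs'⟩ := Module.projective_lifting_property p' LinearMap.id hp'
    obtain ⟨t, ht, w, hw⟩ := hA.exists_common fun ij : Fin n × Fin n => s' (μ (p (e ij.1))) ij.2
    -- `W` is the local section `s'` composed with `p`, with the denominator `t` cleared.
    let W : (Fin n → A) →ₗ[A] (Fin n → A) := Fintype.linearCombination A fun i j => w (i, j)
    have hW : ∀ (x : Fin n → A) j, α (W x j) = α (ρ t) * s' (μ (p x)) j := fun x j => by
      rw [hpe, map_sum, map_sum, Finset.sum_apply, Fintype.linearCombination_apply, Finset.sum_apply,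
        map_sum, Finset.mul_sum]
      refine Finset.sum_congr rfl fun i _ => ?_
      have h2 : α (ρ t) * s' (μ (p (e i))) j = α (w (i, j)) := hw (i, j)
      rw [hM.semi, map_smul]
      simp only [Pi.smul_apply, smul_eq_mul]
      rw [← mul_assoc, ← map_mul, hρ, map_mul, map_mul, mul_assoc, h2]
    have hfg : (LinearMap.ker p).FG := IsNoetherian.noetherian _
    -- After multiplication by `t'`, the map `W` vanishes on the finitely generated kernel of `p`, and descends
    -- to `M`.
    obtain ⟨k, r, hr⟩ := Submodule.fg_iff_exists_fin_generating_family.1 hfg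
    obtain ⟨t', ht', h3⟩ := hA.exists_kill (fun ij : Fin k × Fin n => W (r ij.1) ij.2) (fun ij => by
      have h4 : r ij.1 ∈ LinearMap.ker p := hr ▸ Submodule.subset_span ⟨ij.1, rfl⟩
      refine (hW _ _).trans ?_
      rw [LinearMap.mem_ker.1 h4, map_zero, map_zero, Pi.zero_apply, mul_zero])
    let s₀ : (Fin n → A) →ₗ[A] (Fin n → A) := centralSMul ρ hρ t' ∘ₗ W
    have hker : LinearMap.ker p ≤ LinearMap.ker s₀ := by
      rw [← hr, Submodule.span_le]
      rintro _ ⟨i, rfl⟩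
      exact funext fun j => h3 (i, j)
    -- Locally it is a section of `p` up to `t' * t`; multiplication by `t''` makes it so over `A`.
    obtain ⟨t'', ht'', h5⟩ := hM.exists_kill (fun i => p (W (e i)) - ρ t • p (e i)) (fun i => by
      rw [map_sub, ← hp'α, hM.semi]
      have : (fun j => α (W (e i) j)) = α (ρ t) • s' (μ (p (e i))) := funext fun j => hW _ _
      have h6 : p' (s' (μ (p (e i)))) = μ (p (e i)) := congr($hs' (μ (p (e i))))
      rw [this, map_smul, h6, sub_self])
    let s : M →ₗ[A] (Fin n → A) :=
      (LinearMap.ker p).liftQ s₀ hker ∘ₗ (p.quotKerEquivOfSurjective hp).symm.toLinearMap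
    have hs : ∀ x, s (p x) = s₀ x := fun x => by
      have : (p.quotKerEquivOfSurjective hp).symm (p x) = Submodule.Quotient.mk x :=
        (LinearEquiv.symm_apply_eq _).2 rfl
      change (LinearMap.ker p).liftQ s₀ hker ((p.quotKerEquivOfSurjective hp).symm (p x)) = _
      rw [this]
      rfl
    refine Set.disjoint_left.1 hT (T.mul_mem ht'' (T.mul_mem ht' ht)) (hle ⟨s ∘ₗ centralSMul ρ hρ t'', fun m => ?_⟩)
    have h7 : p ∘ₗ s ∘ₗ centralSMul ρ hρ t'' ∘ₗ p = centralSMul ρ hρ (t'' * (t' * t)) ∘ₗ p := by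
      refine LinearMap.pi_ext' fun i => LinearMap.ext_ring ?_
      change p (s (ρ t'' • p (e i))) = ρ (t'' * (t' * t)) • p (e i)
      rw [map_smul, hs, map_smul]
      change ρ t'' • p (ρ t' • W (e i)) = _
      have h8 := sub_eq_zero.1 ((smul_sub (ρ t'') _ _).symm.trans (h5 i))
      rw [map_smul, smul_smul, hρ, ← smul_smul, h8, smul_smul, smul_smul, ← map_mul, ← map_mul]
      congr 2
      ring
    obtain ⟨x, rfl⟩ := hp m
    exact congr($h7 x)
  obtain ⟨s, hs⟩ : (1 : R) ∈ 𝔞 := h1 ▸ trivial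
  exact Module.Projective.of_split s p (LinearMap.ext fun m => by
    rw [LinearMap.comp_apply, hs, map_one, one_smul, LinearMap.id_apply])

end Localization

/-! ### Modules supported at finitely many closed points -/

/-- A module over a Noetherian ring which is supported at finitely many maximal ideals is the
product of its localizations; the module is presented as `M / N`. -/
lemma exists_of_finite_support {S : Type u} [CommRing S] [IsNoetherianRing S] {M : Type u} [AddCommGroup M]
    [Module S M] (N : Submodule S M) (𝔞 : Ideal S) (h𝔞 : ∀ s ∈ 𝔞, ∀ m : M, s • m ∈ N)
    {Z : Type u} [Finite Z] (q : Z → Ideal S) [hq : ∀ z, (q z).IsMaximal] (hinj : Function.Injective q)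
    (hV : ∀ p : Ideal S, p.IsPrime → 𝔞 ≤ p → ∃ z, p = q z)
    {P : Z → Type u} [∀ z, AddCommGroup (P z)] [∀ z, Module S (P z)] (μ : ∀ z, M →ₗ[S] P z)
    (hs : ∀ z (x : P z), ∃ t ∉ q z, ∃ m, t • x = μ z m)
    (hreg : ∀ z, ∀ t ∉ q z, ∀ x : P z, t • x = 0 → x = 0)
    (h0 : ∀ z m, m ∈ N → μ z m = 0) (x : ∀ z, P z) : ∃ m, ∀ z, μ z m = x z := by
  classical
  cases nonempty_fintype Z
  -- The product of the maximal ideals `q z` has a power contained in `𝔞`.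
  have hle : (⨅ z, q z) ≤ 𝔞.radical := by
    rw [Ideal.radical_eq_sInf]
    refine le_sInf fun p hp => ?_
    obtain ⟨z, rfl⟩ := hV p hp.2 hp.1
    exact iInf_le _ z
  obtain ⟨n, hn⟩ := Ideal.exists_pow_le_of_le_radical_of_fg hle (IsNoetherian.noetherian _)
  have hcop : Pairwise fun z z' => IsCoprime (q z ^ n) (q z' ^ n) := fun z z' hz =>
    IsCoprime.pow (Ideal.isCoprime_of_isMaximal fun h => hz (hinj h))
  have hcop' : Pairwise fun z z' => IsCoprime (q z) (q z') := fun z z' hz =>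
    Ideal.isCoprime_of_isMaximal fun h => hz (hinj h)
  have hn' : ∀ r, (∀ z, r ∈ q z ^ n) → r ∈ 𝔞 := fun r hr => hn (by
    have h1 := Ideal.prod_eq_iInf_of_pairwise_isCoprime (s := Finset.univ) (hcop.set_pairwise _)
    have h2 := Ideal.prod_eq_iInf_of_pairwise_isCoprime (s := Finset.univ) (hcop'.set_pairwise _)
    simp only [Finset.mem_univ, iInf_pos] at h1 h2
    rw [← h2, ← Finset.prod_pow, h1]
    exact (Ideal.mem_iInf).2 hr)
  obtain ⟨e, he⟩ : ∃ e : Z → S, ∀ z z', e z - (if z = z' then 1 else 0) ∈ q z' ^ n := by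
    choose e he using fun z => Ideal.exists_forall_sub_mem_ideal hcop fun z' => if z = z' then 1 else 0
    exact ⟨e, he⟩
  have he1 : ∀ z, e z - 1 ∈ q z ^ n := fun z => by simpa using he z z
  have he0 : ∀ z z', z ≠ z' → e z ∈ q z' ^ n := fun z z' h => by simpa [h] using he z z'
  -- For `r ∈ q z ^ n` the product `e z * r` lies in all `q z' ^ n`, hence in `𝔞`, and `e z` acts injectively
  -- on `P z`.
  have hnil : ∀ z, ∀ r ∈ q z ^ n, ∀ y : P z, r • y = 0 := fun z r hr y => by
    by_cases hn0 : n = 0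
    · obtain ⟨t, ht, m, hm⟩ := hs z y
      have h1 : (1 : S) ∈ 𝔞 := hn' 1 fun z' => by rw [hn0, pow_zero, Ideal.one_eq_top]; trivial
      have h2 : μ z m = 0 := h0 z m (by simpa using h𝔞 1 h1 m)
      rw [hreg z t ht y (hm.trans h2), smul_zero]
    obtain ⟨t, ht, m, hm⟩ := hs z y
    have h1 : e z * r ∈ 𝔞 := hn' _ fun z' => by
      by_cases h : z = z'
      · subst h
        exact Ideal.mul_mem_left _ _ hr
      · exact Ideal.mul_mem_right _ _ (he0 z z' h)
    have h2 := h0 z _ (h𝔞 _ h1 m)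
    have h3 : e z ∉ q z := fun h => (hq z).ne_top ((Ideal.eq_top_iff_one _).2 (by
      have h4 := Ideal.pow_le_self hn0 (he1 z)
      simpa using sub_mem h h4))
    refine hreg z t ht _ (hreg z _ h3 _ ?_)
    rw [smul_comm t r, hm, ← map_smul, ← map_smul, smul_smul, h2]
  -- As `q z ^ n` kills `P z`, the elements outside `q z` already act invertibly, and `μ z` is surjective.
  have hone : ∀ z (y : P z), ∃ m, μ z m = y := fun z y => by
    obtain ⟨t, ht, m, hm⟩ := hs z y
    have hcop : IsCoprime (q z ^ n) (Ideal.span {t}) := by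
      obtain ⟨y, i, hi, h⟩ := (hq z).exists_inv ht
      refine IsCoprime.pow_left (Ideal.isCoprime_iff_exists.2 ⟨i, hi, y * t, ?_, by rw [add_comm, h]⟩)
      exact Ideal.mem_span_singleton'.2 ⟨y, rfl⟩
    obtain ⟨a, ha, b, hb, hab⟩ := Ideal.isCoprime_iff_exists.1 hcop
    obtain ⟨c, rfl⟩ := Ideal.mem_span_singleton'.1 hb
    refine ⟨c • m, ?_⟩
    rw [map_smul, ← hm, smul_smul]
    conv_rhs => rw [← one_smul S y, ← hab, add_smul, hnil z a ha, zero_add]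
  choose m hm using fun z => hone z (x z)
  refine ⟨∑ z, e z • m z, fun z => ?_⟩
  rw [map_sum, Finset.sum_eq_single z]
  · rw [map_smul, hm, ← sub_eq_zero]
    have := hnil z _ (he1 z) (x z)
    rwa [sub_smul, one_smul] at this
  · intro z' _ h
    rw [map_smul]
    exact hnil z _ (he0 z' z h) _
  · exact fun h => (h (Finset.mem_univ z)).elim

/-- Membership in a submodule can be checked locally on the support of the quotient. -/
lemma mem_of_locally {S : Type u} [CommRing S] {M : Type u} [AddCommGroup M]
    [Module S M] (N : Submodule S M) (m : M)
    (h : ∀ p : Ideal S, p.IsMaximal → ∃ t ∉ p, t • m ∈ N) : m ∈ N := by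
  let 𝔟 : Ideal S := N.comap (LinearMap.toSpanSingleton S M m)
  have : 𝔟 = ⊤ := by
    by_contra hne
    obtain ⟨p, hp, hle⟩ := Ideal.exists_le_maximal 𝔟 hne
    obtain ⟨t, ht, h⟩ := h p hp
    exact ht (hle h)
  have h1 : (1 : S) ∈ 𝔟 := this ▸ trivial
  have h2 : (1 : S) • m ∈ N := h1
  rwa [one_smul] at h2

/-! ### Projective modules over pull-back squares -/

section Milnor

variable {A B : Type u} [Ring A] [Ring B] {σ : A →+* B} {M G : Type u} [AddCommGroup M] [Module A M]
  [AddCommGroup G] [Module B G] {ι : M →+ G}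

/-- A subring `A ⊆ B` and an `A`-submodule `M ⊆ G` of a `B`-module: a dual basis of `G` that consists
of elements of `M` and of functionals that map `M` to `A` is a dual basis of `M`, and `G = B ⊗_A M`. -/
lemma isBC_of_dualBasis (hσ : Function.Injective σ) (hι : Function.Injective ι)
    (semi : ∀ (a : A) (m : M), ι (a • m) = σ a • ι m) {κ : Type*} [Fintype κ] (φ : κ → G →ₗ[B] B)
    (v : κ → M) (hφ : ∀ k m, φ k (ι m) ∈ σ.range) (h : ∀ g, ∑ k, φ k g • ι (v k) = g) :
    Module.Finite A M ∧ Module.Projective A M ∧ IsBC σ ι := by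
  choose ψ hψ using hφ
  let ψ' : κ → M →ₗ[A] A := fun k =>
    { toFun := ψ k
      map_add' := fun m m' => hσ (by rw [hψ, map_add, map_add, map_add, hψ, hψ])
      map_smul' := fun a m => hσ (by rw [hψ, semi, map_smul, RingHom.id_apply, smul_eq_mul, smul_eq_mul, map_mul, hψ]) }
  have hψ' : ∀ k m, σ (ψ' k m) = φ k (ι m) := hψ
  have hdb : ∀ m, ∑ k, ψ' k m • v k = m := fun m => hι (by
    rw [map_sum, ← h (ι m)]
    refine Finset.sum_congr rfl fun k _ => ?_
    rw [semi, hψ'])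
  obtain ⟨h1, h2⟩ := projective_of_dualBasis ψ' v hdb
  refine ⟨h1, h2, IsBC.of_dual semi ?_ fun χ => ?_⟩
  · rw [eq_top_iff]
    intro g _
    rw [← h g]
    exact Submodule.sum_mem _ fun k _ => Submodule.smul_mem _ _ (Submodule.subset_span ⟨_, rfl⟩)
  · refine ⟨∑ k, (LinearMap.toSpanSingleton B B (σ (χ (v k)))) ∘ₗ φ k, fun m => ?_⟩
    rw [LinearMap.sum_apply]
    conv_rhs => rw [← hdb m, map_sum, map_sum]
    refine Finset.sum_congr rfl fun k _ => ?_
    rw [map_smul, smul_eq_mul, map_mul, hψ']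
    rfl

/-- Milnor's gluing of projective modules, in terms of dual bases: it suffices to have a dual basis
modulo an ideal `I` of `B` that is contained in `A`. -/
lemma isBC_of_dualBasis_mod (hσ : Function.Injective σ) (hι : Function.Injective ι)
    (semi : ∀ (a : A) (m : M), ι (a • m) = σ a • ι m) [Module.Finite B G] [Module.Projective B G]
    (I : Ideal B) [I.IsTwoSided] (hI : ∀ b ∈ I, b ∈ σ.range)
    (hIG : ∀ g ∈ I • (⊤ : Submodule B G), g ∈ ι.range) {κ : Type} [Fintype κ] (φ : κ → G →ₗ[B] B)
    (v : κ → M) (hφ : ∀ k m, φ k (ι m) ∈ σ.range)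
    (h : ∀ g, g - ∑ k, φ k g • ι (v k) ∈ I • (⊤ : Submodule B G)) :
    Module.Finite A M ∧ Module.Projective A M ∧ IsBC σ ι := by
  obtain ⟨n, χ, w, hχ⟩ := exists_dualBasis (A := B) G
  -- The error `ε = id - ∑ φ k ⊗ v k` has values in `I • G`. From `id = (id - ε) (id + ε) + ε ^ 2`, the functionals
  -- `φ k ∘ (id + ε)` with the vectors `v k`, and `χ j ∘ ε` with `ε (w j)`, form a dual basis of `G`.
  let ε : G →ₗ[B] G := LinearMap.id - ∑ k, (LinearMap.toSpanSingleton B G (ι (v k))) ∘ₗ φ k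
  have hε' : ∀ g, ε g = g - ∑ k, φ k g • ι (v k) := fun g => by
    rw [LinearMap.sub_apply, LinearMap.sum_apply]
    rfl
  have hε : ∀ g, ε g ∈ I • (⊤ : Submodule B G) := fun g => by
    rw [hε']
    exact h g
  have hlin : ∀ (f : G →ₗ[B] B) (g : G), f (ε g) ∈ I := fun f g => by
    have h1 : I • (⊤ : Submodule B G) ≤ Submodule.comap f I := by
      rw [Submodule.smul_le]
      intro r hr g _
      rw [Submodule.mem_comap, map_smul]
      exact I.mul_mem_right _ hr
    exact h1 (hε g)
  choose w' hw' using fun j => hIG _ (hε (w j))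
  refine isBC_of_dualBasis hσ hι semi (κ := κ ⊕ Fin n)
    (Sum.elim (fun k => φ k ∘ₗ (LinearMap.id + ε)) fun j => χ j ∘ₗ ε) (Sum.elim v w') ?_ fun g => ?_
  · rintro (k | j) m
    · change φ k (ι m + ε (ι m)) ∈ _
      rw [map_add]
      exact add_mem (hφ k m) (hI _ (hlin _ _))
    · exact hI _ (hlin _ _)
  · rw [Fintype.sum_sum_type]
    have h1 : ∑ j, χ j (ε g) • ε (w j) = ε (ε g) := by
      conv_rhs => rw [← hχ (ε g), map_sum]
      exact Finset.sum_congr rfl fun j _ => (map_smul _ _ _).symm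
    have h2 : ∑ k, φ k (g + ε g) • ι (v k) = (g + ε g) - ε (g + ε g) := by
      rw [hε' (g + ε g), sub_sub_cancel]
    simp only [Sum.elim_inl, Sum.elim_inr, hw']
    refine (congrArg₂ (· + ·) h2 h1).trans ?_
    rw [map_add]
    abel

end Milnor

/-! ### Coherent sheaves over affine open sets -/

section Coherent

variable {X : Scheme.{u}} {A : Sheaf (Opens.grothendieckTopology X) RingCat.{u}}
  (str : X.ringCatSheaf ⟶ A)

/-- The structure map `Γ(X, U) → A(U)`. -/
def strApp (U : X.Opens) : Γ(X, U) →+* A.obj.obj (op U) := (str.hom.app (op U)).hom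

lemma strApp_res {U V : X.Opens} (i : U ⟶ V) (r : Γ(X, V)) :
    strApp str U (X.presheaf.map i.op r) = A.obj.map i.op (strApp str V r) :=
  congr(($(str.hom.naturality i.op)).hom r)

/-- The multiplicative set of the functions on `U` that do not vanish at `x`. -/
def nonvanishing (U : X.Opens) (x : X) (hx : x ∈ U) : Submonoid Γ(X, U) where
  carrier := {t | x ∈ X.basicOpen t}
  one_mem' := by
    change x ∈ X.basicOpen (1 : Γ(X, U))
    rw [Scheme.basicOpen_one]
    exact hx
  mul_mem' {s t} hs ht := by
    change x ∈ X.basicOpen (s * t)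
    rw [Scheme.basicOpen_mul]
    exact ⟨hs, ht⟩

/-- A function that does not vanish at `x` is a unit in the stalk of `A`. -/
lemma isUnit_germR_strApp {U : X.Opens} {x : X} {hx : x ∈ U} {t : Γ(X, U)} (ht : x ∈ X.basicOpen t) :
    IsUnit (germR A U x hx (strApp str U t)) := by
  have h1 := X.toRingedSpace.isUnit_res_basicOpen t
  have h2 := (h1.map (strApp str (X.basicOpen t))).map (germR A (X.basicOpen t) x ht)
  have h3 := strApp_res str (homOfLE (X.basicOpen_le t)) t
  have h4 := germR_res (A := A) (homOfLE (X.basicOpen_le t)) x ht (strApp str U t)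
  rw [← h4, ← h3]
  exact h2

/-- Sections of a coherent sheaf over `D(f)` are the localization at `f` of the sections over `U`. -/
lemma IsCoherent.loc {F : SheafOfModules.{u} A} (hF : IsCoherent str F) {U : X.Opens}
    (hU : IsAffineOpen U) (f : Γ(X, U)) :
    (∀ s : F.val.obj (op (X.basicOpen f)), ∃ (n : ℕ) (t : F.val.obj (op U)),
      F.val.map (homOfLE (X.basicOpen_le f)).op t =
        A.obj.map (homOfLE (X.basicOpen_le f)).op (strApp str U (f ^ n)) • s) ∧
    ∀ t : F.val.obj (op U), F.val.map (homOfLE (X.basicOpen_le f)).op t = 0 →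
      ∃ n : ℕ, strApp str U (f ^ n) • t = 0 := by
  let M : X.Modules := (SheafOfModules.restrictScalars.{u} str).obj F
  have : M.IsQuasicoherent := hF.quasicoherent
  obtain ⟨h1, h2⟩ := qc_loc M hU f
  refine ⟨fun s => ?_, fun t ht => ?_⟩
  · obtain ⟨n, t, h⟩ := h1 s
    refine ⟨n, t, Eq.trans h ?_⟩
    rw [← map_pow]
    exact congrArg (fun a : A.obj.obj (op (X.basicOpen f)) => a • s)
      (strApp_res str (homOfLE (X.basicOpen_le f)) (f ^ n))
  · obtain ⟨n, h⟩ := h2 t ht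
    exact ⟨n, h⟩

lemma exists_basicOpen {U : X.Opens} (hU : IsAffineOpen U) {W : X.Opens} {x : X} (hx : x ∈ U) (hxW : x ∈ W) :
    ∃ f : Γ(X, U), X.basicOpen f ≤ W ∧ x ∈ X.basicOpen f :=
  hU.exists_basicOpen_le ⟨x, hxW⟩ hx

/-- If the sections of `F` over basic open sets are the localizations of the sections over `U`, then
so are the stalks. -/
lemma locAt_of_loc {F : SheafOfModules.{u} A} {U : X.Opens} (hU : IsAffineOpen U)
    (h : ∀ f : Γ(X, U), (∀ s : F.val.obj (op (X.basicOpen f)), ∃ (n : ℕ) (t : F.val.obj (op U)),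
      F.val.map (homOfLE (X.basicOpen_le f)).op t =
        A.obj.map (homOfLE (X.basicOpen_le f)).op (strApp str U (f ^ n)) • s) ∧
      ∀ t : F.val.obj (op U), F.val.map (homOfLE (X.basicOpen_le f)).op t = 0 →
        ∃ n : ℕ, strApp str U (f ^ n) • t = 0) (x : X) (hx : x ∈ U) :
    LocAt (nonvanishing U x hx) (strApp str U) (germR A U x hx) (germM F U x hx) where
  semi := germM_smul F U x hx
  unit t ht := isUnit_germR_strApp str ht
  surj m' := by
    obtain ⟨W, hxW, s, rfl⟩ := exists_germM F x m'
    obtain ⟨f, hfW, hf⟩ := exists_basicOpen hU hx hxW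
    obtain ⟨n, t, h⟩ := (h f).1 (F.val.map (homOfLE hfW).op s)
    refine ⟨f ^ n, pow_mem (S := nonvanishing U x hx) hf n, t, ?_⟩
    have h1 := (congrArg (germM F (X.basicOpen f) x hf) h).trans (germM_smul F _ x hf _ _)
    rw [germR_res] at h1
    refine Eq.trans ?_ (h1.symm.trans (germM_res F (homOfLE (X.basicOpen_le f)) x hf t))
    exact congrArg _ (germM_res F (homOfLE hfW) x hf s).symm
  inj m hm := by
    obtain ⟨W, hxW, i, hW⟩ := exists_res_eq_zero F.val.presheaf hx m hm
    obtain ⟨f, hfW, hf⟩ := exists_basicOpen hU hx hxW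
    have h1 : F.val.map (homOfLE (X.basicOpen_le f)).op m = 0 := by
      have h2 := congrArg (F.val.map (homOfLE hfW).op) hW
      refine Eq.trans ?_ (h2.trans (map_zero _))
      exact congr(($(F.val.presheaf.map_comp i.op (homOfLE hfW).op)) m)
    obtain ⟨n, h⟩ := (h f).2 m h1
    exact ⟨f ^ n, pow_mem (S := nonvanishing U x hx) hf n, h⟩

/-- The stalks of a coherent sheaf are the localizations of its sections over an affine open set. -/
lemma IsCoherent.locAt {F : SheafOfModules.{u} A} (hF : IsCoherent str F) {U : X.Opens}
    (hU : IsAffineOpen U) (x : X) (hx : x ∈ U) :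
    LocAt (nonvanishing U x hx) (strApp str U) (germR A U x hx) (germM F U x hx) :=
  locAt_of_loc str hU (hF.loc str hU) x hx

lemma exists_res_eq_zero' {X : TopCat.{u}} (P : TopCat.Presheaf RingCat.{u} X) {W : Opens X} {x : X} (hx : x ∈ W)
    (t : P.obj (op W)) (h : P.germ W x hx t = 0) : ∃ (W' : Opens X) (_ : x ∈ W') (i : W' ⟶ W), P.map i.op t = 0 := by
  obtain ⟨W', hx', i, i', h⟩ := P.germ_eq x hx hx t 0 (h.trans (map_zero (P.germ W x hx).hom).symm)
  exact ⟨W', hx', i, h.trans (map_zero (P.map i'.op).hom)⟩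

/-- The stalks of a coherent sheaf of algebras are the localizations of its sections over an affine
open set. -/
lemma IsCoherent.locAt_ring (hA : IsCoherent str (SheafOfModules.unit A)) {U : X.Opens}
    (hU : IsAffineOpen U) (x : X) (hx : x ∈ U) :
    LocAt (nonvanishing U x hx) (strApp str U) (germR A U x hx) (germR A U x hx).toAddMonoidHom where
  semi a b := map_mul (germR A U x hx) a b
  unit t ht := isUnit_germR_strApp str ht
  surj m' := by
    obtain ⟨W, hxW, s, rfl⟩ := exists_germR x m'
    obtain ⟨f, hfW, hf⟩ := exists_basicOpen hU hx hxW
    obtain ⟨n, t, h⟩ := (hA.loc str hU f).1 (A.obj.map (homOfLE hfW).op s)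
    refine ⟨f ^ n, pow_mem (S := nonvanishing U x hx) hf n, t, ?_⟩
    have h0 : A.obj.map (homOfLE (X.basicOpen_le f)).op (show A.obj.obj (op U) from t) =
      A.obj.map (homOfLE (X.basicOpen_le f)).op (strApp str U (f ^ n)) * A.obj.map (homOfLE hfW).op s := h
    have h1 := congrArg (germR A (X.basicOpen f) x hf) h0
    rw [map_mul, germR_res, germR_res] at h1
    exact Eq.trans (congrArg (germR A U x hx (strApp str U (f ^ n)) * ·)
      (germR_res (homOfLE hfW) x hf s).symm) h1.symm
  inj m hm := by
    obtain ⟨W, hxW, i, h⟩ := exists_res_eq_zero' A.obj hx m hm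
    obtain ⟨f, hfW, hf⟩ := exists_basicOpen hU hx hxW
    have h1 : A.obj.map (homOfLE (X.basicOpen_le f)).op m = 0 := by
      have h2 := congrArg (A.obj.map (homOfLE hfW).op) h
      refine Eq.trans ?_ (h2.trans (map_zero (A.obj.map (homOfLE hfW).op).hom))
      exact congr(($(A.obj.map_comp i.op (homOfLE hfW).op)) m)
    obtain ⟨n, h⟩ := (hA.loc str hU f).2 m h1
    exact ⟨f ^ n, pow_mem (S := nonvanishing U x hx) hf n, h⟩

/-- A sheaf is coherent if on an affine cover its stalks are the localizations of finite modules. -/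
lemma IsCoherent.of_cover (hA : IsCoherent str (SheafOfModules.unit A)) (F : SheafOfModules.{u} A)
    {I : Type u} (U : I → X.Opens) (hU : ∀ i, IsAffineOpen (U i)) (hcov : ∀ x, ∃ i, x ∈ U i)
    (N : I → Type u) [∀ i, AddCommGroup (N i)] [∀ i, Module (A.obj.obj (op (U i))) (N i)]
    [∀ i, Module.Finite (A.obj.obj (op (U i))) (N i)]
    (φ : ∀ i, N i →ₗ[A.obj.obj (op (U i))] F.val.obj (op (U i)))
    (h : ∀ i x hx, LocAt (nonvanishing (U i) x hx) (strApp str (U i)) (germR A (U i) x hx)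
      ((germM F (U i) x hx).comp (φ i).toAddMonoidHom)) :
    IsCoherent str F ∧ ∀ i, Function.Bijective (φ i) := by
  let M : X.Modules := (SheafOfModules.restrictScalars.{u} str).obj F
  let _ (i) : Module Γ(X, U i) (N i) := Module.compHom _ (strApp str (U i))
  let φ' (i) : N i →ₗ[Γ(X, U i)] Γ(M, U i) :=
    { toFun := φ i
      map_add' := map_add _
      map_smul' := fun r n => map_smul (φ i) (strApp str (U i) r) n }
  have key (i) := fromSpec_presentation M (hU i) (N i) (φ' i)
    (fun x hx W hW hxW s => by
      obtain ⟨t, ht, n, hn⟩ := (h i x hx).surj (germM F W x hxW s)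
      refine ⟨t, ht, n, hn.symm.trans ?_⟩
      refine Eq.trans ?_ (germM_smul F W x hxW (strApp str W (X.presheaf.map (homOfLE hW).op t)) s).symm
      rw [strApp_res, germR_res])
    (fun x hx n hn => by
      obtain ⟨t, ht, h⟩ := (h i x hx).inj n hn
      exact ⟨t, ht, h⟩)
  have hqc : M.IsQuasicoherent := qc_of_presentation M U hU hcov fun i => (key i).1
  refine ⟨⟨hqc, fun V hV => qc_finite M U hU hcov (fun i => ?_) hV⟩, fun i => (key i).2⟩
  have h1 : Module.Finite Γ(X, U i) (N i) := by
    let _ : Module Γ(X, U i) (A.obj.obj (op (U i))) := Module.compHom _ (strApp str (U i))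
    have : Module.Finite Γ(X, U i) (A.obj.obj (op (U i))) := hA.finite (U i) (hU i)
    have : IsScalarTower Γ(X, U i) (A.obj.obj (op (U i))) (N i) := ⟨fun r a n => mul_smul (strApp str (U i) r) a n⟩
    exact Module.Finite.trans (A.obj.obj (op (U i))) (N i)
  exact Module.Finite.of_surjective (φ' i) (key i).2.2

end Coherent

/-! ### Skyscraper sheaves and the stalks of inverse images -/

section Skyscraper

variable {X : TopCat.{u}} {A : Sheaf (Opens.grothendieckTopology X) RingCat.{u}}

/-- A morphism of sheaves of modules is an isomorphism if it is bijective on stalks. -/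
lemma isIso_of_stalkMapM {F F' : SheafOfModules.{u} A} (φ : F ⟶ F')
    (h : ∀ x, Function.Bijective (stalkMapM φ x)) : IsIso φ := by
  have h0 : ∀ x, IsIso ((TopCat.Presheaf.stalkFunctor Ab.{u} x).map
      ((SheafOfModules.toSheaf A).map φ).hom) := fun x => by
    rw [ConcreteCategory.isIso_iff_bijective]
    exact h x
  have : IsIso ((SheafOfModules.toSheaf A).map φ) :=
    TopCat.Presheaf.isIso_of_stalkFunctor_map_iso (X := X) ((SheafOfModules.toSheaf A).map φ)
  exact isIso_of_reflects_iso φ (SheafOfModules.toSheaf A)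

variable (A) (y : X) (M : Type u) [AddCommGroup M]

/-- The skyscraper sheaf at `y` with value `M`: the sections over `W` are the functions on the set of
proofs of `y ∈ W`. -/
def skyAb : (Opens X)ᵒᵖ ⥤ Ab.{u} where
  obj W := AddCommGrpCat.of (PLift (y ∈ W.unop) → M)
  map i := AddCommGrpCat.ofHom
    { toFun := fun f h => f ⟨i.unop.le h.down⟩
      map_zero' := rfl
      map_add' := fun _ _ => rfl }
  map_id _ := rfl
  map_comp _ _ := rfl

lemma skyAb_isSheaf : Presheaf.IsSheaf (Opens.grothendieckTopology X) (skyAb y M) := by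
  classical
  refine (TopCat.Presheaf.isSheaf_iff_isSheafUniqueGluing (skyAb y M)).2 fun κ U sf hsf => ?_
  have hc : ∀ (i j : κ) (hi : y ∈ U i) (hj : y ∈ U j),
      (show PLift (y ∈ U i) → M from sf i) ⟨hi⟩ = (show PLift (y ∈ U j) → M from sf j) ⟨hj⟩ :=
    fun i j hi hj => congr_fun (hsf i j) ⟨⟨hi, hj⟩⟩
  let s : PLift (y ∈ iSup U) → M := fun h =>
    (show PLift (y ∈ U (Opens.mem_iSup.1 h.down).choose) → M from
      sf (Opens.mem_iSup.1 h.down).choose) ⟨(Opens.mem_iSup.1 h.down).choose_spec⟩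
  refine ⟨s, fun i => funext fun h => hc _ _ _ _, fun t ht => funext fun h => ?_⟩
  obtain ⟨i, hi⟩ := Opens.mem_iSup.1 h.down
  have h1 := congr_fun (ht i) ⟨hi⟩
  exact Eq.trans h1 (hc _ _ _ _)

variable [Module (ringStalk A y) M]

instance skyModule (W : (Opens X)ᵒᵖ) : Module (A.obj.obj W) ((skyAb y M).obj W) :=
  @Pi.module (PLift (y ∈ W.unop)) (fun _ => M) (A.obj.obj W) _ _
    (fun h => Module.compHom M (germR A W.unop y h.down))

/-- The skyscraper sheaf at `y` with value a module over the stalk of `A` at `y`. -/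
def sky : SheafOfModules.{u} A where
  val := PresheafOfModules.ofPresheaf (skyAb y M) fun W _ i a f => funext fun h =>
    congrArg (· • (show PLift (y ∈ W.unop) → M from f) ⟨i.unop.le h.down⟩) (germR_res i.unop y h.down a).symm
  isSheaf := skyAb_isSheaf y M

variable {A y M}

/-- The value at `y` of a section of a skyscraper sheaf. -/
def skyVal {W : Opens X} (hy : y ∈ W) : (sky A y M).val.obj (op W) →+ M where
  toFun f := (show PLift (y ∈ W) → M from f) ⟨hy⟩
  map_zero' := rfl
  map_add' _ _ := rfl

lemma skyVal_smul {W : Opens X} (hy : y ∈ W) (a : A.obj.obj (op W)) (f : (sky A y M).val.obj (op W)) :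
    skyVal hy (a • f) = germR A W y hy a • skyVal hy f := rfl

/-- The value at `y` of the image of a section under a morphism to a skyscraper sheaf. -/
def skyEval {G : SheafOfModules.{u} A} (χ : G ⟶ sky A y M) {W : Opens X} (hy : y ∈ W) :
    G.val.obj (op W) →+ M := (skyVal hy).comp (χ.val.app (op W)).hom.toAddMonoidHom

lemma skyEval_smul {G : SheafOfModules.{u} A} (χ : G ⟶ sky A y M) {W : Opens X} (hy : y ∈ W)
    (a : A.obj.obj (op W)) (s : G.val.obj (op W)) :
    skyEval χ hy (a • s) = germR A W y hy a • skyEval χ hy s :=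
  (congrArg (skyVal hy) (map_smul (χ.val.app (op W)).hom a s)).trans (skyVal_smul hy a _)

lemma skyEval_res {G : SheafOfModules.{u} A} (χ : G ⟶ sky A y M) {W W' : Opens X} (i : W' ⟶ W)
    (hy : y ∈ W') (s : G.val.obj (op W)) :
    skyEval χ hy (G.val.map i.op s) = skyEval χ (i.le hy) s :=
  congrArg (skyVal hy) (PresheafOfModules.naturality_apply χ.val i.op s)

/-- A morphism to a skyscraper sheaf factors through the stalk. -/
lemma exists_skyDesc {G : SheafOfModules.{u} A} (χ : G ⟶ sky A y M) :
    ∃ ν : modStalk G y →ₗ[ringStalk A y] M, ∀ (W : Opens X) (hy : y ∈ W) (s : G.val.obj (op W)),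
      ν (germM G W y hy s) = skyEval χ hy s := by
  choose W hW s hs using exists_germM G y
  have key : ∀ (W' : Opens X) (hy : y ∈ W') (t : G.val.obj (op W')) (z : modStalk G y),
      germM G W' y hy t = z → skyEval χ (hW z) (s z) = skyEval χ hy t := by
    intro W' hy t z hz
    obtain ⟨V, hV, i, j, h⟩ := TopCat.Presheaf.germ_eq G.val.presheaf y _ hy _ _ ((hs z).trans hz.symm)
    exact (skyEval_res χ i hV _).symm.trans ((congrArg (skyEval χ hV) h).trans (skyEval_res χ j hV _))
  refine ⟨{ toFun := fun z => skyEval χ (hW z) (s z), map_add' := fun z z' => ?_, map_smul' := fun a z => ?_ },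
    fun W' hy t => key W' hy t _ rfl⟩
  · obtain ⟨V, hV, t, rfl⟩ := exists_germM G y z
    obtain ⟨V', hV', t', rfl⟩ := exists_germM G y z'
    have hy : y ∈ V ⊓ V' := ⟨hV, hV'⟩
    obtain ⟨p, e⟩ : ∃ p : G.val.obj (op (V ⊓ V')), germM G _ y hy p = germM G V y hV t :=
      ⟨_, germM_res G (Opens.infLELeft V V') y hy t⟩
    obtain ⟨p', e'⟩ : ∃ p : G.val.obj (op (V ⊓ V')), germM G _ y hy p = germM G V' y hV' t' :=
      ⟨_, germM_res G (Opens.infLERight V V') y hy t'⟩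
    rw [key _ hy _ _ e, key _ hy _ _ e', ← map_add]
    exact key _ hy _ _ ((map_add (germM G (V ⊓ V') y hy) _ _).trans (congrArg₂ (· + ·) e e'))
  · obtain ⟨V, hV, b, t, rfl, rfl⟩ := exists_germ₂ G y a z
    rw [key _ hV _ _ (germM_smul G V y hV b t), key V hV t _ rfl, skyEval_smul]
    rfl

end Skyscraper

section PullStalk

variable {K : Type u} [Field K] {𝒴 𝒳 : NCVariety K} (π : NCHom 𝒴 𝒳)

/-- A semilinear map `F_{π y} → M` as a morphism from `F` to the direct image of a skyscraper sheaf. -/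
def skyLift (F : SheafOfModules.{u} 𝒳.sheaf) (y : 𝒴.space) (M : Type u) [AddCommGroup M]
    [Module (ringStalk 𝒴.sheaf y) M] (ν : modStalk F (π.base y) →+ M)
    (hν : ∀ (a : ringStalk 𝒳.sheaf (π.base y)) m, ν (a • m) = π.stalkMap y a • ν m) :
    F ⟶ π.push.obj (sky 𝒴.sheaf y M) where
  val := PresheafOfModules.homMk
    { app := fun U => AddCommGrpCat.ofHom
        ({ toFun := fun s h => ν (germM F U.unop (π.base y) h.down s)
           map_zero' := funext fun h => by rw [map_zero, map_zero]; rfl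
           map_add' := fun s t => funext fun h => by rw [map_add, map_add]; rfl } :
          F.val.obj U →+ (PLift (y ∈ π.base ⁻¹ᵁ U.unop) → M))
      naturality := fun U V i => by
        ext s
        refine funext fun h => ?_
        exact congrArg ν (germM_res F i.unop (π.base y) h.down s) }
    (fun U a s => funext fun h => by
      refine (congrArg ν (germM_smul F U.unop (π.base y) h.down a s)).trans ((hν _ _).trans ?_)
      exact congrArg (· • ν (germM F U.unop (π.base y) h.down s)) (π.stalkMap_germ U.unop y h.down a))

/-- The stalks of the inverse image are the extensions of scalars of the stalks. -/
lemma isBC_pullStalk (F : SheafOfModules.{u} 𝒳.sheaf) (y : 𝒴.space) :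
    IsBC (π.stalkMap y) (π.pullStalk F y).toAddMonoidHom := by
  let adj := SheafOfModules.pullbackPushforwardAdjunction.{u} π.sharp
  have semi : ∀ (a : ringStalk 𝒳.sheaf (π.base y)) m,
    (π.pullStalk F y).toAddMonoidHom (a • m) = π.stalkMap y a • (π.pullStalk F y).toAddMonoidHom m :=
    fun a m => (π.pullStalk F y).map_smulₛₗ a m
  -- a semilinear map `ν` extends to the stalk of the inverse image
  have hext : ∀ (M : Type u) [AddCommGroup M] [Module (ringStalk 𝒴.sheaf y) M]
      (ν : modStalk F (π.base y) →+ M)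
      (hν : ∀ (a : ringStalk 𝒳.sheaf (π.base y)) m, ν (a • m) = π.stalkMap y a • ν m),
      ∃ ν' : modStalk (π.pull.obj F) y →ₗ[ringStalk 𝒴.sheaf y] M, ∀ m, ν' (π.pullStalk F y m) = ν m := by
    intro M _ _ ν hν
    obtain ⟨ν', hν'⟩ := exists_skyDesc ((adj.homEquiv F (sky 𝒴.sheaf y M)).symm (skyLift π F y M ν hν))
    refine ⟨ν', fun m => ?_⟩
    obtain ⟨U, hx, s, rfl⟩ := exists_germM F (π.base y) m
    rw [π.pullStalk_germ]
    refine (hν' (π.base ⁻¹ᵁ U) hx _).trans ?_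
    have h1 := (adj.homEquiv F (sky 𝒴.sheaf y M)).apply_symm_apply (skyLift π F y M ν hν)
    rw [adj.homEquiv_unit] at h1
    exact congrArg (fun χ : F ⟶ π.push.obj (sky 𝒴.sheaf y M) =>
      skyVal (A := 𝒴.sheaf) (W := π.base ⁻¹ᵁ U) hx (χ.val.app (op U) s)) h1
  obtain ⟨τ, hτ⟩ := hext _ (Extend.one (π.stalkMap y)) (Extend.one_smul _)
  refine IsBC.mk' semi ?_ τ hτ
  -- the quotient by the submodule generated by the image of `F_{π y}` vanishes
  set N := Submodule.span (ringStalk 𝒴.sheaf y) (Set.range (π.pullStalk F y).toAddMonoidHom) with hN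
  let M := modStalk (π.pull.obj F) y ⧸ N
  let q : π.pull.obj F ⟶ sky 𝒴.sheaf y M :=
    { val := PresheafOfModules.homMk
        { app := fun W => AddCommGrpCat.ofHom
            ({ toFun := fun s h => N.mkQ (germM (π.pull.obj F) W.unop y h.down s)
               map_zero' := funext fun h => by rw [map_zero, map_zero]; rfl
               map_add' := fun s t => funext fun h => by rw [map_add, map_add]; rfl } :
              (π.pull.obj F).val.obj W →+ (PLift (y ∈ W.unop) → M))
          naturality := fun U V i => by
            ext s
            refine funext fun h => ?_
            exact congrArg N.mkQ (germM_res (π.pull.obj F) i.unop y h.down s) }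
        (fun W a s => funext fun h => by
          exact (congrArg N.mkQ (germM_smul (π.pull.obj F) W.unop y h.down a s)).trans (map_smul _ _ _)) }
  have hq : q = 0 := by
    apply (adj.homEquiv F (sky 𝒴.sheaf y M)).injective
    rw [adj.homEquiv_unit, adj.homEquiv_unit]
    refine SheafOfModules.Hom.ext (PresheafOfModules.hom_ext fun U => ModuleCat.hom_ext (LinearMap.ext fun s =>
      funext fun h => ?_))
    refine Eq.trans ?_ (rfl : (0 : M) = _)
    refine (Submodule.Quotient.mk_eq_zero N).2 (Submodule.subset_span ⟨germM F U.unop (π.base y) h.down s, ?_⟩)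
    exact π.pullStalk_germ F U.unop y h.down s
  rw [eq_top_iff]
  intro z _
  obtain ⟨W, hy, s, rfl⟩ := exists_germM (π.pull.obj F) y z
  have h1 := congrArg (fun χ : π.pull.obj F ⟶ sky 𝒴.sheaf y M => skyEval χ hy s) hq
  exact (Submodule.Quotient.mk_eq_zero N).1 h1

end PullStalk

/-! ### Points of affine open sets, and sections of vector bundles -/

section Points

variable {X : Scheme.{u}} {U : X.Opens} (hU : IsAffineOpen U)

/-- The prime ideal of the functions on the affine open set `U` that vanish at `x`. -/
def ptIdeal (x : X) (hx : x ∈ U) : Ideal Γ(X, U) := (hU.primeIdealOf ⟨x, hx⟩).asIdeal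

instance (x : X) (hx : x ∈ U) : (ptIdeal hU x hx).IsPrime := (hU.primeIdealOf ⟨x, hx⟩).isPrime

lemma notMem_ptIdeal {x : X} {hx : x ∈ U} {t : Γ(X, U)} :
    t ∉ ptIdeal hU x hx ↔ x ∈ X.basicOpen t := by
  have h : x ∈ X.basicOpen t ↔ hU.primeIdealOf ⟨x, hx⟩ ∈ hU.fromSpec ⁻¹ᵁ X.basicOpen t :=
    iff_of_eq (congrArg (· ∈ X.basicOpen t) (hU.fromSpec_primeIdealOf ⟨x, hx⟩).symm)
  rw [h, hU.fromSpec_preimage_basicOpen]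
  rfl

lemma mem_nonvanishing_iff {x : X} {hx : x ∈ U} {t : Γ(X, U)} :
    t ∈ nonvanishing U x hx ↔ t ∉ ptIdeal hU x hx := (notMem_ptIdeal hU).symm

lemma exists_ptIdeal_eq (p : Ideal Γ(X, U)) [hp : p.IsPrime] : ∃ (x : X) (hx : x ∈ U), ptIdeal hU x hx = p := by
  have hx : hU.fromSpec ⟨p, hp⟩ ∈ U := by
    have : hU.fromSpec ⟨p, hp⟩ ∈ Set.range hU.fromSpec := ⟨_, rfl⟩
    rwa [hU.range_fromSpec] at this
  refine ⟨hU.fromSpec ⟨p, hp⟩, hx, ?_⟩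
  have h := hU.fromSpec_primeIdealOf ⟨_, hx⟩
  have h1 := hU.fromSpec.isOpenEmbedding.injective h
  exact congrArg PrimeSpectrum.asIdeal h1

lemma ptIdeal_le_iff {x x' : X} {hx : x ∈ U} {hx' : x' ∈ U} :
    ptIdeal hU x hx ≤ ptIdeal hU x' hx' ↔ x ⤳ x' := by
  have h := hU.fromSpec.isOpenEmbedding.isInducing.specializes_iff (x := hU.primeIdealOf ⟨x, hx⟩) (y := hU.primeIdealOf ⟨x', hx'⟩)
  rw [hU.fromSpec_primeIdealOf, hU.fromSpec_primeIdealOf] at h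
  exact (PrimeSpectrum.le_iff_specializes (hU.primeIdealOf ⟨x, hx⟩) (hU.primeIdealOf ⟨x', hx'⟩)).trans h.symm

lemma ptIdeal_isMaximal {x : X} (hx : x ∈ U) (hc : IsClosed {x}) : (ptIdeal hU x hx).IsMaximal :=
  hU.primeIdealOf_isMaximal_of_isClosed ⟨x, hx⟩ hc

lemma ptIdeal_injective {x x' : X} {hx : x ∈ U} {hx' : x' ∈ U} (h : ptIdeal hU x hx = ptIdeal hU x' hx') : x = x' :=
  (((ptIdeal_le_iff hU).1 h.le).antisymm ((ptIdeal_le_iff hU).1 h.ge)).eq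

end Points

namespace NCVariety

variable {K : Type u} [Field K] (𝒳 : NCVariety K)

lemma isLocallyNoetherian : IsLocallyNoetherian 𝒳.space := by
  have := 𝒳.locallyOfFiniteType
  exact LocallyOfFiniteType.isLocallyNoetherian 𝒳.toSpec

lemma isNoetherianRing_sections {U : 𝒳.space.Opens} (hU : IsAffineOpen U) : IsNoetherianRing Γ(𝒳.space, U) := by
  have := 𝒳.isLocallyNoetherian
  exact IsLocallyNoetherian.component_noetherian ⟨U, hU⟩

lemma strApp_commute (U : 𝒳.space.Opens) (r : Γ(𝒳.space, U)) (a : 𝒳.sheaf.obj.obj (op U)) :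
    strApp 𝒳.str U r * a = a * strApp 𝒳.str U r := 𝒳.commute U r a

instance algebraSections (U : 𝒳.space.Opens) : Algebra Γ(𝒳.space, U) (𝒳.sheaf.obj.obj (op U)) :=
  RingHom.toAlgebra' (strApp 𝒳.str U) (𝒳.strApp_commute U)

lemma finite_sections {U : 𝒳.space.Opens} (hU : IsAffineOpen U) :
    Module.Finite Γ(𝒳.space, U) (𝒳.sheaf.obj.obj (op U)) := 𝒳.coherent.finite U hU

lemma isNoetherianRing_algebra {U : 𝒳.space.Opens} (hU : IsAffineOpen U) :
    IsNoetherianRing (𝒳.sheaf.obj.obj (op U)) := by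
  have := 𝒳.isNoetherianRing_sections hU
  have := 𝒳.finite_sections hU
  exact IsNoetherianRing.of_finite Γ(𝒳.space, U) _

variable {𝒳}

lemma module_finite {F : SheafOfModules.{u} 𝒳.sheaf} (hF : IsCoherent 𝒳.str F) {U : 𝒳.space.Opens} (hU : IsAffineOpen U) :
    Module.Finite (𝒳.sheaf.obj.obj (op U)) (F.val.obj (op U)) := by
  let _ : Module Γ(𝒳.space, U) (F.val.obj (op U)) := Module.compHom _ (strApp 𝒳.str U)
  have : Module.Finite Γ(𝒳.space, U) (F.val.obj (op U)) := hF.finite U hU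
  have : IsScalarTower Γ(𝒳.space, U) (𝒳.sheaf.obj.obj (op U)) (F.val.obj (op U)) :=
    ⟨fun r a n => mul_smul (strApp 𝒳.str U r) a n⟩
  exact Module.Finite.of_restrictScalars_finite Γ(𝒳.space, U) _ _

/-- The sections of a vector bundle over an affine open set form a projective module. -/
lemma isVectorBundle.projective {F : SheafOfModules.{u} 𝒳.sheaf} (hF : 𝒳.isVectorBundle F) {U : 𝒳.space.Opens}
    (hU : IsAffineOpen U) : Module.Projective (𝒳.sheaf.obj.obj (op U)) (F.val.obj (op U)) := by
  have := 𝒳.isNoetherianRing_algebra hU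
  have := module_finite hF.1 hU
  refine projective_of_locAt (strApp 𝒳.str U) (𝒳.strApp_commute U) fun p hp => ?_
  have := hp.isPrime
  obtain ⟨x, hx, rfl⟩ := exists_ptIdeal_eq hU p
  exact ⟨nonvanishing U x hx, Set.disjoint_left.2 fun t ht => (mem_nonvanishing_iff hU).1 ht, ringStalk 𝒳.sheaf x, modStalk F x,
    inferInstance, inferInstance, inferInstance, germR 𝒳.sheaf U x hx, germM F U x hx,
    𝒳.coherent.locAt_ring 𝒳.str hU x hx, hF.1.locAt 𝒳.str hU x hx, hF.2 x⟩

end NCVariety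

/-! ### Residues of localizations -/

section Residues

variable {R : Type u} [CommRing R] {A A' : Type u} [Ring A] [Ring A']
  {M M' Q : Type u} [AddCommGroup M] [Module A M] [AddCommGroup M'] [Module A' M']
  [AddCommGroup Q] [Module A' Q]

/-- The semilinear map `ν : M → Q` over `α : A → A'` identifies `Q` with the localization of `M / N`
at the image under `ρ : R → A` of the multiplicative set `T`. -/
structure ResAt (T : Submonoid R) (ρ : R →+* A) (α : A →+* A') (N : Submodule A M) (ν : M →+ Q) : Prop where
  semi : ∀ (a : A) (m : M), ν (a • m) = α a • ν m
  unit : ∀ t ∈ T, IsUnit (α (ρ t))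
  surj : ∀ q : Q, ∃ t ∈ T, ∃ m, α (ρ t) • q = ν m
  ker : ∀ m : M, ν m = 0 ↔ ∃ t ∈ T, ρ t • m ∈ N

/-- The quotient of a localization by a localized two-sided ideal. -/
lemma LocAt.resAt {T : Submonoid R} {ρ : R →+* A} {α : A →+* A'} {μ : M →+ M'}
    (h : LocAt T ρ α μ) (hρ : ∀ r a, ρ r * a = a * ρ r) (I : Ideal A) (I' : Ideal A')
    (hI : ∀ s, s ∈ I' ↔ ∃ t ∈ T, ∃ a ∈ I, α (ρ t) * s = α a) :
    ResAt T ρ α (I • (⊤ : Submodule A M))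
      ((Submodule.mkQ (I' • (⊤ : Submodule A' M'))).toAddMonoidHom.comp μ) where
  semi a m := (congrArg (Submodule.mkQ (I' • (⊤ : Submodule A' M'))) (h.semi a m)).trans (map_smul _ _ _)
  unit := h.unit
  surj q := by
    obtain ⟨m', rfl⟩ := Submodule.mkQ_surjective _ q
    obtain ⟨t, ht, m, hm⟩ := h.surj m'
    exact ⟨t, ht, m, (map_smul _ _ _).symm.trans (congrArg _ hm)⟩
  ker m := by
    have h0 : (Submodule.mkQ (I' • (⊤ : Submodule A' M'))).toAddMonoidHom.comp μ m = 0 ↔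
        μ m ∈ I' • (⊤ : Submodule A' M') := Submodule.Quotient.mk_eq_zero _
    rw [h0]
    constructor
    · intro hm
      have key : ∀ z ∈ I' • (⊤ : Submodule A' M'), ∃ t ∈ T, ∃ n ∈ I • (⊤ : Submodule A M),
          α (ρ t) • z = μ n := by
        intro z hz
        induction hz using Submodule.smul_induction_on' with
        | smul s hs m' _ =>
          obtain ⟨t, ht, a, ha, h1⟩ := (hI s).1 hs
          obtain ⟨t', ht', n, h2⟩ := h.surj m'
          refine ⟨t' * t, T.mul_mem ht' ht, a • n, Submodule.smul_mem_smul ha trivial, ?_⟩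
          rw [h.semi, ← h2, smul_smul, smul_smul, map_mul, map_mul, mul_assoc, h1, ← map_mul, hρ, map_mul]
        | add x _ y _ hx hy =>
          obtain ⟨t, ht, n, hn, h1⟩ := hx
          obtain ⟨t', ht', n', hn', h2⟩ := hy
          refine ⟨t * t', T.mul_mem ht ht', ρ t' • n + ρ t • n', add_mem (Submodule.smul_mem _ _ hn)
            (Submodule.smul_mem _ _ hn'), ?_⟩
          rw [map_add, h.semi, h.semi, ← h1, ← h2, smul_add, smul_smul, smul_smul, ← map_mul, ← map_mul,
            ← map_mul, ← map_mul, mul_comm t' t]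
      obtain ⟨t, ht, n, hn, h1⟩ := key _ hm
      obtain ⟨t', ht', h2⟩ := h.inj (ρ t • m - n) (by rw [map_sub, h.semi, h1, sub_self])
      refine ⟨t' * t, T.mul_mem ht' ht, ?_⟩
      rw [smul_sub, sub_eq_zero] at h2
      rw [map_mul, mul_smul, h2]
      exact Submodule.smul_mem _ _ hn
    · rintro ⟨t, ht, hm⟩
      have key : ∀ z ∈ I • (⊤ : Submodule A M), μ z ∈ I' • (⊤ : Submodule A' M') := by
        intro z hz
        induction hz using Submodule.smul_induction_on' with
        | smul s hs n _ =>
          rw [h.semi]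
          exact Submodule.smul_mem_smul ((hI _).2 ⟨1, T.one_mem, s, hs, by simp⟩) trivial
        | add x _ y _ hx hy => rw [map_add]; exact add_mem hx hy
      have h1 := key _ hm
      rw [h.semi] at h1
      have h2 := Submodule.smul_mem _ (↑(h.unit t ht).unit⁻¹ : A') h1
      rwa [smul_smul, IsUnit.val_inv_mul, one_smul] at h2

variable [IsNoetherianRing R] (ρ : R →+* A) (N : Submodule A M) (𝔞 : Ideal R) {Z : Type u}
  (q : Z → Ideal R) {A'' : Z → Type u} [∀ z, Ring (A'' z)] {Q' : Z → Type u} [∀ z, AddCommGroup (Q' z)]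
  [∀ z, Module (A'' z) (Q' z)] {T : Z → Submonoid R}

/-- The Chinese remainder theorem for the residues at the points of the support of `M / N`. -/
lemma ResAt.exists_eq (h𝔞 : ∀ s ∈ 𝔞, ∀ m : M, ρ s • m ∈ N) [Finite Z]
    [hq : ∀ z, (q z).IsMaximal] (hinj : Function.Injective q)
    (hV : ∀ p : Ideal R, p.IsPrime → 𝔞 ≤ p → ∃ z, p = q z)
    (hT : ∀ z t, t ∈ T z ↔ t ∉ q z) {α : ∀ z, A →+* A'' z} {ν : ∀ z, M →+ Q' z}
    (h : ∀ z, ResAt (T z) ρ (α z) N (ν z)) (x : ∀ z, Q' z) : ∃ m, ∀ z, ν z m = x z := by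
  let _ : Module R M := Module.compHom _ ρ
  let _ (z) : Module R (Q' z) := Module.compHom _ ((α z).comp ρ)
  let N' : Submodule R M :=
    { carrier := N, zero_mem' := N.zero_mem, add_mem' := N.add_mem, smul_mem' := fun r _ hm => N.smul_mem (ρ r) hm }
  let μ (z) : M →ₗ[R] Q' z :=
    { toFun := ν z, map_add' := map_add _, map_smul' := fun r m => (h z).semi (ρ r) m }
  exact exists_of_finite_support N' 𝔞 h𝔞 q hinj hV μ
    (fun z x => by
      obtain ⟨t, ht, m, hm⟩ := (h z).surj x
      exact ⟨t, (hT z t).1 ht, m, hm⟩)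
    (fun z t ht x hx => ((h z).unit t ((hT z t).2 ht)).smul_eq_zero.1 hx)
    (fun z m hm => ((h z).ker m).2 ⟨1, (T z).one_mem, by rw [map_one, one_smul]; exact hm⟩) x

omit [IsNoetherianRing R] in
lemma ResAt.mem (h𝔞 : ∀ s ∈ 𝔞, ∀ m : M, ρ s • m ∈ N)
    (hV : ∀ p : Ideal R, p.IsPrime → 𝔞 ≤ p → ∃ z, p = q z)
    (hT : ∀ z t, t ∈ T z ↔ t ∉ q z) {α : ∀ z, A →+* A'' z} {ν : ∀ z, M →+ Q' z}
    (h : ∀ z, ResAt (T z) ρ (α z) N (ν z)) (m : M) (hm : ∀ z, ν z m = 0) : m ∈ N := by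
  let _ : Module R M := Module.compHom _ ρ
  let N' : Submodule R M :=
    { carrier := N, zero_mem' := N.zero_mem, add_mem' := N.add_mem, smul_mem' := fun r _ hm => N.smul_mem (ρ r) hm }
  refine mem_of_locally N' m fun p hp => ?_
  by_cases hle : 𝔞 ≤ p
  · obtain ⟨z, rfl⟩ := hV p hp.isPrime hle
    obtain ⟨t, ht, h1⟩ := ((h z).ker m).1 (hm z)
    exact ⟨t, (hT z t).1 ht, h1⟩
  · obtain ⟨s, hs, hsp⟩ := Set.not_subset.1 hle
    exact ⟨s, hsp, h𝔞 s hs m⟩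

end Residues

/-! ### Morphisms of noncommutative varieties over affine open sets -/

/-- A variant of `IsCoherent.loc` for an open set that is only propositionally equal to `D(f)`, such as the
preimage of a basic open set. -/
lemma IsCoherent.loc' {X : Scheme.{u}} {A : Sheaf (Opens.grothendieckTopology X) RingCat.{u}}
    {str : X.ringCatSheaf ⟶ A} {F : SheafOfModules.{u} A} (hF : IsCoherent str F) {U : X.Opens}
    (hU : IsAffineOpen U) (f : Γ(X, U)) {W : X.Opens} (hW : W = X.basicOpen f) (hWU : W ≤ U) :
    (∀ s : F.val.obj (op W), ∃ (n : ℕ) (t : F.val.obj (op U)),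
      F.val.map (homOfLE hWU).op t = A.obj.map (homOfLE hWU).op (strApp str U (f ^ n)) • s) ∧
    ∀ t : F.val.obj (op U), F.val.map (homOfLE hWU).op t = 0 → ∃ n : ℕ, strApp str U (f ^ n) • t = 0 := by
  subst hW
  exact hF.loc str hU f

namespace NCHom

variable {K : Type u} [Field K] {𝒴 𝒳 : NCVariety K} (π : NCHom 𝒴 𝒳)

lemma sharpApp_str (U : 𝒳.space.Opens) (r : Γ(𝒳.space, U)) :
    π.sharpApp U (strApp 𝒳.str U r) = strApp 𝒴.str (π.base ⁻¹ᵁ U) (π.base.app U r) :=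
  congrArg (fun φ : 𝒳.space.ringCatSheaf ⟶ π.pushRing => (φ.hom.app (op U)).hom r) π.str_sharp

lemma sharpStalk_germ (U : 𝒳.space.Opens) (x : 𝒳.space) (hx : x ∈ U) (a : 𝒳.sheaf.obj.obj (op U)) :
    π.sharpStalk x (germR 𝒳.sheaf U x hx a) = germR π.pushRing U x hx (π.sharpApp U a) :=
  TopCat.Presheaf.stalkFunctor_map_germ_apply U x hx π.sharp.hom a

/-- Sections of the direct image of a coherent sheaf over basic open sets. -/
lemma push_loc [IsFinite π.base] {G : SheafOfModules.{u} 𝒴.sheaf} (hG : IsCoherent 𝒴.str G) {U : 𝒳.space.Opens}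
    (hU : IsAffineOpen U) (f : Γ(𝒳.space, U)) :
    (∀ s : G.val.obj (op (π.base ⁻¹ᵁ 𝒳.space.basicOpen f)), ∃ (n : ℕ) (t : G.val.obj (op (π.base ⁻¹ᵁ U))),
      G.val.map ((Opens.map π.base.base).map (homOfLE (𝒳.space.basicOpen_le f))).op t =
        π.sharpApp _ (𝒳.sheaf.obj.map (homOfLE (𝒳.space.basicOpen_le f)).op (strApp 𝒳.str U (f ^ n))) • s) ∧
    ∀ t : G.val.obj (op (π.base ⁻¹ᵁ U)),
      G.val.map ((Opens.map π.base.base).map (homOfLE (𝒳.space.basicOpen_le f))).op t = 0 →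
        ∃ n : ℕ, π.sharpApp U (strApp 𝒳.str U (f ^ n)) • t = 0 := by
  have hV : IsAffineOpen (π.base ⁻¹ᵁ U) := hU.preimage π.base
  have hW : π.base ⁻¹ᵁ 𝒳.space.basicOpen f = 𝒴.space.basicOpen (π.base.app U f) :=
    Scheme.preimage_basicOpen _ _
  obtain ⟨h1, h2⟩ := hG.loc' hV (π.base.app U f) hW (π.base.preimage_mono (𝒳.space.basicOpen_le f))
  refine ⟨fun s => ?_, fun t ht => ?_⟩
  · obtain ⟨n, t, h⟩ := h1 s
    refine ⟨n, t, Eq.trans h ?_⟩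
    rw [sharpApp_res, sharpApp_str, map_pow (π.base.app U).hom]
    rfl
  · obtain ⟨n, h⟩ := h2 t ht
    refine ⟨n, ?_⟩
    rw [sharpApp_str, map_pow (π.base.app U).hom]
    exact h

namespace IsNormalization

variable {π} (hπ : π.IsNormalization)
include hπ

lemma sharpStalk_injective (x : 𝒳.space) : Function.Injective (π.sharpStalk x) := by
  obtain ⟨j, -, h⟩ := hπ.exists_embedding x
  refine fun a b hab => hπ.toFrac_injective x ?_
  rw [← h, ← h, hab]

lemma sharpApp_injective (U : 𝒳.space.Opens) : Function.Injective (π.sharpApp U) := by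
  intro a b hab
  refine TopCat.Presheaf.section_ext (C := RingCat.{u}) 𝒳.sheaf U a b fun x hx => ?_
  refine hπ.sharpStalk_injective x ?_
  refine (π.sharpStalk_germ U x hx a).trans (Eq.trans ?_ (π.sharpStalk_germ U x hx b).symm)
  rw [hab]

/-- Being a section of `A` is a local property of sections of `π_* B`. -/
lemma mem_range_of_locally (U : 𝒳.space.Opens) (b : 𝒴.sheaf.obj.obj (op (π.base ⁻¹ᵁ U)))
    (h : ∀ x ∈ U, ∃ (W : 𝒳.space.Opens) (i : W ⟶ U), x ∈ W ∧
      𝒴.sheaf.obj.map ((Opens.map π.base.base).map i).op b ∈ (π.sharpApp W).range) : b ∈ (π.sharpApp U).range := by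
  choose W i hW a ha using fun x : U => h x.1 x.2
  have hcov : U ≤ iSup W := fun x hx => Opens.mem_iSup.2 ⟨⟨x, hx⟩, hW ⟨x, hx⟩⟩
  have hcomp : TopCat.Presheaf.IsCompatible 𝒳.sheaf.obj W a := fun x y => by
    refine hπ.sharpApp_injective _ ?_
    refine (π.sharpApp_res _ _).trans (Eq.trans ?_ (π.sharpApp_res _ _).symm)
    rw [ha, ha]
    have h1 := congr(($(𝒴.sheaf.obj.map_comp ((Opens.map π.base.base).map (i x)).op ((Opens.map π.base.base).map (Opens.infLELeft (W x) (W y))).op)) b)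
    have h2 := congr(($(𝒴.sheaf.obj.map_comp ((Opens.map π.base.base).map (i y)).op ((Opens.map π.base.base).map (Opens.infLERight (W x) (W y))).op)) b)
    exact h1.symm.trans h2
  obtain ⟨s, hs, -⟩ := TopCat.Sheaf.existsUnique_gluing' (C := RingCat.{u}) 𝒳.sheaf W U i hcov a hcomp
  refine ⟨s, TopCat.Presheaf.section_ext (C := RingCat.{u}) 𝒴.sheaf (π.base ⁻¹ᵁ U) _ _ fun y hy => ?_⟩
  have h1 := congrArg (π.sharpApp (W ⟨π.base y, hy⟩)) (hs ⟨π.base y, hy⟩)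
  have h2 := (π.sharpApp_res (i ⟨π.base y, hy⟩) s).symm.trans (h1.trans (ha _))
  have h3 := congrArg (germR 𝒴.sheaf _ y (hW ⟨π.base y, hy⟩)) h2
  refine (germR_res (A := 𝒴.sheaf) ((Opens.map π.base.base).map (i ⟨π.base y, hy⟩)) y (hW ⟨π.base y, hy⟩) _).symm.trans
    (h3.trans (germR_res (A := 𝒴.sheaf) ((Opens.map π.base.base).map (i ⟨π.base y, hy⟩)) y (hW ⟨π.base y, hy⟩) b))

end IsNormalization

end NCHom

/-! ### Points of curves -/

/-- If `p` is minimal among the primes that contain `I`, then every element of `p` is nilpotent modulo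
`I` locally at `p`. -/
lemma exists_mul_pow_mem {R : Type u} [CommRing R] (I p : Ideal R) [hp : p.IsPrime]
    (h : ∀ q : Ideal R, q.IsPrime → I ≤ q → q ≤ p → q = p) {r : R} (hr : r ∈ p) :
    ∃ t ∉ p, ∃ k : ℕ, t * r ^ k ∈ I := by
  by_contra! hc
  -- Otherwise a prime ideal over `I` avoids all `t * r ^ k`; it is contained in `p`, but not equal to it.
  let T : Submonoid R :=
    { carrier := {s | ∃ t ∉ p, ∃ k : ℕ, t * r ^ k = s}
      one_mem' := ⟨1, fun h1 => hp.ne_top ((Ideal.eq_top_iff_one _).2 h1), 0, by simp⟩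
      mul_mem' := by
        rintro _ _ ⟨t, ht, k, rfl⟩ ⟨t', ht', k', rfl⟩
        exact ⟨t * t', hp.mul_notMem ht ht', k + k', by ring⟩ }
  have hd : Disjoint (I : Set R) T := Set.disjoint_left.2 fun s hs ⟨t, ht, k, e⟩ => hc t ht k (e ▸ hs)
  obtain ⟨q, hq, hIq, hqT⟩ := Ideal.exists_le_prime_disjoint I T hd
  have hqp : q ≤ p := fun s hs => by
    by_contra hsp
    exact Set.disjoint_left.1 hqT hs ⟨s, hsp, 0, by simp⟩
  have h1 : r ∈ q := h q hq hIq hqp ▸ hr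
  exact Set.disjoint_left.1 hqT h1 ⟨1, fun h1 => hp.ne_top ((Ideal.eq_top_iff_one _).2 h1), 1, by simp⟩

namespace NCVariety

variable {K : Type u} [Field K] {𝒳 : NCVariety K}

/-- On a curve there are no chains of two proper specializations. -/
lemma IsNCCurve.eq_or_eq (h : 𝒳.IsNCCurve) {a b c : 𝒳.space} (hab : a ⤳ b) (hbc : b ⤳ c) : a = b ∨ b = c := by
  by_contra! hne
  obtain ⟨Z, hZ, haZ⟩ := exists_mem_irreducibleComponents_subset_of_isIrreducible (closure {a})
    isIrreducible_singleton.closure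
  have hZc : IsClosed Z := isClosed_of_mem_irreducibleComponents Z hZ
  have ha : a ∈ Z := haZ (subset_closure rfl)
  have hb : b ∈ Z := hab.mem_closed hZc ha
  have hc : c ∈ Z := hbc.mem_closed hZc hb
  let C (z : Z) : IrreducibleCloseds Z := ⟨closure {z}, isIrreducible_singleton.closure, isClosed_closure⟩
  have hlt : ∀ z w : Z, (z : 𝒳.space) ⤳ w → (z : 𝒳.space) ≠ w → C w < C z := fun z w hzw hne' => by
    have hzw' : z ⤳ w := Topology.IsInducing.subtypeVal.specializes_iff.1 hzw
    refine lt_of_le_of_ne ?_ fun heq => hne' ?_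
    · exact (specializes_iff_closure_subset.1 hzw' : closure {w} ⊆ closure {z})
    · have h1 : closure {w} = closure {z} := congrArg IrreducibleCloseds.carrier heq
      have h2 : w ⤳ z := specializes_iff_closure_subset.2 h1.ge
      exact (hzw.antisymm (Topology.IsInducing.subtypeVal.specializes_iff.2 h2)).eq
  -- Three distinct points give a chain of length two of irreducible closed subsets of the component `Z`.
  let s : LTSeries (IrreducibleCloseds Z) :=
    { length := 2
      toFun := ![C ⟨c, hc⟩, C ⟨b, hb⟩, C ⟨a, ha⟩]
      step := fun i => by
        fin_cases i
        · exact hlt _ _ hbc hne.2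
        · exact hlt _ _ hab hne.1 }
  have h2 : ((2 : ℕ) : WithBot ℕ∞) ≤ topologicalKrullDim Z := Order.LTSeries.length_le_krullDim s
  rw [h.dim_one Z hZ] at h2
  exact absurd h2 (by decide)

/-- The local ring of a reduced scheme at a generic point is a field. -/
lemma specializes_generic_isUnit {η : 𝒳.space} (h : ∀ z : 𝒳.space, z ⤳ η → z = η) (s : 𝒳.space.presheaf.stalk η) (hs : s ≠ 0) :
    IsUnit s := by
  have := 𝒳.reduced
  obtain ⟨W, hW, r, rfl⟩ := 𝒳.space.presheaf.exists_germ_eq s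
  obtain ⟨_, ⟨U, hU, rfl⟩, hηU, hUW⟩ := 𝒳.space.isBasis_affineOpens.exists_subset_of_mem_open hW W.2
  have hU : IsAffineOpen U := hU
  have hηU : η ∈ U := hηU
  let r' : Γ(𝒳.space, U) := 𝒳.space.presheaf.map (homOfLE hUW).op r
  have e : 𝒳.space.presheaf.germ U η hηU r' = 𝒳.space.presheaf.germ W η hW r :=
    TopCat.Presheaf.germ_res_apply 𝒳.space.presheaf (homOfLE hUW) η hηU r
  rw [← e] at hs ⊢
  -- A function that vanishes at a generic point is nilpotent near it, hence zero.
  by_cases hr : r' ∈ ptIdeal hU η hηU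
  · obtain ⟨t, ht, k, htk⟩ := exists_mul_pow_mem ⊥ (ptIdeal hU η hηU) (fun q hq _ hqp => by
      obtain ⟨z, hz, rfl⟩ := exists_ptIdeal_eq hU q
      obtain rfl := h z ((ptIdeal_le_iff hU).1 hqp)
      rfl) hr
    have h1 := congrArg (𝒳.space.presheaf.germ U η hηU).hom (Ideal.mem_bot.1 htk)
    rw [map_mul, map_pow, map_zero] at h1
    have h2 : IsUnit (𝒳.space.presheaf.germ U η hηU t) :=
      (Scheme.mem_basicOpen _ _ _ hηU).1 ((notMem_ptIdeal hU).1 ht)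
    have h3 := h2.mul_right_eq_zero.1 h1
    exact (hs (IsReduced.eq_zero _ ⟨k, h3⟩)).elim
  · exact (Scheme.mem_basicOpen _ _ _ hηU).1 ((notMem_ptIdeal hU).1 hr)

/-- At a generic point, `A_η = K(A)_η`. -/
lemma toFrac_surjective {η : 𝒳.space} (h : ∀ z : 𝒳.space, z ⤳ η → z = η) : Function.Surjective (𝒳.toFrac η) := by
  intro z
  induction z using TensorProduct.induction_on with
  | zero => exact ⟨0, map_zero _⟩
  | add x y hx hy =>
    obtain ⟨a, rfl⟩ := hx
    obtain ⟨b, rfl⟩ := hy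
    exact ⟨a + b, map_add _ _ _⟩
  | tmul q a =>
    obtain ⟨r, hr⟩ : ∃ r : 𝒳.space.presheaf.stalk η, algebraMap _ (FractionRing (𝒳.space.presheaf.stalk η)) r = q := by
      obtain ⟨r, s, rfl⟩ := IsLocalization.exists_mk'_eq (nonZeroDivisors (𝒳.space.presheaf.stalk η)) q
      obtain ⟨u, hu⟩ := specializes_generic_isUnit h s.1 (nonZeroDivisors.ne_zero s.2)
      refine ⟨r * ↑u⁻¹, (IsLocalization.eq_mk'_iff_mul_eq).2 ?_⟩
      rw [← hu, ← map_mul, mul_assoc, Units.inv_mul, mul_one]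
    refine ⟨r • a, ?_⟩
    rw [map_smul, ← hr]
    change r • ((1 : FractionRing _) ⊗ₜ a) = _
    rw [TensorProduct.smul_tmul', Algebra.smul_def, mul_one]

end NCVariety

namespace NCHom.IsNormalization

variable {K : Type u} [Field K] {𝒴 𝒳 : NCVariety K} {π : NCHom 𝒴 𝒳} (hπ : π.IsNormalization)
include hπ

/-- Generic points are not singular, since there `A ⊆ π_* B ⊆ K(A)` have the same stalk. -/
lemma generic_notMem_sing {η : 𝒳.space} (h : ∀ z : 𝒳.space, z ⤳ η → z = η) : η ∉ π.sing := by
  refine fun hη => hη ⟨hπ.sharpStalk_injective η, fun b => ?_⟩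
  obtain ⟨j, hj, h'⟩ := hπ.exists_embedding η
  obtain ⟨a, ha⟩ := NCVariety.toFrac_surjective h (j b)
  exact ⟨a, hj ((h' a).trans ha)⟩

/-- On a curve, a proper generization of a singular point, or a point with a proper specialization, is
not singular. -/
lemma notMem_sing_of_specializes (h𝒳 : 𝒳.IsNCCurve) {a b : 𝒳.space} (hab : a ⤳ b) (hne : a ≠ b) : a ∉ π.sing :=
  generic_notMem_sing hπ fun _ hz => (h𝒳.eq_or_eq hz hab).resolve_right hne

lemma isClosed_of_mem_sing (h𝒳 : 𝒳.IsNCCurve) {x : 𝒳.space} (hx : x ∈ π.sing) : IsClosed {x} := by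
  refine isClosed_of_closure_subset fun z hz => ?_
  by_contra hne
  exact notMem_sing_of_specializes hπ h𝒳 (specializes_iff_mem_closure.2 hz) (fun h => hne h.symm) hx

end NCHom.IsNormalization

/-! ### The conductor over affine open sets -/

section Core

variable {A B : Type u} [Ring A] [Ring B]

/-- The largest two-sided ideal of `B` that is contained in the image of `A`. -/
def core (σ : A →+* B) : Ideal B where
  carrier := {b | ∀ c d, c * b * d ∈ σ.range}
  zero_mem' c d := by simp
  add_mem' {a b} ha hb c d := by
    rw [mul_add, add_mul]
    exact add_mem (ha c d) (hb c d)
  smul_mem' e b hb c d := by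
    rw [smul_eq_mul, ← mul_assoc]
    exact hb (c * e) d

instance (σ : A →+* B) : (core σ).IsTwoSided := ⟨fun {b} e hb c d => by
  rw [← mul_assoc, mul_assoc (c * b)]
  exact hb c (e * d)⟩

lemma core_le_range {σ : A →+* B} {b : B} (hb : b ∈ core σ) : b ∈ σ.range := by
  have := hb 1 1
  rwa [one_mul, mul_one] at this

instance (σ : A →+* B) (I : Ideal B) [I.IsTwoSided] : (I.comap σ).IsTwoSided :=
  ⟨fun {b} e hb => by
    rw [Ideal.mem_comap, map_mul]
    exact I.mul_mem_right _ hb⟩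

variable {R A' : Type u} [CommRing R] [Ring A'] {T : Submonoid R} {ρ : R →+* A} {α : A →+* A'}

lemma LocAt.central (h : LocAt T ρ α α.toAddMonoidHom) (hρ : ∀ r a, ρ r * a = a * ρ r) (r : R) (a' : A') :
    α (ρ r) * a' = a' * α (ρ r) := by
  obtain ⟨t, ht, b, hb⟩ := h.surj a'
  have hb' : α (ρ t) * a' = α b := hb
  refine (h.unit t ht).mul_left_cancel ?_
  rw [← mul_assoc, ← map_mul, ← map_mul, mul_comm t r, map_mul, map_mul, mul_assoc, hb', ← map_mul, hρ,
    map_mul, ← hb', mul_assoc]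

/-- The extension of a two-sided ideal to a localization. -/
def LocAt.extIdeal (h : LocAt T ρ α α.toAddMonoidHom) (hρ : ∀ r a, ρ r * a = a * ρ r) (I : Ideal A)
    [I.IsTwoSided] : TwoSidedIdeal A' :=
  TwoSidedIdeal.mk' {s | ∃ t ∈ T, ∃ a ∈ I, α (ρ t) * s = α a}
    ⟨1, T.one_mem, 0, I.zero_mem, by simp⟩
    (by
      rintro s s' ⟨t, ht, a, ha, e⟩ ⟨t', ht', a', ha', e'⟩
      refine ⟨t * t', T.mul_mem ht ht', ρ t' * a + ρ t * a', add_mem (I.mul_mem_left _ ha) (I.mul_mem_left _ ha'), ?_⟩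
      rw [map_add, map_mul α (ρ t') a, map_mul α (ρ t) a', ← e, ← e', mul_add, ← mul_assoc, ← mul_assoc]
      simp only [← map_mul]
      rw [mul_comm t' t])
    (by
      rintro s ⟨t, ht, a, ha, e⟩
      exact ⟨t, ht, -a, neg_mem ha, by rw [mul_neg, e, map_neg]⟩)
    (by
      rintro b s ⟨t, ht, a, ha, e⟩
      obtain ⟨t', ht', c, hc⟩ := h.surj b
      have hc' : α (ρ t') * b = α c := hc
      refine ⟨t' * t, T.mul_mem ht' ht, c * a, I.mul_mem_left _ ha, ?_⟩
      rw [map_mul, map_mul, map_mul, ← hc', ← e, mul_assoc, mul_assoc, ← mul_assoc _ b, h.central hρ t b, mul_assoc])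
    (by
      rintro s b ⟨t, ht, a, ha, e⟩
      obtain ⟨t', ht', c, hc⟩ := h.surj b
      have hc' : α (ρ t') * b = α c := hc
      refine ⟨t' * t, T.mul_mem ht' ht, a * c, I.mul_mem_right _ ha, ?_⟩
      rw [map_mul, map_mul, map_mul, ← hc', ← e, mul_assoc, ← mul_assoc (α (ρ t)) s b, ← mul_assoc, h.central hρ t' _, mul_assoc])

lemma LocAt.mem_extIdeal (h : LocAt T ρ α α.toAddMonoidHom) (hρ : ∀ r a, ρ r * a = a * ρ r) (I : Ideal A)
    [I.IsTwoSided] (s : A') : s ∈ h.extIdeal hρ I ↔ ∃ t ∈ T, ∃ a ∈ I, α (ρ t) * s = α a :=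
  TwoSidedIdeal.mem_mk' _ _ _ _ _ _ _

end Core

namespace NCHom

variable {K : Type u} [Field K] {𝒴 𝒳 : NCVariety K} (π : NCHom 𝒴 𝒳)

/-- The central homomorphism `Γ(X, U) → B(π⁻¹ U)`. -/
def baseMap (U : 𝒳.space.Opens) : Γ(𝒳.space, U) →+* 𝒴.sheaf.obj.obj (op (π.base ⁻¹ᵁ U)) :=
  (π.sharpApp U).comp (strApp 𝒳.str U)

lemma baseMap_apply (U : 𝒳.space.Opens) (r : Γ(𝒳.space, U)) : π.baseMap U r = π.sharpApp U (strApp 𝒳.str U r) := rfl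

lemma baseMap_commute (U : 𝒳.space.Opens) (r : Γ(𝒳.space, U)) (b : 𝒴.sheaf.obj.obj (op (π.base ⁻¹ᵁ U))) :
    π.baseMap U r * b = b * π.baseMap U r := by
  rw [baseMap_apply, sharpApp_str]
  exact 𝒴.strApp_commute _ _ _

/-- The two-sided ideal of `B(π⁻¹ U)` of the sections of the conductor. -/
abbrev coreAbove (U : 𝒳.space.Opens) : Ideal (𝒴.sheaf.obj.obj (op (π.base ⁻¹ᵁ U))) := core (π.sharpApp U)

/-- The two-sided ideal of `A(U)` of the sections of the conductor. -/
abbrev coreBelow (U : 𝒳.space.Opens) : Ideal (𝒳.sheaf.obj.obj (op U)) := (π.coreAbove U).comap (π.sharpApp U)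

/-- `B(π⁻¹ U)` is a finitely generated module over `Γ(X, U)`, since `π` is finite and `B` coherent. -/
lemma exists_generators [IsFinite π.base] {U : 𝒳.space.Opens} (hU : IsAffineOpen U) :
    ∃ (n : ℕ) (b : Fin n → 𝒴.sheaf.obj.obj (op (π.base ⁻¹ᵁ U))), ∀ c, ∃ r : Fin n → Γ(𝒳.space, U),
      ∑ i, π.baseMap U (r i) * b i = c := by
  let _ : Algebra Γ(𝒳.space, U) Γ(𝒴.space, π.base ⁻¹ᵁ U) := (π.base.app U).hom.toAlgebra
  have : Module.Finite Γ(𝒳.space, U) Γ(𝒴.space, π.base ⁻¹ᵁ U) := IsFinite.finite_app π.base U hU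
  have := 𝒴.finite_sections (hU.preimage π.base)
  let _ : Module Γ(𝒳.space, U) (𝒴.sheaf.obj.obj (op (π.base ⁻¹ᵁ U))) := Module.compHom _ (π.base.app U).hom
  have : IsScalarTower Γ(𝒳.space, U) Γ(𝒴.space, π.base ⁻¹ᵁ U) (𝒴.sheaf.obj.obj (op (π.base ⁻¹ᵁ U))) :=
    ⟨fun r s b => mul_smul ((π.base.app U).hom r) s b⟩
  have : Module.Finite Γ(𝒳.space, U) (𝒴.sheaf.obj.obj (op (π.base ⁻¹ᵁ U))) :=
    Module.Finite.trans Γ(𝒴.space, π.base ⁻¹ᵁ U) _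
  obtain ⟨n, p, hp⟩ := Module.Finite.exists_fin' Γ(𝒳.space, U) (𝒴.sheaf.obj.obj (op (π.base ⁻¹ᵁ U)))
  refine ⟨n, fun i => p (Pi.single i 1), fun c => ?_⟩
  obtain ⟨r, rfl⟩ := hp c
  refine ⟨r, ?_⟩
  conv_rhs => rw [pi_eq_sum_univ' r, map_sum]
  refine Finset.sum_congr rfl fun i _ => ?_
  rw [map_smul, baseMap_apply, sharpApp_str]
  rfl

/-- To bring `b` into the conductor, it suffices to bring each product `c * b * d` into `A(U)`: as `B(π⁻¹ U)`
is a finitely generated module, one multiplier serves for all `c` and `d`. -/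
lemma exists_mem_core [IsFinite π.base] {U : 𝒳.space.Opens} (hU : IsAffineOpen U) (T : Submonoid Γ(𝒳.space, U))
    (b : 𝒴.sheaf.obj.obj (op (π.base ⁻¹ᵁ U)))
    (h : ∀ c d, ∃ t ∈ T, π.baseMap U t * (c * b * d) ∈ (π.sharpApp U).range) :
    ∃ t ∈ T, π.baseMap U t * b ∈ π.coreAbove U := by
  classical
  obtain ⟨n, e, he⟩ := π.exists_generators hU
  choose t ht h using fun ij : Fin n × Fin n => h (e ij.1) (e ij.2)
  have hr : ∀ r, π.baseMap U r ∈ (π.sharpApp U).range := fun r => ⟨_, rfl⟩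
  refine ⟨∏ ij, t ij, Submonoid.prod_mem _ fun ij _ => ht ij, fun c d => ?_⟩
  obtain ⟨r, rfl⟩ := he c
  obtain ⟨r', rfl⟩ := he d
  rw [Finset.sum_mul, Finset.sum_mul]
  refine sum_mem fun i _ => ?_
  rw [Finset.mul_sum]
  refine sum_mem fun j _ => ?_
  rw [← Finset.prod_erase_mul _ _ (Finset.mem_univ (i, j)), map_mul]
  have e1 : ∀ (x y z w u v p q : 𝒴.sheaf.obj.obj (op (π.base ⁻¹ᵁ U))), (∀ m, z * m = m * z) → (∀ m, w * m = m * w) →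
      (∀ m, p * m = m * p) → x * y * (z * w * u) * (p * q) = x * z * p * (w * (y * u * q)) := by
    intro x y z w u v p q hz hw hp
    calc x * y * (z * w * u) * (p * q) = x * (y * z) * w * u * (p * q) := by simp only [mul_assoc]
      _ = x * z * (y * w) * u * (p * q) := by rw [← hz]; simp only [mul_assoc]
      _ = x * z * w * y * (u * p) * q := by rw [← hw]; simp only [mul_assoc]
      _ = x * z * w * (y * p) * u * q := by rw [← hp]; simp only [mul_assoc]
      _ = x * z * (w * p) * y * u * q := by rw [← hp]; simp only [mul_assoc]
      _ = _ := by rw [← hp]; simp only [mul_assoc]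
  rw [e1 _ _ _ _ _ 0 _ _ (π.baseMap_commute U _) (π.baseMap_commute U _) (π.baseMap_commute U _)]
  exact mul_mem (mul_mem (mul_mem (hr _) (hr _)) (hr _)) (h (i, j))

/-- A section of `π_* B` which over `D(f)` is a section of `A` is so globally after multiplication by a
power of `f`. -/
lemma exists_pow_mem_range [IsFinite π.base] {U : 𝒳.space.Opens} (hU : IsAffineOpen U) (f : Γ(𝒳.space, U))
    (b : 𝒴.sheaf.obj.obj (op (π.base ⁻¹ᵁ U)))
    (h : 𝒴.sheaf.obj.map ((Opens.map π.base.base).map (homOfLE (𝒳.space.basicOpen_le f))).op b ∈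
      (π.sharpApp (𝒳.space.basicOpen f)).range) :
    ∃ n : ℕ, π.baseMap U (f ^ n) * b ∈ (π.sharpApp U).range := by
  obtain ⟨a, ha⟩ := h
  obtain ⟨n, a', ha'⟩ := (𝒳.coherent.loc 𝒳.str hU f).1 a
  let a'' : 𝒳.sheaf.obj.obj (op U) := a'
  have h1 : 𝒳.sheaf.obj.map (homOfLE (𝒳.space.basicOpen_le f)).op a'' =
    𝒳.sheaf.obj.map (homOfLE (𝒳.space.basicOpen_le f)).op (strApp 𝒳.str U (f ^ n)) * a := ha'
  have h2 : 𝒴.sheaf.obj.map ((Opens.map π.base.base).map (homOfLE (𝒳.space.basicOpen_le f))).op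
      (π.baseMap U (f ^ n) * b - π.sharpApp U a'') = 0 := by
    rw [map_sub, map_mul, ← sharpApp_res, h1, map_mul, ha, baseMap_apply, ← sharpApp_res, sub_self]
  obtain ⟨m, hm⟩ := (π.push_loc 𝒴.coherent hU f).2 (π.baseMap U (f ^ n) * b - π.sharpApp U a'') h2
  have h3 : π.baseMap U (f ^ m) * (π.baseMap U (f ^ n) * b - π.sharpApp U a'') = 0 := hm
  refine ⟨m + n, strApp 𝒳.str U (f ^ m) * a'', ?_⟩
  rw [mul_sub, sub_eq_zero] at h3
  rw [pow_add, map_mul (π.baseMap U), mul_assoc, h3, map_mul]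
  rfl

variable {π} (hπ : π.IsNormalization)
include hπ

/-- A section of `π_* B` whose germ at `x` belongs to `A_x` is, up to a function that does not vanish at `x`,
a section of `A`. -/
lemma exists_nonvanishing_mem_range {U : 𝒳.space.Opens} (hU : IsAffineOpen U) (x : 𝒳.space) (hx : x ∈ U)
    (b : 𝒴.sheaf.obj.obj (op (π.base ⁻¹ᵁ U))) (h : germR π.pushRing U x hx b ∈ (π.sharpStalk x).range) :
    ∃ t ∈ nonvanishing U x hx, π.baseMap U t * b ∈ (π.sharpApp U).range := by
  have := hπ.finite
  obtain ⟨a, ha⟩ := h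
  obtain ⟨W, hxW, a, rfl⟩ := exists_germR x a
  rw [sharpStalk_germ] at ha
  obtain ⟨W', hxW', i, j, hij⟩ := TopCat.Presheaf.germ_eq (C := RingCat.{u}) π.pushRing.obj x hxW hx _ _ ha
  obtain ⟨f, hfW, hf⟩ := exists_basicOpen hU hx hxW'
  obtain ⟨n, hn⟩ := π.exists_pow_mem_range hU f b (by
    refine ⟨𝒳.sheaf.obj.map (homOfLE (hfW.trans i.le)).op a, ?_⟩
    rw [sharpApp_res]
    have h1 := congrArg (𝒴.sheaf.obj.map ((Opens.map π.base.base).map (homOfLE hfW)).op) hij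
    have h2 := congr(($(𝒴.sheaf.obj.map_comp ((Opens.map π.base.base).map i).op ((Opens.map π.base.base).map (homOfLE hfW)).op)) (π.sharpApp W a))
    have h3 := congr(($(𝒴.sheaf.obj.map_comp ((Opens.map π.base.base).map j).op ((Opens.map π.base.base).map (homOfLE hfW)).op)) b)
    exact h2.trans (h1.trans h3.symm))
  exact ⟨f ^ n, pow_mem (S := nonvanishing U x hx) hf n, hn⟩

/-- The conductor is the unit ideal away from the singular points. -/
lemma exists_mem_core_of_notMem_sing {U : 𝒳.space.Opens} (hU : IsAffineOpen U) (x : 𝒳.space) (hx : x ∈ U)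
    (h : x ∉ π.sing) : ∃ t ∈ nonvanishing U x hx, π.baseMap U t ∈ π.coreAbove U := by
  have := hπ.finite
  obtain ⟨t, ht, h1⟩ := π.exists_mem_core hU (nonvanishing U x hx) 1 fun c d => by
    refine exists_nonvanishing_mem_range hπ hU x hx _ ?_
    obtain ⟨a, ha⟩ := (not_not.1 h).2 (germR π.pushRing U x hx
      (show 𝒴.sheaf.obj.obj (op (π.base ⁻¹ᵁ U)) from c * 1 * d))
    exact ⟨a, ha⟩
  exact ⟨t, ht, by rwa [mul_one] at h1⟩

/-- The conductor is compatible with restriction: an element of the largest two-sided ideal of `B(π⁻¹ U)` in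
`A(U)` lies in the conductor over every smaller open set. -/
lemma isConductorSection {U : 𝒳.space.Opens} (hU : IsAffineOpen U) (a : 𝒳.sheaf.obj.obj (op U))
    (ha : a ∈ π.coreBelow U) : π.IsConductorSection U a := by
  have := hπ.finite
  intro W i b c
  refine hπ.mem_range_of_locally W _ fun x hx => ?_
  obtain ⟨f, hfW, hf⟩ := exists_basicOpen hU (i.le hx) hx
  refine ⟨𝒳.space.basicOpen f, homOfLE hfW, hf, ?_⟩
  obtain ⟨n, b', hb'⟩ := (π.push_loc 𝒴.coherent hU f).1
    (𝒴.sheaf.obj.map ((Opens.map π.base.base).map (homOfLE hfW)).op b)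
  obtain ⟨m, c', hc'⟩ := (π.push_loc 𝒴.coherent hU f).1
    (𝒴.sheaf.obj.map ((Opens.map π.base.base).map (homOfLE hfW)).op c)
  let b'' : 𝒴.sheaf.obj.obj (op (π.base ⁻¹ᵁ U)) := b'
  let c'' : 𝒴.sheaf.obj.obj (op (π.base ⁻¹ᵁ U)) := c'
  let j : 𝒳.space.basicOpen f ⟶ U := homOfLE (𝒳.space.basicOpen_le f)
  let resB := (𝒴.sheaf.obj.map ((Opens.map π.base.base).map j).op).hom
  let resW := (𝒴.sheaf.obj.map ((Opens.map π.base.base).map (homOfLE hfW)).op).hom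
  have hb : resB b'' = resB (π.baseMap U (f ^ n)) * resW b := by
    rw [baseMap_apply]
    exact Eq.trans hb' (congrArg (· * resW b) (π.sharpApp_res j _))
  have hc : resB c'' = resB (π.baseMap U (f ^ m)) * resW c := by
    rw [baseMap_apply]
    exact Eq.trans hc' (congrArg (· * resW c) (π.sharpApp_res j _))
  have hu : IsUnit (strApp 𝒳.str (𝒳.space.basicOpen f) (𝒳.space.presheaf.map j.op (f ^ n * f ^ m))) := by
    have h1 := (𝒳.space.toRingedSpace.isUnit_res_basicOpen f).pow (n + m)
    have h2 := h1.map (strApp 𝒳.str (𝒳.space.basicOpen f))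
    rw [← pow_add, map_pow (𝒳.space.presheaf.map j.op).hom]
    exact h2
  obtain ⟨a₁, ha₁⟩ := ha b'' c''
  have h3 : π.sharpApp _ (𝒳.sheaf.obj.map j.op a₁) =
      π.baseMap _ (𝒳.space.presheaf.map j.op (f ^ n * f ^ m)) * resW (b * π.sharpApp W (𝒳.sheaf.obj.map i.op a) * c) := by
    have e1 : resW (π.sharpApp W (𝒳.sheaf.obj.map i.op a)) = resB (π.sharpApp U a) := by
      rw [sharpApp_res]
      exact congr(($(𝒴.sheaf.obj.map_comp ((Opens.map π.base.base).map i).op ((Opens.map π.base.base).map (homOfLE hfW)).op)) (π.sharpApp U a)).symm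
    have e2 : ∀ r, π.baseMap _ (𝒳.space.presheaf.map j.op r) = resB (π.baseMap U r) := fun r => by
      rw [baseMap_apply, strApp_res, sharpApp_res]
      rfl
    rw [sharpApp_res, ha₁]
    change resB (b'' * _ * c'') = _
    have e5 : resW (b * π.sharpApp W (𝒳.sheaf.obj.map i.op a) * c) = resW b * resB (π.sharpApp U a) * resW c :=
      (map_mul resW _ c).trans (congrArg (· * resW c) ((map_mul resW b _).trans (congrArg (resW b * ·) e1)))
    rw [map_mul, map_mul, hb, hc, e5, e2, map_mul, map_mul]
    have e3 : ∀ m, resB (π.baseMap U (f ^ n)) * m = m * resB (π.baseMap U (f ^ n)) := fun m => by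
      rw [← e2]; exact π.baseMap_commute _ _ _
    have e4 : ∀ z, resB (π.baseMap U (f ^ m)) * z = z * resB (π.baseMap U (f ^ m)) := fun z => by
      rw [← e2]; exact π.baseMap_commute _ _ _
    rw [← mul_assoc _ (resB (π.baseMap U (f ^ m))), ← e4]
    simp only [← mul_assoc]
    rw [← e4]
  obtain ⟨v, hv⟩ := hu
  refine ⟨↑v⁻¹ * 𝒳.sheaf.obj.map j.op a₁, ?_⟩
  rw [map_mul, h3, baseMap_apply, ← hv, ← mul_assoc, ← map_mul, Units.inv_mul, map_one, one_mul]

end NCHom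

/-! ### The conductor on stalks, and residues at a point -/

lemma LocAt.resAt_ring {R A A' : Type u} [CommRing R] [Ring A] [Ring A'] {T : Submonoid R} {ρ : R →+* A} {α : A →+* A'}
    (h : LocAt T ρ α α.toAddMonoidHom) (I : Ideal A) (I' : Ideal A') [I'.IsTwoSided]
    (hI : ∀ s, s ∈ I' ↔ ∃ t ∈ T, ∃ a ∈ I, α (ρ t) * s = α a) :
    ResAt T ρ α I ((Ideal.Quotient.mk I').comp α).toAddMonoidHom where
  semi a m := by
    change Ideal.Quotient.mk I' (α (a * m)) = α a • Ideal.Quotient.mk I' (α m)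
    rw [map_mul]
    rfl
  unit := h.unit
  surj q := by
    obtain ⟨s, rfl⟩ := Ideal.Quotient.mk_surjective q
    obtain ⟨t, ht, m, hm⟩ := h.surj s
    exact ⟨t, ht, m, congrArg (Ideal.Quotient.mk I') hm⟩
  ker m := by
    have h0 : ((Ideal.Quotient.mk I').comp α).toAddMonoidHom m = 0 ↔ α m ∈ I' := Ideal.Quotient.eq_zero_iff_mem
    rw [h0, hI]
    constructor
    · rintro ⟨t, ht, a, ha, e⟩
      obtain ⟨t', ht', h2⟩ := h.inj (ρ t * m - a) (by
        change α (ρ t * m - a) = 0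
        rw [map_sub, map_mul, e, sub_self])
      refine ⟨t' * t, T.mul_mem ht' ht, ?_⟩
      rw [smul_eq_mul, mul_sub, sub_eq_zero] at h2
      rw [smul_eq_mul, map_mul, mul_assoc, h2]
      exact I.mul_mem_left _ ha
    · rintro ⟨t, ht, hm⟩
      exact ⟨t, ht, _, hm, (map_mul _ _ _).symm⟩

namespace NCHom

variable {K : Type u} [Field K] {𝒴 𝒳 : NCVariety K} {π : NCHom 𝒴 𝒳}

lemma comap_ptIdeal [IsFinite π.base] {U : 𝒳.space.Opens} (hU : IsAffineOpen U) {y : 𝒴.space} (hy : π.base y ∈ U) :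
    (ptIdeal (hU.preimage π.base) y hy).comap (π.base.app U).hom = ptIdeal hU (π.base y) hy := by
  have h := hU.comap_primeIdealOf_appLE (f := π.base) U (π.base ⁻¹ᵁ U) (hU.preimage π.base) le_rfl hy
  rw [Scheme.Hom.appLE_eq_app] at h
  exact congrArg PrimeSpectrum.asIdeal h

lemma app_mem_nonvanishing [IsFinite π.base] {U : 𝒳.space.Opens} (hU : IsAffineOpen U) {y : 𝒴.space} (hy : π.base y ∈ U)
    (t : Γ(𝒳.space, U)) : π.base.app U t ∈ nonvanishing (π.base ⁻¹ᵁ U) y hy ↔ t ∈ nonvanishing U (π.base y) hy :=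
  (mem_nonvanishing_iff (hU.preimage π.base) (hx := hy)).trans
    ((not_congr (Ideal.ext_iff.1 (comap_ptIdeal hU hy) t)).trans (mem_nonvanishing_iff hU).symm)

/-- An ideal of `Γ(Y, π⁻¹ U)` which is not contained in the maximal ideals of the points above `x`
contains a function on `U` that does not vanish at `x`. -/
lemma exists_base_mem [IsFinite π.base] {U : 𝒳.space.Opens} (hU : IsAffineOpen U) (x : 𝒳.space) (hx : x ∈ U)
    (𝔟 : Ideal Γ(𝒴.space, π.base ⁻¹ᵁ U))
    (h : ∀ (y : 𝒴.space) (hy : π.base y ∈ U), π.base y = x → ∃ t ∈ nonvanishing (π.base ⁻¹ᵁ U) y hy, t ∈ 𝔟) :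
    ∃ r ∈ nonvanishing U x hx, π.base.app U r ∈ 𝔟 := by
  by_contra! hc
  let _ : Algebra Γ(𝒳.space, U) Γ(𝒴.space, π.base ⁻¹ᵁ U) := (π.base.app U).hom.toAlgebra
  have : Module.Finite Γ(𝒳.space, U) Γ(𝒴.space, π.base ⁻¹ᵁ U) := IsFinite.finite_app π.base U hU
  have hle : 𝔟.comap (algebraMap Γ(𝒳.space, U) Γ(𝒴.space, π.base ⁻¹ᵁ U)) ≤ ptIdeal hU x hx := fun r hr => by
    by_contra hrx
    exact hc r ((mem_nonvanishing_iff hU).2 hrx) hr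
  obtain ⟨Q, hQ, hQp, hQx⟩ := Ideal.exists_ideal_over_prime_of_isIntegral (ptIdeal hU x hx) 𝔟 hle
  obtain ⟨y, hy, rfl⟩ := exists_ptIdeal_eq (hU.preimage π.base) Q
  have h1 := (comap_ptIdeal hU hy).symm.trans hQx
  obtain rfl := ptIdeal_injective hU h1
  obtain ⟨t, ht, htb⟩ := h y hy rfl
  exact (mem_nonvanishing_iff (hU.preimage π.base)).1 ht (hQ htb)

variable (hπ : π.IsNormalization)
include hπ

/-- The stalks of the conductor are the localizations of its sections over an affine open set. -/
lemma mem_conductor_iff {U : 𝒳.space.Opens} (hU : IsAffineOpen U) (x : 𝒳.space) (hx : x ∈ U) (s : ringStalk 𝒳.sheaf x) :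
    s ∈ π.conductor x ↔ ∃ t ∈ nonvanishing U x hx, ∃ a ∈ π.coreBelow U,
      germR 𝒳.sheaf U x hx (strApp 𝒳.str U t) * s = germR 𝒳.sheaf U x hx a := by
  have := hπ.finite
  have hloc := 𝒳.coherent.locAt_ring 𝒳.str hU x hx
  constructor
  · intro hs
    have hle : TwoSidedIdeal.span (π.conductorGerms x) ≤ hloc.extIdeal (𝒳.strApp_commute U) (π.coreBelow U) := by
      rw [TwoSidedIdeal.span_le]
      rintro _ ⟨W, hxW, a, ha, rfl⟩
      refine (hloc.mem_extIdeal (𝒳.strApp_commute U) (π.coreBelow U) _).2 ?_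
      obtain ⟨f, hfW, hf⟩ := exists_basicOpen hU hx hxW
      obtain ⟨n, a', ha'⟩ := (𝒳.coherent.loc 𝒳.str hU f).1 (𝒳.sheaf.obj.map (homOfLE hfW).op a)
      let a'' : 𝒳.sheaf.obj.obj (op U) := a'
      have h1 : 𝒳.sheaf.obj.map (homOfLE (𝒳.space.basicOpen_le f)).op a'' =
        𝒳.sheaf.obj.map (homOfLE (𝒳.space.basicOpen_le f)).op (strApp 𝒳.str U (f ^ n)) *
          𝒳.sheaf.obj.map (homOfLE hfW).op a := ha'
      have h1' : germR 𝒳.sheaf U x hx a'' = germR 𝒳.sheaf U x hx (strApp 𝒳.str U (f ^ n)) * germR 𝒳.sheaf W x hxW a := by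
        have := congrArg (germR 𝒳.sheaf (𝒳.space.basicOpen f) x hf) h1
        rwa [map_mul, germR_res, germR_res, germR_res] at this
      obtain ⟨t, ht, h2⟩ := π.exists_mem_core hU (nonvanishing U x hx) (π.sharpApp U a'') fun c d => by
        obtain ⟨m, hm⟩ := π.exists_pow_mem_range hU f (c * π.sharpApp U a'' * d) (by
          have h3 := ha (𝒳.space.basicOpen f) (homOfLE hfW)
            (𝒴.sheaf.obj.map ((Opens.map π.base.base).map (homOfLE (𝒳.space.basicOpen_le f))).op
              (π.baseMap U (f ^ n) * c))
            (𝒴.sheaf.obj.map ((Opens.map π.base.base).map (homOfLE (𝒳.space.basicOpen_le f))).op d)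
          convert h3 using 1
          rw [map_mul, map_mul, map_mul, ← sharpApp_res, h1, map_mul, baseMap_apply, ← sharpApp_res]
          have h4 : ∀ m, π.sharpApp (𝒳.space.basicOpen f) (𝒳.sheaf.obj.map (homOfLE (𝒳.space.basicOpen_le f)).op
              (strApp 𝒳.str U (f ^ n))) * m = m * π.sharpApp (𝒳.space.basicOpen f)
                (𝒳.sheaf.obj.map (homOfLE (𝒳.space.basicOpen_le f)).op (strApp 𝒳.str U (f ^ n))) := fun m => by
            rw [← strApp_res]; exact π.baseMap_commute _ _ _
          rw [← mul_assoc, ← h4])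
        exact ⟨f ^ m, pow_mem (S := nonvanishing U x hx) hf m, hm⟩
      refine ⟨t * f ^ n, mul_mem ht (pow_mem (S := nonvanishing U x hx) hf n), strApp 𝒳.str U t * a'', ?_, ?_⟩
      · rw [Ideal.mem_comap, map_mul]
        exact h2
      · rw [map_mul, map_mul, map_mul, h1', mul_assoc]
    exact (hloc.mem_extIdeal (𝒳.strApp_commute U) (π.coreBelow U) s).1 (hle (TwoSidedIdeal.mem_asIdeal.1 hs))
  · rintro ⟨t, ht, a, ha, e⟩
    have h1 : germR 𝒳.sheaf U x hx a ∈ π.conductor x :=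
      TwoSidedIdeal.mem_asIdeal.2 (TwoSidedIdeal.subset_span ⟨U, hx, a, isConductorSection hπ hU a ha, rfl⟩)
    rw [← e] at h1
    have h2 := (π.conductor x).mul_mem_left (↑(hloc.unit t ht).unit⁻¹) h1
    rwa [← mul_assoc, IsUnit.val_inv_mul, one_mul] at h2

/-- The ideals `J_y` are the localizations of the conductor, regarded as an ideal of `B(π⁻¹ U)`. -/
lemma mem_conductorAbove_iff {U : 𝒳.space.Opens} (hU : IsAffineOpen U) (y : 𝒴.space) (hy : π.base y ∈ U)
    (s : ringStalk 𝒴.sheaf y) :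
    s ∈ π.conductorAbove y ↔ ∃ t ∈ nonvanishing (π.base ⁻¹ᵁ U) y hy, ∃ b ∈ π.coreAbove U,
      germR 𝒴.sheaf (π.base ⁻¹ᵁ U) y hy (strApp 𝒴.str (π.base ⁻¹ᵁ U) t) * s = germR 𝒴.sheaf (π.base ⁻¹ᵁ U) y hy b := by
  have := hπ.finite
  have hloc := 𝒴.coherent.locAt_ring 𝒴.str (hU.preimage π.base) y hy
  constructor
  · intro hs
    have hle : TwoSidedIdeal.span (π.stalkMap y '' π.conductorGerms (π.base y)) ≤
        hloc.extIdeal (𝒴.strApp_commute _) (π.coreAbove U) := by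
      rw [TwoSidedIdeal.span_le]
      rintro _ ⟨s, hs, rfl⟩
      refine (hloc.mem_extIdeal (𝒴.strApp_commute _) (π.coreAbove U) _).2 ?_
      obtain ⟨t, ht, a, ha, e⟩ := (mem_conductor_iff hπ hU (π.base y) hy s).1
        (TwoSidedIdeal.mem_asIdeal.2 (TwoSidedIdeal.subset_span hs))
      refine ⟨π.base.app U t, (app_mem_nonvanishing hU hy t).2 ht, _, ha, ?_⟩
      have h1 := congrArg (π.stalkMap y) e
      rwa [map_mul, stalkMap_germ, stalkMap_germ, sharpApp_str] at h1
    exact (hloc.mem_extIdeal (𝒴.strApp_commute _) (π.coreAbove U) s).1 (hle (TwoSidedIdeal.mem_asIdeal.1 hs))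
  · rintro ⟨t, ht, b, hb, e⟩
    have h1 : germR 𝒴.sheaf (π.base ⁻¹ᵁ U) y hy b ∈ π.conductorAbove y := by
      obtain ⟨a, rfl⟩ := core_le_range hb
      rw [← stalkMap_germ]
      exact π.conductor_le_comap y ((mem_conductor_iff hπ hU (π.base y) hy _).2 ⟨1, one_mem _, a, hb, by
        rw [map_one, map_one, one_mul]⟩)
    rw [← e] at h1
    have h2 := (π.conductorAbove y).mul_mem_left (↑(hloc.unit t ht).unit⁻¹) h1
    rwa [← mul_assoc, IsUnit.val_inv_mul, one_mul] at h2

/-- A point at which some function from the conductor does not vanish is not singular. -/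
lemma notMem_sing_of_mem_core {U : 𝒳.space.Opens} (hU : IsAffineOpen U) (x : 𝒳.space) (hx : x ∈ U)
    (t : Γ(𝒳.space, U)) (ht : t ∈ nonvanishing U x hx) (h : π.baseMap U t ∈ π.coreAbove U) : x ∉ π.sing := by
  have := hπ.finite
  refine not_not.2 ⟨hπ.sharpStalk_injective x, fun s => ?_⟩
  obtain ⟨W, hxW, b, rfl⟩ := exists_germR x s
  obtain ⟨f, hfW, hf⟩ := exists_basicOpen hU hx hxW
  obtain ⟨n, b', hb'⟩ := (π.push_loc 𝒴.coherent hU f).1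
    (𝒴.sheaf.obj.map ((Opens.map π.base.base).map (homOfLE hfW)).op b)
  let b'' : 𝒴.sheaf.obj.obj (op (π.base ⁻¹ᵁ U)) := b'
  obtain ⟨a, ha⟩ : π.baseMap U t * b'' ∈ (π.sharpApp U).range := by
    have := h 1 b''
    rwa [one_mul] at this
  let j : 𝒳.space.basicOpen f ⟶ U := homOfLE (𝒳.space.basicOpen_le f)
  have hb : germR π.pushRing U x hx b'' = germR π.pushRing U x hx (π.sharpApp U (strApp 𝒳.str U (f ^ n))) *
      germR π.pushRing W x hxW b := by
    have h0 : 𝒴.sheaf.obj.map ((Opens.map π.base.base).map j).op b'' =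
      π.sharpApp _ (𝒳.sheaf.obj.map j.op (strApp 𝒳.str U (f ^ n))) *
        𝒴.sheaf.obj.map ((Opens.map π.base.base).map (homOfLE hfW)).op b := hb'
    rw [sharpApp_res] at h0
    have h1 := congrArg (germR π.pushRing (𝒳.space.basicOpen f) x hf) h0
    have h2 := (germR_res (A := π.pushRing) j x hf b'').symm.trans (h1.trans (map_mul _ _ _))
    refine h2.trans (congrArg₂ (· * ·) ?_ ?_)
    · exact germR_res (A := π.pushRing) j x hf _
    · exact germR_res (A := π.pushRing) (homOfLE hfW) x hf b
  have hu := isUnit_germR_strApp 𝒳.str (hx := hx) ((nonvanishing U x hx).mul_mem ht (pow_mem (S := nonvanishing U x hx) hf n))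
  obtain ⟨v, hv⟩ := hu
  refine ⟨↑v⁻¹ * germR 𝒳.sheaf U x hx a, ?_⟩
  have h3 : π.sharpStalk x (germR 𝒳.sheaf U x hx a) = π.sharpStalk x ↑v * germR π.pushRing W x hxW b := by
    rw [sharpStalk_germ, ha, hv, sharpStalk_germ, map_mul (strApp 𝒳.str U), map_mul (π.sharpApp U)]
    refine (map_mul (germR π.pushRing U x hx) (π.baseMap U t) b'').trans ?_
    refine (congrArg (germR π.pushRing U x hx (π.baseMap U t) * ·) hb).trans ((mul_assoc _ _ _).symm.trans ?_)
    exact congrArg (· * germR π.pushRing W x hxW b) (map_mul (germR π.pushRing U x hx) _ _).symm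
  rw [map_mul, h3, ← mul_assoc, ← map_mul, Units.inv_mul, map_one, one_mul]

end NCHom

/-! ### Finiteness of the singular set and the Chinese remainder theorem -/

namespace NCHom

variable {K : Type u} [Field K] {𝒴 𝒳 : NCVariety K} {π : NCHom 𝒴 𝒳}

variable (π) in
/-- The ideal of the functions on `U` that lie in the conductor. -/
abbrev conductorIdeal (U : 𝒳.space.Opens) : Ideal Γ(𝒳.space, U) := (π.coreAbove U).comap (π.baseMap U)

variable (hπ : π.IsNormalization)
include hπ

/-- Over an affine open set, the singular points are the zeros of the conductor. -/
lemma mem_sing_iff {U : 𝒳.space.Opens} (hU : IsAffineOpen U) {x : 𝒳.space} (hx : x ∈ U) :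
    x ∈ π.sing ↔ π.conductorIdeal U ≤ ptIdeal hU x hx := by
  refine ⟨fun h t ht => ?_, fun h => ?_⟩
  · by_contra htx
    exact notMem_sing_of_mem_core hπ hU x hx t ((mem_nonvanishing_iff hU).2 htx) ht h
  · by_contra hx'
    obtain ⟨t, ht, h1⟩ := exists_mem_core_of_notMem_sing hπ hU x hx hx'
    exact (mem_nonvanishing_iff hU).1 ht (h h1)

variable (h𝒳 : 𝒳.IsNCCurve)
include h𝒳

/-- The ideal of a singular point is minimal over the conductor. -/
lemma eq_ptIdeal_of_le {U : 𝒳.space.Opens} (hU : IsAffineOpen U) {x : 𝒳.space} (hx : x ∈ U) (q : Ideal Γ(𝒳.space, U))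
    (hq : q.IsPrime) (h : π.conductorIdeal U ≤ q) (hqx : q ≤ ptIdeal hU x hx) : q = ptIdeal hU x hx := by
  obtain ⟨z, hz, rfl⟩ := exists_ptIdeal_eq hU q
  have hzs := (mem_sing_iff hπ hU hz).2 h
  have hzx := (ptIdeal_le_iff hU).1 hqx
  by_cases hne : z = x
  · subst hne
    rfl
  · exact absurd hzs (IsNormalization.notMem_sing_of_specializes hπ h𝒳 hzx hne)

lemma exists_mul_pow_mem_conductorIdeal {U : 𝒳.space.Opens} (hU : IsAffineOpen U) {x : 𝒳.space} (hx : x ∈ U)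
    {f : Γ(𝒳.space, U)} (hf : f ∈ ptIdeal hU x hx) :
    ∃ t ∉ ptIdeal hU x hx, ∃ k : ℕ, t * f ^ k ∈ π.conductorIdeal U :=
  exists_mul_pow_mem _ _ (fun q hq h hqx => eq_ptIdeal_of_le hπ h𝒳 hU hx q hq h hqx) hf

/-- The singular points in an affine open set correspond to minimal primes over the conductor, of which there
are finitely many in a Noetherian ring. -/
lemma finite_sing : π.sing.Finite := by
  have := 𝒳.quasiCompact
  have : CompactSpace 𝒳.space := QuasiCompact.compactSpace_of_compactSpace 𝒳.toSpec
  have key : ∀ x : 𝒳.space, ∃ W ∈ nhds x, (W ∩ π.sing).Finite := fun x => by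
    obtain ⟨U, hU, hx, -⟩ := exists_isAffineOpen_mem_and_subset (X := 𝒳.space) (x := x) (U := ⊤) trivial
    refine ⟨U, U.isOpen.mem_nhds hx, ?_⟩
    have := 𝒳.isNoetherianRing_sections hU
    have hfin := Ideal.finite_minimalPrimes_of_isNoetherianRing Γ(𝒳.space, U) (π.conductorIdeal U)
    have := hfin.to_subtype
    let g : ↥((U : Set 𝒳.space) ∩ π.sing) → (π.conductorIdeal U).minimalPrimes := fun z =>
      ⟨ptIdeal hU z.1 z.2.1, ⟨inferInstance, (mem_sing_iff hπ hU z.2.1).1 z.2.2⟩, fun q hq hle =>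
        (eq_ptIdeal_of_le hπ h𝒳 hU z.2.1 q hq.1 hq.2 hle).ge⟩
    exact Set.finite_coe_iff.1 <| Finite.of_injective g fun z z' h =>
      Subtype.ext (ptIdeal_injective hU (congrArg Subtype.val h))
  choose W hW hfin using key
  obtain ⟨t, ht⟩ := CompactSpace.elim_nhds_subcover W hW
  refine (t.finite_toSet.biUnion fun x _ => hfin x).subset fun z hz => ?_
  have : z ∈ ⋃ x ∈ t, W x := ht ▸ trivial
  simp only [Set.mem_iUnion] at this ⊢
  obtain ⟨x, hx, hzx⟩ := this
  exact ⟨x, hx, hzx, hz⟩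

lemma finite_singAbove : π.singAbove.Finite := by
  have := hπ.finite
  exact (finite_sing hπ h𝒳).preimage' fun x _ => π.base.finite_preimage_singleton x

omit h𝒳 in
/-- The points of the support of `B / J` lie above the singular points. -/
lemma exists_eq_ptIdeal_above {U : 𝒳.space.Opens} (hU : IsAffineOpen U) (hV : IsAffineOpen (π.base ⁻¹ᵁ U))
    (p : Ideal Γ(𝒴.space, π.base ⁻¹ᵁ U)) (hp : p.IsPrime)
    (h : (π.coreAbove U).comap (strApp 𝒴.str (π.base ⁻¹ᵁ U)) ≤ p) :
    ∃ z : {y : π.singAbove // π.base y.1 ∈ U}, p = ptIdeal hV z.1.1 z.2 := by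
  have := hπ.finite
  obtain ⟨y, hy, rfl⟩ := exists_ptIdeal_eq hV p
  have hys : π.base y ∈ π.sing := by
    refine (mem_sing_iff hπ hU hy).2 fun r hr => ?_
    rw [← comap_ptIdeal hU hy]
    refine h ?_
    rw [Ideal.mem_comap]
    refine Eq.mp (congrArg (· ∈ π.coreAbove U) (π.sharpApp_str U r)) hr
  exact ⟨⟨⟨y, hys⟩, hy⟩, rfl⟩

lemma ptIdeal_above_isMaximal {U : 𝒳.space.Opens} (hU : IsAffineOpen U) (hV : IsAffineOpen (π.base ⁻¹ᵁ U))
    (z : {y : π.singAbove // π.base y.1 ∈ U}) : (ptIdeal hV z.1.1 z.2).IsMaximal := by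
  have := hπ.finite
  let _ : Algebra Γ(𝒳.space, U) Γ(𝒴.space, π.base ⁻¹ᵁ U) := (π.base.app U).hom.toAlgebra
  have : Module.Finite Γ(𝒳.space, U) Γ(𝒴.space, π.base ⁻¹ᵁ U) := IsFinite.finite_app π.base U hU
  have h1 : ((ptIdeal hV z.1.1 z.2).comap (algebraMap Γ(𝒳.space, U) Γ(𝒴.space, π.base ⁻¹ᵁ U))).IsMaximal := by
    have := ptIdeal_isMaximal hU z.2 (IsNormalization.isClosed_of_mem_sing hπ h𝒳 z.1.2)
    rw [← comap_ptIdeal hU z.2] at this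
    exact this
  have : (ptIdeal hV z.1.1 z.2).IsPrime := (hV.primeIdealOf ⟨z.1.1, z.2⟩).isPrime
  exact Ideal.isMaximal_of_isIntegral_of_isMaximal_comap _ h1

lemma ptIdeal_sing_isMaximal {U : 𝒳.space.Opens} (hU : IsAffineOpen U)
    (z : {x : π.sing // x.1 ∈ U}) : (ptIdeal hU z.1.1 z.2).IsMaximal :=
  ptIdeal_isMaximal hU z.2 (IsNormalization.isClosed_of_mem_sing hπ h𝒳 z.1.2)

omit h𝒳 in
/-- The residue of `G` at `y` is the localization at `y` of `G / J G`. -/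
lemma residue_resAt {G : SheafOfModules.{u} 𝒴.sheaf} (hG : IsCoherent 𝒴.str G) {U : 𝒳.space.Opens} (hU : IsAffineOpen U)
    (y : 𝒴.space) (hy : π.base y ∈ U) :
    ResAt (nonvanishing (π.base ⁻¹ᵁ U) y hy) (strApp 𝒴.str (π.base ⁻¹ᵁ U)) (germR 𝒴.sheaf (π.base ⁻¹ᵁ U) y hy)
      (π.coreAbove U • (⊤ : Submodule (𝒴.sheaf.obj.obj (op (π.base ⁻¹ᵁ U))) (G.val.obj (op (π.base ⁻¹ᵁ U)))))
      (π.residue G U y hy) := by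
  have := hπ.finite
  exact (hG.locAt 𝒴.str (hU.preimage π.base) y hy).resAt (𝒴.strApp_commute _) _ _ (mem_conductorAbove_iff hπ hU y hy)

/-- Sections of `G` over `π⁻¹ U` with prescribed residues. -/
lemma exists_residue_eq {G : SheafOfModules.{u} 𝒴.sheaf} (hG : IsCoherent 𝒴.str G) {U : 𝒳.space.Opens} (hU : IsAffineOpen U)
    (v : π.restrictAbove.obj G) : ∃ g : (π.push.obj G).val.obj (op U),
      ∀ (y : π.singAbove) (hy : π.base y.1 ∈ U), π.residue G U y.1 hy g = v y := by
  have := hπ.finite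
  have := (finite_singAbove hπ h𝒳).to_subtype
  have hV := hU.preimage π.base
  have := 𝒴.isNoetherianRing_sections hV
  have := ptIdeal_above_isMaximal hπ h𝒳 hU hV
  obtain ⟨g, hg⟩ := ResAt.exists_eq (strApp 𝒴.str (π.base ⁻¹ᵁ U)) _ _
    (fun z : {y : π.singAbove // π.base y.1 ∈ U} => ptIdeal hV z.1.1 z.2)
    (fun s hs m => Submodule.smul_mem_smul hs Submodule.mem_top)
    (fun z z' h => Subtype.ext (Subtype.ext (ptIdeal_injective hV h)))
    (exists_eq_ptIdeal_above hπ hU hV) (fun z t => mem_nonvanishing_iff hV)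
    (fun z => residue_resAt hπ hG hU z.1.1 z.2) (fun z => v z.1)
  exact ⟨g, fun y hy => hg ⟨y, hy⟩⟩

omit h𝒳 in
/-- A section of `G` over `π⁻¹ U` all of whose residues vanish belongs to `J G`. -/
lemma mem_of_residue_eq_zero {G : SheafOfModules.{u} 𝒴.sheaf} (hG : IsCoherent 𝒴.str G) {U : 𝒳.space.Opens} (hU : IsAffineOpen U)
    (g : G.val.obj (op (π.base ⁻¹ᵁ U)))
    (hg : ∀ (y : π.singAbove) (hy : π.base y.1 ∈ U), π.residue G U y.1 hy g = 0) :
    g ∈ π.coreAbove U • (⊤ : Submodule (𝒴.sheaf.obj.obj (op (π.base ⁻¹ᵁ U))) (G.val.obj (op (π.base ⁻¹ᵁ U)))) := by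
  have := hπ.finite
  have hV := hU.preimage π.base
  exact ResAt.mem (strApp 𝒴.str (π.base ⁻¹ᵁ U)) _ _
    (fun z : {y : π.singAbove // π.base y.1 ∈ U} => ptIdeal hV z.1.1 z.2)
    (fun s hs m => Submodule.smul_mem_smul hs Submodule.mem_top)
    (exists_eq_ptIdeal_above hπ hU hV) (fun z t => mem_nonvanishing_iff hV)
    (fun z => residue_resAt hπ hG hU z.1.1 z.2) g (fun z => hg z.1 z.2)

omit h𝒳 in
/-- The ring `B_y / J_y` is the localization at `y` of `B / J`. -/
lemma ring_resAt_above {U : 𝒳.space.Opens} (hU : IsAffineOpen U) (y : 𝒴.space) (hy : π.base y ∈ U) :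
    ResAt (nonvanishing (π.base ⁻¹ᵁ U) y hy) (strApp 𝒴.str (π.base ⁻¹ᵁ U)) (germR 𝒴.sheaf (π.base ⁻¹ᵁ U) y hy)
      (π.coreAbove U) ((Ideal.Quotient.mk (π.conductorAbove y)).comp (germR 𝒴.sheaf (π.base ⁻¹ᵁ U) y hy)).toAddMonoidHom := by
  have := hπ.finite
  exact (𝒴.coherent.locAt_ring 𝒴.str (hU.preimage π.base) y hy).resAt_ring _ _ (mem_conductorAbove_iff hπ hU y hy)

/-- Sections of `B` over `π⁻¹ U` with prescribed residues. -/
lemma exists_mk_germR_above_eq {U : 𝒳.space.Opens} (hU : IsAffineOpen U) (v : π.ringS') :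
    ∃ b : 𝒴.sheaf.obj.obj (op (π.base ⁻¹ᵁ U)), ∀ (y : π.singAbove) (hy : π.base y.1 ∈ U),
      Ideal.Quotient.mk (π.conductorAbove y.1) (germR 𝒴.sheaf (π.base ⁻¹ᵁ U) y.1 hy b) = v y := by
  have := hπ.finite
  have := (finite_singAbove hπ h𝒳).to_subtype
  have hV := hU.preimage π.base
  have := 𝒴.isNoetherianRing_sections hV
  have := ptIdeal_above_isMaximal hπ h𝒳 hU hV
  obtain ⟨g, hg⟩ := ResAt.exists_eq (strApp 𝒴.str (π.base ⁻¹ᵁ U)) _ _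
    (fun z : {y : π.singAbove // π.base y.1 ∈ U} => ptIdeal hV z.1.1 z.2)
    (fun s hs m => (π.coreAbove U).mul_mem_right m hs)
    (fun z z' h => Subtype.ext (Subtype.ext (ptIdeal_injective hV h)))
    (exists_eq_ptIdeal_above hπ hU hV) (fun z t => mem_nonvanishing_iff hV)
    (fun z => ring_resAt_above hπ hU z.1.1 z.2) (fun z => v z.1)
  exact ⟨g, fun y hy => hg ⟨y, hy⟩⟩

omit h𝒳 in
/-- A section of `B` over `π⁻¹ U` all of whose residues vanish belongs to the conductor. -/
lemma mem_coreAbove_of_mk_eq_zero {U : 𝒳.space.Opens} (hU : IsAffineOpen U) (b : 𝒴.sheaf.obj.obj (op (π.base ⁻¹ᵁ U)))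
    (hb : ∀ (y : π.singAbove) (hy : π.base y.1 ∈ U),
      Ideal.Quotient.mk (π.conductorAbove y.1) (germR 𝒴.sheaf (π.base ⁻¹ᵁ U) y.1 hy b) = 0) : b ∈ π.coreAbove U := by
  have := hπ.finite
  have hV := hU.preimage π.base
  exact ResAt.mem (strApp 𝒴.str (π.base ⁻¹ᵁ U)) _ _
    (fun z : {y : π.singAbove // π.base y.1 ∈ U} => ptIdeal hV z.1.1 z.2)
    (fun s hs m => (π.coreAbove U).mul_mem_right m hs)
    (exists_eq_ptIdeal_above hπ hU hV) (fun z t => mem_nonvanishing_iff hV)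
    (fun z => ring_resAt_above hπ hU z.1.1 z.2) b (fun z => hb z.1 z.2)

omit h𝒳 in
lemma exists_eq_ptIdeal_sing {U : 𝒳.space.Opens} (hU : IsAffineOpen U) (p : Ideal Γ(𝒳.space, U)) (hp : p.IsPrime)
    (h : π.conductorIdeal U ≤ p) : ∃ z : {x : π.sing // x.1 ∈ U}, p = ptIdeal hU z.1.1 z.2 := by
  obtain ⟨x, hx, rfl⟩ := exists_ptIdeal_eq hU p
  exact ⟨⟨⟨x, (mem_sing_iff hπ hU hx).2 h⟩, hx⟩, rfl⟩

/-- Sections of `F` over `U` with prescribed residues. -/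
lemma exists_mk_germM_eq {F : SheafOfModules.{u} 𝒳.sheaf} (hF : IsCoherent 𝒳.str F) {U : 𝒳.space.Opens} (hU : IsAffineOpen U)
    (v : π.restrict.obj F) : ∃ s : F.val.obj (op U), ∀ (x : π.sing) (hx : x.1 ∈ U),
      Submodule.Quotient.mk (germM F U x.1 hx s) = v x := by
  have := (finite_sing hπ h𝒳).to_subtype
  have := 𝒳.isNoetherianRing_sections hU
  have := ptIdeal_sing_isMaximal hπ h𝒳 hU
  obtain ⟨g, hg⟩ := ResAt.exists_eq (strApp 𝒳.str U) _ (π.conductorIdeal U)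
    (fun z : {x : π.sing // x.1 ∈ U} => ptIdeal hU z.1.1 z.2)
    (fun s hs m => Submodule.smul_mem_smul (I := π.coreBelow U) hs Submodule.mem_top)
    (fun z z' h => Subtype.ext (Subtype.ext (ptIdeal_injective hU h)))
    (exists_eq_ptIdeal_sing hπ hU) (fun z t => mem_nonvanishing_iff hU)
    (fun z => (hF.locAt 𝒳.str hU z.1.1 z.2).resAt (𝒳.strApp_commute _) _ _ (mem_conductor_iff hπ hU z.1.1 z.2)) (fun z => v z.1)
  exact ⟨g, fun y hy => hg ⟨y, hy⟩⟩

/-- Sections of `A` over `U` with prescribed residues. -/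
lemma exists_mk_germR_eq {U : 𝒳.space.Opens} (hU : IsAffineOpen U) (v : π.ringS) :
    ∃ a : 𝒳.sheaf.obj.obj (op U), ∀ (x : π.sing) (hx : x.1 ∈ U),
      Ideal.Quotient.mk (π.conductor x.1) (germR 𝒳.sheaf U x.1 hx a) = v x := by
  have := (finite_sing hπ h𝒳).to_subtype
  have := 𝒳.isNoetherianRing_sections hU
  have := ptIdeal_sing_isMaximal hπ h𝒳 hU
  obtain ⟨g, hg⟩ := ResAt.exists_eq (strApp 𝒳.str U) _ (π.conductorIdeal U)
    (fun z : {x : π.sing // x.1 ∈ U} => ptIdeal hU z.1.1 z.2)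
    (fun s hs m => (π.coreBelow U).mul_mem_right m hs)
    (fun z z' h => Subtype.ext (Subtype.ext (ptIdeal_injective hU h)))
    (exists_eq_ptIdeal_sing hπ hU) (fun z t => mem_nonvanishing_iff hU)
    (fun z => (𝒳.coherent.locAt_ring 𝒳.str hU z.1.1 z.2).resAt_ring _ _ (mem_conductor_iff hπ hU z.1.1 z.2)) (fun z => v z.1)
  exact ⟨g, fun y hy => hg ⟨y, hy⟩⟩

omit h𝒳 in
/-- The conductor at a singular point `x` is the intersection of `A_x` with the conductors at the
points above `x`. -/
lemma mem_conductor_of_forall (x : 𝒳.space) (s : ringStalk 𝒳.sheaf x)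
    (h : ∀ (y : 𝒴.space) (hy : π.base y = x), π.stalkMap y (hy ▸ s) ∈ π.conductorAbove y) : s ∈ π.conductor x := by
  have := hπ.finite
  obtain ⟨U, hU, hx, -⟩ := exists_isAffineOpen_mem_and_subset (X := 𝒳.space) (x := x) (U := ⊤) trivial
  have hloc := 𝒳.coherent.locAt_ring 𝒳.str hU x hx
  obtain ⟨t, ht, a, ha⟩ := hloc.surj s
  have ha' : germR 𝒳.sheaf U x hx (strApp 𝒳.str U t) * s = germR 𝒳.sheaf U x hx a := ha
  let 𝔟 : Ideal Γ(𝒴.space, π.base ⁻¹ᵁ U) :=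
    { carrier := {r | strApp 𝒴.str (π.base ⁻¹ᵁ U) r * π.sharpApp U a ∈ π.coreAbove U}
      zero_mem' := by simp
      add_mem' := fun {r r'} hr hr' => by
        simp only [Set.mem_ofPred_eq, map_add, add_mul] at hr hr' ⊢
        exact add_mem hr hr'
      smul_mem' := fun c r hr => by
        simp only [Set.mem_ofPred_eq, smul_eq_mul, map_mul, mul_assoc] at hr ⊢
        exact Ideal.mul_mem_left _ _ hr }
  obtain ⟨r, hr, h1⟩ := exists_base_mem hU x hx 𝔟 fun y hy hyx => by
    subst hyx
    have h2 : germR 𝒴.sheaf (π.base ⁻¹ᵁ U) y hy (π.sharpApp U a) ∈ π.conductorAbove y := by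
      rw [← stalkMap_germ, ← ha', map_mul]
      exact Ideal.mul_mem_left _ _ (h y rfl)
    obtain ⟨t', ht', b, hb, e⟩ := (mem_conductorAbove_iff hπ hU y hy _).1 h2
    have hlocY := 𝒴.coherent.locAt_ring 𝒴.str (hU.preimage π.base) y hy
    obtain ⟨t'', ht'', h3⟩ := hlocY.inj (strApp 𝒴.str (π.base ⁻¹ᵁ U) t' * π.sharpApp U a - b) (by
      change germR 𝒴.sheaf (π.base ⁻¹ᵁ U) y hy _ = 0
      rw [map_sub, map_mul, e, sub_self])
    refine ⟨t'' * t', (nonvanishing (π.base ⁻¹ᵁ U) y hy).mul_mem ht'' ht', ?_⟩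
    change strApp 𝒴.str (π.base ⁻¹ᵁ U) (t'' * t') * π.sharpApp U a ∈ π.coreAbove U
    rw [smul_eq_mul, mul_sub, sub_eq_zero] at h3
    rw [map_mul, mul_assoc, h3]
    exact Ideal.mul_mem_left _ _ hb
  refine (mem_conductor_iff hπ hU x hx s).2 ⟨r * t, (nonvanishing U x hx).mul_mem hr ht, strApp 𝒳.str U r * a, ?_, ?_⟩
  · rw [Ideal.mem_comap, map_mul, sharpApp_str]
    exact h1
  · rw [map_mul, map_mul, map_mul, mul_assoc, ha']

omit h𝒳 in
/-- The homomorphism `S → S̃` is injective, since `J_x` consists of the elements of `A_x` that lie in `J_y` for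
all `y` above `x`. -/
lemma ringSMap_injective : Function.Injective π.ringSMap := by
  rw [injective_iff_map_eq_zero]
  intro s hs
  funext x
  obtain ⟨a, ha⟩ := Ideal.Quotient.mk_surjective (s x)
  rw [Pi.zero_apply, ← ha]
  refine Ideal.Quotient.eq_zero_iff_mem.2 (mem_conductor_of_forall hπ x.1 a fun y hy => ?_)
  obtain ⟨x, hx⟩ := x
  change π.base y = x at hy
  subst hy
  exact Ideal.Quotient.eq_zero_iff_mem.1 ((π.ringSMap_apply s ⟨y, hx⟩ a ha.symm).symm.trans (congrFun hs ⟨y, hx⟩))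

end NCHom

/-! ### Reduction modulo ideals and products of rings -/

section Products

/-- Reduction modulo a two-sided ideal is a base change. -/
lemma IsBC.mkQ {A M : Type u} [Ring A] [AddCommGroup M] [Module A M] (I : Ideal A) [I.IsTwoSided] :
    IsBC (Ideal.Quotient.mk I) (Submodule.mkQ (I • (⊤ : Submodule A M))).toAddMonoidHom := by
  have semi : ∀ (a : A) (m : M), (Submodule.mkQ (I • (⊤ : Submodule A M))).toAddMonoidHom (a • m) =
      Ideal.Quotient.mk I a • (Submodule.mkQ (I • (⊤ : Submodule A M))).toAddMonoidHom m := fun a m => rfl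
  let _ : Module A (Extend (Ideal.Quotient.mk I) M) := Module.compHom _ (Ideal.Quotient.mk I)
  let g : M →ₗ[A] Extend (Ideal.Quotient.mk I) M :=
    { toFun := Extend.one (Ideal.Quotient.mk I)
      map_add' := map_add _
      map_smul' := Extend.one_smul (Ideal.Quotient.mk I) }
  have hg : I • (⊤ : Submodule A M) ≤ LinearMap.ker g := by
    refine Submodule.smul_le.2 fun a ha m _ => ?_
    refine (Extend.one_smul (Ideal.Quotient.mk I) a m).trans ?_
    rw [Ideal.Quotient.eq_zero_iff_mem.2 ha, zero_smul]
  let s : (M ⧸ I • (⊤ : Submodule A M)) →ₗ[A] Extend (Ideal.Quotient.mk I) M := Submodule.liftQ _ g hg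
  refine IsBC.mk' semi ?_
    { toFun := s
      map_add' := map_add s
      map_smul' := fun a x => by
        obtain ⟨a, rfl⟩ := Ideal.Quotient.mk_surjective a
        exact map_smul s a x } fun m => Submodule.liftQ_apply _ g (h := hg) m
  rw [eq_top_iff]
  intro x _
  obtain ⟨m, rfl⟩ := Submodule.mkQ_surjective _ x
  exact Submodule.subset_span ⟨m, rfl⟩

variable {Z Z' : Type u} {R : Z → Type u} [∀ z, Ring (R z)] {P : Z → Type u} [∀ z, AddCommGroup (P z)]
  [∀ z, Module (R z) (P z)]

/-- A finite product of finitely generated projective modules is one over the product of the rings. -/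
lemma finite_projective_pi [Finite Z] (h : ∀ z, Module.Finite (R z) (P z) ∧ Module.Projective (R z) (P z)) :
    Module.Finite (∀ z, R z) (∀ z, P z) ∧ Module.Projective (∀ z, R z) (∀ z, P z) := by
  classical
  cases nonempty_fintype Z
  have hd : ∀ z, ∃ (n : ℕ) (φ : Fin n → P z →ₗ[R z] R z) (v : Fin n → P z), ∀ m, ∑ i, φ i m • v i = m := fun z => by
    have := (h z).1
    have := (h z).2
    exact exists_dualBasis (P z)
  choose n φ v hφ using hd
  refine projective_of_dualBasis (ι := Σ z, Fin (n z))
    (fun j =>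
      { toFun := fun m => Pi.single j.1 (φ j.1 j.2 (m j.1))
        map_add' := fun m m' => by rw [Pi.add_apply, map_add, Pi.single_add]
        map_smul' := fun a m => by
          rw [Pi.smul_apply', map_smul]
          funext w
          by_cases hw : w = j.1
          · subst hw; simp
          · simp [Pi.single_eq_of_ne hw] })
    (fun j => Pi.single j.1 (v j.1 j.2)) fun m => funext fun w => ?_
  rw [Fintype.sum_sigma, Finset.sum_apply, Finset.sum_eq_single w]
  · refine Eq.trans ?_ (hφ w (m w))
    rw [Finset.sum_apply]
    refine Finset.sum_congr rfl fun i _ => ?_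
    simp [Pi.smul_apply']
  · intro z _ hz
    rw [Finset.sum_apply]
    refine Finset.sum_eq_zero fun i _ => ?_
    simp [Pi.smul_apply', Pi.single_eq_of_ne hz.symm]
  · intro hw
    exact absurd (Finset.mem_univ w) hw

/-- Base change along a product of ring homomorphisms. -/
lemma IsBC.pi [Finite Z] [Finite Z'] (p : Z' → Z) {R' : Z' → Type u} [∀ y, Ring (R' y)] {P' : Z' → Type u}
    [∀ y, AddCommGroup (P' y)] [∀ y, Module (R' y) (P' y)]
    (hP : ∀ z, Module.Finite (R z) (P z) ∧ Module.Projective (R z) (P z))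
    (f : ∀ y, R (p y) →+* R' y) (μ : ∀ y, P (p y) →+ P' y) (h : ∀ y, IsBC (f y) (μ y))
    (F : (∀ z, R z) →+* (∀ y, R' y)) (hF : ∀ a y, F a y = f y (a (p y)))
    (ν : (∀ z, P z) →+ (∀ y, P' y)) (hν : ∀ m y, ν m y = μ y (m (p y))) : IsBC F ν := by
  classical
  cases nonempty_fintype Z'
  have := (finite_projective_pi hP).1
  have := (finite_projective_pi hP).2
  refine IsBC.of_dual (fun a m => funext fun y => ?_) ?_ fun φ => ?_
  · rw [hν, Pi.smul_apply', Pi.smul_apply', (h y).semi, hν, hF]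
  · rw [eq_top_iff]
    intro w _
    rw [← Finset.univ_sum_single w]
    refine Submodule.sum_mem _ fun y _ => ?_
    have hw : w y ∈ Submodule.span (R' y) (Set.range (μ y)) := (h y).span ▸ Submodule.mem_top
    generalize w y = x at hw
    induction hw using Submodule.span_induction with
    | mem x hx =>
      obtain ⟨m, rfl⟩ := hx
      have : Pi.single y (μ y m) = (Pi.single y 1 : ∀ y, R' y) • ν (Pi.single (p y) m) := by
        funext y'
        by_cases hy : y' = y
        · subst hy
          rw [Pi.smul_apply', hν]
          simp
        · rw [Pi.smul_apply']
          simp [Pi.single_eq_of_ne hy]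
      rw [this]
      exact Submodule.smul_mem _ _ (Submodule.subset_span ⟨_, rfl⟩)
    | zero => rw [Pi.single_zero]; exact zero_mem _
    | add x x' _ _ hx hx' => rw [Pi.single_add]; exact add_mem hx hx'
    | smul a x _ hx =>
      have : (Pi.single y (a • x) : ∀ y, P' y) = (Pi.single y a : ∀ y, R' y) • (Pi.single y x : ∀ y, P' y) := by
        funext y'
        by_cases hy : y' = y
        · subst hy
          rw [Pi.smul_apply']
          simp
        · rw [Pi.smul_apply']
          simp [Pi.single_eq_of_ne hy]
      rw [this]
      exact Submodule.smul_mem _ _ hx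
  · let φz (z : Z) : P z →ₗ[R z] R z :=
      { toFun := fun m => φ (Pi.single z m) z
        map_add' := fun m m' => by rw [Pi.single_add, map_add, Pi.add_apply]
        map_smul' := fun a m => by
          have : (Pi.single z (a • m) : ∀ z, P z) = (Pi.single z a : ∀ z, R z) • (Pi.single z m : ∀ z, P z) := by
            funext z'
            by_cases hz : z' = z
            · subst hz
              rw [Pi.smul_apply']
              simp
            · rw [Pi.smul_apply']
              simp [Pi.single_eq_of_ne hz]
          rw [this, map_smul, Pi.smul_apply', Pi.single_eq_same, RingHom.id_apply] }
    have hφz : ∀ m z, φ m z = φz z (m z) := fun m z => by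
      have : (Pi.single z (m z) : ∀ z, P z) = (Pi.single z 1 : ∀ z, R z) • m := by
        funext z'
        by_cases hz : z' = z
        · subst hz
          rw [Pi.smul_apply']
          simp
        · rw [Pi.smul_apply']
          simp [Pi.single_eq_of_ne hz]
      change φ m z = φ (Pi.single z (m z)) z
      rw [this, map_smul, Pi.smul_apply', Pi.single_eq_same, one_smul]
    let ψ (y : Z') : P' y →ₗ[R' y] R' y := (h y).lift ((f y).toAddMonoidHom.comp (φz (p y)).toAddMonoidHom)
      fun a m => by
        change f y (φz (p y) (a • m)) = f y a * f y (φz (p y) m)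
        rw [map_smul, smul_eq_mul, map_mul]
    refine ⟨{ toFun := fun w y => ψ y (w y)
              map_add' := fun w w' => funext fun y => by rw [Pi.add_apply, map_add, Pi.add_apply]
              map_smul' := fun a w => funext fun y => by
                rw [Pi.smul_apply', map_smul, RingHom.id_apply, Pi.smul_apply'] }, fun m => funext fun y => ?_⟩
    change ψ y (ν m y) = F (φ m) y
    rw [hν, hF, hφz]
    exact (h y).lift_apply _ _ _

end Products

/-! ### Inverse images of vector bundles -/

namespace NCVariety

variable {K : Type u} [Field K] {𝒳 : NCVariety K}

lemma isBC_germM {F : SheafOfModules.{u} 𝒳.sheaf} (hF : IsCoherent 𝒳.str F) {U : 𝒳.space.Opens} (hU : IsAffineOpen U)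
    (x : 𝒳.space) (hx : x ∈ U) : IsBC (germR 𝒳.sheaf U x hx) (germM F U x hx) :=
  (𝒳.coherent.locAt_ring 𝒳.str hU x hx).isBC (hF.locAt 𝒳.str hU x hx)

lemma isVectorBundle.finite_stalk {F : SheafOfModules.{u} 𝒳.sheaf} (hF : 𝒳.isVectorBundle F) (x : 𝒳.space) :
    Module.Finite (ringStalk 𝒳.sheaf x) (modStalk F x) := by
  obtain ⟨U, hU, hx, -⟩ := exists_isAffineOpen_mem_and_subset (X := 𝒳.space) (x := x) (U := ⊤) trivial
  have := module_finite hF.1 hU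
  have := isVectorBundle.projective hF hU
  exact (isBC_germM hF.1 hU x hx).finite_projective.1

end NCVariety

namespace NCHom

variable {K : Type u} [Field K] {𝒴 𝒳 : NCVariety K} (π : NCHom 𝒴 𝒳)

/-- The natural map `F(U) → (π^* F)(π⁻¹ U)`. -/
def pullUnit (F : SheafOfModules.{u} 𝒳.sheaf) (U : 𝒳.space.Opens) :
    F.val.obj (op U) →+ (π.pull.obj F).val.obj (op (π.base ⁻¹ᵁ U)) :=
  (((SheafOfModules.pullbackPushforwardAdjunction.{u} π.sharp).unit.app F).val.app (op U)).hom.toAddMonoidHom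

lemma pullUnit_smul (F : SheafOfModules.{u} 𝒳.sheaf) (U : 𝒳.space.Opens) (a : 𝒳.sheaf.obj.obj (op U)) (m : F.val.obj (op U)) :
    π.pullUnit F U (a • m) = π.sharpApp U a • π.pullUnit F U m :=
  map_smul (((SheafOfModules.pullbackPushforwardAdjunction.{u} π.sharp).unit.app F).val.app (op U)).hom a m

lemma germM_pullUnit (F : SheafOfModules.{u} 𝒳.sheaf) (U : 𝒳.space.Opens) (y : 𝒴.space) (hy : π.base y ∈ U)
    (m : F.val.obj (op U)) : germM (π.pull.obj F) (π.base ⁻¹ᵁ U) y hy (π.pullUnit F U m) =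
      π.pullStalk F y (germM F U (π.base y) hy m) := (π.pullStalk_germ F U y hy m).symm

variable {π}

section

variable [IsFinite π.base] {F : SheafOfModules.{u} 𝒳.sheaf} (hF : 𝒳.isVectorBundle F)
include hF

/-- The stalk of `π^* F` at `y` is the localization of `B(π⁻¹ U) ⊗ F(U)`: both are obtained from `F(U)` by
extension of scalars to `B_y`. -/
lemma extend_locAt {U : 𝒳.space.Opens} (hU : IsAffineOpen U) (y : 𝒴.space) (hy : π.base y ∈ U) :
    LocAt (nonvanishing (π.base ⁻¹ᵁ U) y hy) (strApp 𝒴.str (π.base ⁻¹ᵁ U)) (germR 𝒴.sheaf (π.base ⁻¹ᵁ U) y hy)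
      ((germM (π.pull.obj F) (π.base ⁻¹ᵁ U) y hy).comp
        (Extend.lift (π.sharpApp U) (π.pullUnit F U) (π.pullUnit_smul F U)).toAddMonoidHom) := by
  have := NCVariety.module_finite hF.1 hU
  have := NCVariety.isVectorBundle.projective hF hU
  have h1 := (NCVariety.isBC_germM hF.1 hU (π.base y) hy).comp (isBC_pullStalk π F y)
  have hext := IsBC.extend (f := π.sharpApp U) (M := F.val.obj (op U))
  have := hext.finite_projective.1
  have := hext.finite_projective.2
  have hring : (π.stalkMap y).comp (germR 𝒳.sheaf U (π.base y) hy) =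
      (germR 𝒴.sheaf (π.base ⁻¹ᵁ U) y hy).comp (π.sharpApp U) := RingHom.ext fun a => π.stalkMap_germ U y hy a
  rw [hring] at h1
  refine IsBC.locAt (hext.of_comp (fun b n => ?_) ?_) (𝒴.coherent.locAt_ring 𝒴.str (hU.preimage π.base) y hy)
  · exact (congrArg (germM (π.pull.obj F) (π.base ⁻¹ᵁ U) y hy)
      (map_smul (Extend.lift (π.sharpApp U) (π.pullUnit F U) (π.pullUnit_smul F U)) b n)).trans (germM_smul _ _ _ _ _ _)
  · convert h1 using 1
    refine AddMonoidHom.ext fun m => ?_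
    exact (congrArg (germM (π.pull.obj F) (π.base ⁻¹ᵁ U) y hy)
      (Extend.lift_one (π.pullUnit F U) (π.pullUnit_smul F U) m)).trans (π.germM_pullUnit F U y hy m)

/-- The inverse image of a vector bundle is coherent, with sections `B(π⁻¹ U) ⊗ F(U)` over the preimage of an
affine open set `U`. -/
lemma pull_of_cover : IsCoherent 𝒴.str (π.pull.obj F) ∧ ∀ U : 𝒳.space.affineOpens,
    Function.Bijective (Extend.lift (π.sharpApp U.1) (π.pullUnit F U.1) (π.pullUnit_smul F U.1)) := by
  have hfin (U : 𝒳.space.affineOpens) :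
      Module.Finite (𝒴.sheaf.obj.obj (op (π.base ⁻¹ᵁ U.1))) (Extend (π.sharpApp U.1) (F.val.obj (op U.1))) := by
    have := NCVariety.module_finite hF.1 U.2
    have := NCVariety.isVectorBundle.projective hF U.2
    exact (IsBC.extend (f := π.sharpApp U.1) (M := F.val.obj (op U.1))).finite_projective.1
  refine IsCoherent.of_cover 𝒴.str 𝒴.coherent (π.pull.obj F) (fun U : 𝒳.space.affineOpens => π.base ⁻¹ᵁ U.1)
    (fun U => U.2.preimage π.base) (fun y => ?_) (fun U => Extend (π.sharpApp U.1) (F.val.obj (op U.1)))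
    (fun U => Extend.lift (π.sharpApp U.1) (π.pullUnit F U.1) (π.pullUnit_smul F U.1))
    (fun U y hy => extend_locAt hF U.2 y hy)
  obtain ⟨U, hU, hx, -⟩ := exists_isAffineOpen_mem_and_subset (X := 𝒳.space) (x := π.base y) (U := ⊤) trivial
  exact ⟨⟨U, hU⟩, hx⟩

/-- Over affine open sets, the inverse image of a vector bundle is given by extension of scalars. -/
lemma isBC_pullUnit {U : 𝒳.space.Opens} (hU : IsAffineOpen U) : IsBC (π.sharpApp U) (π.pullUnit F U) :=
  ⟨π.pullUnit_smul F U, (pull_of_cover hF).2 ⟨U, hU⟩⟩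

lemma isVectorBundle_pull : 𝒴.isVectorBundle (π.pull.obj F) := by
  refine ⟨(pull_of_cover hF).1, fun y => ?_⟩
  have := NCVariety.isVectorBundle.finite_stalk hF (π.base y)
  have := hF.2 (π.base y)
  exact (isBC_pullStalk π F y).finite_projective.2

omit [IsFinite π.base] in
lemma fib_finite_projective (x : 𝒳.space) (I : Ideal (ringStalk 𝒳.sheaf x)) [I.IsTwoSided] :
    Module.Finite (ringStalk 𝒳.sheaf x ⧸ I) (Fib F x I) ∧ Module.Projective (ringStalk 𝒳.sheaf x ⧸ I) (Fib F x I) := by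
  have := NCVariety.isVectorBundle.finite_stalk hF x
  have := hF.2 x
  exact (IsBC.mkQ I).finite_projective

omit hF [IsFinite π.base] in
/-- The residue of `π^* F` at `y` is the extension of scalars of the residue of `F` at `π y`. -/
lemma isBC_pullFib (F : SheafOfModules.{u} 𝒳.sheaf) (y : 𝒴.space) :
    IsBC (Ideal.quotientMap (π.conductorAbove y) (π.stalkMap y) (π.conductor_le_comap y))
      (π.pullFib F y).toAddMonoidHom := by
  have h1 := (isBC_pullStalk π F y).comp (IsBC.mkQ (M := modStalk (π.pull.obj F) y) (π.conductorAbove y))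
  refine (IsBC.mkQ (M := modStalk F (π.base y)) (π.conductor (π.base y))).of_comp (fun a v => ?_) ?_
  · obtain ⟨a, rfl⟩ := Ideal.Quotient.mk_surjective a
    exact π.pullFib_smul F y a v
  · convert h1 using 1
    · rfl
    · rfl

/-- The object `(π^* F, ι^* F, θ_F)` of a vector bundle `F` is a triple. -/
lemma isTriple_toTriples (hπ : π.IsNormalization) (h𝒳 : 𝒳.IsNCCurve) : π.isTriple (π.toTriples.obj F) := by
  have := (finite_sing hπ h𝒳).to_subtype
  have := (finite_singAbove hπ h𝒳).to_subtype
  have hP : ∀ x : π.sing, _ := fun x => fib_finite_projective hF x.1 (π.conductor x.1)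
  have hbc : IsBC π.ringSMap (π.pullFibs F) :=
    IsBC.pi (fun y : π.singAbove => (⟨π.base y.1, y.2⟩ : π.sing)) hP _ _ (fun y => isBC_pullFib F y.1)
      π.ringSMap (fun a y => rfl) (π.pullFibs F) (fun m y => rfl)
  refine ⟨isVectorBundle_pull hF, (finite_projective_pi hP).1, (finite_projective_pi hP).2, ?_⟩
  rw [ConcreteCategory.isIso_iff_bijective]
  exact hbc.bij

end

end NCHom

/-! ### Gluing: the sections over affine open sets -/

namespace NCHom

variable {K : Type u} [Field K] {𝒴 𝒳 : NCVariety K} (π : NCHom 𝒴 𝒳)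

section Residues

variable (U : 𝒳.space.Opens)

open Classical in
/-- The residues of a section of `G` over `π⁻¹ U` at all points above the singular points,
extended by zero outside `π⁻¹ U`. -/
def residues (G : SheafOfModules.{u} 𝒴.sheaf) : (π.push.obj G).val.obj (op U) →+ π.restrictAbove.obj G where
  toFun g := fun y : π.singAbove => if hy : π.base y.1 ∈ U then π.residue G U y.1 hy g else 0
  map_zero' := funext fun y => by
    split_ifs
    · exact map_zero _
    · rfl
  map_add' g h := funext fun y : π.singAbove => by
    change _ = (dite _ _ _ : Fib G y.1 (π.conductorAbove y.1)) + dite _ _ _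
    split_ifs
    · exact map_add _ _ _
    · exact (add_zero _).symm

variable {U}

lemma residues_apply (G : SheafOfModules.{u} 𝒴.sheaf) (g : (π.push.obj G).val.obj (op U)) (y : π.singAbove)
    (hy : π.base y.1 ∈ U) : π.residues U G g y = π.residue G U y.1 hy g := dif_pos hy

lemma residues_apply_of_notMem (G : SheafOfModules.{u} 𝒴.sheaf) (g : (π.push.obj G).val.obj (op U)) (y : π.singAbove)
    (hy : π.base y.1 ∉ U) : π.residues U G g y = 0 := dif_neg hy

end Residues

/-- The semilinear map `p ↦ θ(1 ⊗ p)` of a triple. -/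
def tripleMap (T : Comma π.extend π.restrictAbove) : T.left →+ π.restrictAbove.obj T.right :=
  T.hom.hom.toAddMonoidHom.comp (oneTensor π.ringSMap T.left)

lemma tripleMap_apply (T : Comma π.extend π.restrictAbove) (p : T.left) :
    π.tripleMap T p = T.hom.hom (oneTensor π.ringSMap T.left p) := rfl

lemma tripleMap_smul (T : Comma π.extend π.restrictAbove) (s : π.ringS) (p : T.left) :
    π.tripleMap T (s • p) = π.ringSMap s • π.tripleMap T p := by
  rw [tripleMap_apply, oneTensor_smul]
  exact map_smul T.hom.hom _ _

lemma isBC_tripleMap (T : Comma π.extend π.restrictAbove) [IsIso T.hom] : IsBC π.ringSMap (π.tripleMap T) := by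
  refine ⟨π.tripleMap_smul T, ?_⟩
  have h : Extend.lift π.ringSMap (π.tripleMap T) (π.tripleMap_smul T) = T.hom.hom :=
    Extend.hom_ext π.ringSMap fun p => Extend.lift_one _ _ p
  rw [h]
  exact (ConcreteCategory.isIso_iff_bijective T.hom).1 inferInstance

/-- The image of `P` in `∏ G_y / J_y G_y` is the product of its components at the singular points. -/
lemma exists_tripleMap_eq [Finite π.sing] (T : Comma π.extend π.restrictAbove) (w : π.restrictAbove.obj T.right)
    (h : ∀ x : π.sing, ∃ p : T.left, ∀ y : π.singAbove, π.base y.1 = x.1 → w y = π.tripleMap T p y) :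
    ∃ p : T.left, w = π.tripleMap T p := by
  classical
  cases nonempty_fintype π.sing
  choose p hp using h
  have hs : ∀ (x : π.sing) (y : π.singAbove), π.ringSMap (Pi.single x 1) y = if π.base y.1 = x.1 then 1 else 0 := by
    intro x y
    by_cases hxy : π.base y.1 = x.1
    · rw [if_pos hxy]
      have hx : x = ⟨π.base y.1, y.2⟩ := Subtype.ext hxy.symm
      subst hx
      exact (π.ringSMap_apply _ y 1 (Pi.single_eq_same _ _)).trans (by rw [map_one, map_one])
    · rw [if_neg hxy]
      exact (π.ringSMap_apply _ y 0 ((Pi.single_eq_of_ne (fun h => hxy (congrArg Subtype.val h)) _).trans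
        (map_zero _).symm)).trans (by rw [map_zero, map_zero])
  refine ⟨∑ x, (Pi.single x 1 : π.ringS) • p x, funext fun y : π.singAbove => ?_⟩
  have h1 : (∑ x, π.tripleMap T ((Pi.single x 1 : π.ringS) • p x)) y =
      ∑ x, π.ringSMap (Pi.single x 1) y • π.tripleMap T (p x) y :=
    (Finset.sum_apply _ _ _).trans (Finset.sum_congr rfl fun x _ => congrFun (π.tripleMap_smul T _ _) y)
  rw [map_sum]
  refine Eq.trans ?_ h1.symm
  rw [Finset.sum_eq_single (⟨π.base y.1, y.2⟩ : π.sing), hs, if_pos rfl, one_smul]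
  · exact hp ⟨π.base y.1, y.2⟩ y rfl
  · intro x _ hx
    rw [hs, if_neg (fun h => hx (Subtype.ext h.symm)), zero_smul]
  · intro h
    exact absurd (Finset.mem_univ _) h

/-- A section lies in the preimage of `θ(1 ⊗ P)` if and only if the family of its residues belongs
to `θ(1 ⊗ P)`. -/
lemma inPreimage_iff [Finite π.sing] (T : Comma π.extend π.restrictAbove) {U : 𝒳.space.Opens}
    (g : (π.push.obj T.right).val.obj (op U)) :
    π.InPreimage T U g ↔ ∃ p : T.left, π.residues U T.right g = π.tripleMap T p := by
  constructor
  · intro h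
    refine π.exists_tripleMap_eq T _ fun x => ?_
    by_cases hx : x.1 ∈ U
    · obtain ⟨p, hp⟩ := h x.1 x.2 hx
      exact ⟨p, fun y hyx => (π.residues_apply T.right g y (hyx ▸ hx)).trans (hp y (hyx ▸ hx) hyx)⟩
    · exact ⟨0, fun y hyx => by
        rw [map_zero]
        exact π.residues_apply_of_notMem T.right g y (hyx ▸ hx)⟩
  · rintro ⟨p, hp⟩ x _ _
    exact ⟨p, fun y hy _ => (residues_apply π T.right g y hy).symm.trans (congrFun hp y)⟩

/-- The inclusion of the glued sections. -/
def glueIncl (T : Comma π.extend π.restrictAbove) (U : 𝒳.space.Opens) :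
    (π.glue.obj T).val.obj (op U) →+ T.right.val.obj (op (π.base ⁻¹ᵁ U)) where
  toFun g := g.1
  map_zero' := rfl
  map_add' _ _ := rfl

lemma glueIncl_smul (T : Comma π.extend π.restrictAbove) (U : 𝒳.space.Opens) (a : 𝒳.sheaf.obj.obj (op U))
    (g : (π.glue.obj T).val.obj (op U)) : π.glueIncl T U (a • g) = π.sharpApp U a • π.glueIncl T U g := rfl

lemma glueIncl_injective (T : Comma π.extend π.restrictAbove) (U : 𝒳.space.Opens) :
    Function.Injective (π.glueIncl T U) := fun _ _ h => Subtype.ext h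

lemma glueIncl_res (T : Comma π.extend π.restrictAbove) {U V : 𝒳.space.Opens} (i : U ⟶ V)
    (g : (π.glue.obj T).val.obj (op V)) : π.glueIncl T U ((π.glue.obj T).val.map i.op g) =
      T.right.val.map ((Opens.map π.base.base).map i).op (π.glueIncl T V g) := rfl

lemma exists_glueIncl_eq (T : Comma π.extend π.restrictAbove) (U : 𝒳.space.Opens)
    (g : (π.push.obj T.right).val.obj (op U)) (hg : π.InPreimage T U g) : ∃ h, π.glueIncl T U h = g := ⟨⟨g, hg⟩, rfl⟩

lemma inPreimage_glueIncl (T : Comma π.extend π.restrictAbove) (U : 𝒳.space.Opens)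
    (h : (π.glue.obj T).val.obj (op U)) : π.InPreimage T U (π.glueIncl T U h) := h.2

lemma residue_smul_above {G : SheafOfModules.{u} 𝒴.sheaf} (U : 𝒳.space.Opens)
    (y : 𝒴.space) (hy : π.base y ∈ U) (b : 𝒴.sheaf.obj.obj (op (π.base ⁻¹ᵁ U))) (g : G.val.obj (op (π.base ⁻¹ᵁ U))) :
    π.residue G U y hy (b • g) = Ideal.Quotient.mk (π.conductorAbove y) (germR 𝒴.sheaf (π.base ⁻¹ᵁ U) y hy b) •
      π.residue G U y hy g :=
  congrArg (Submodule.mkQ (π.conductorAbove y • (⊤ : Submodule (ringStalk 𝒴.sheaf y) (modStalk G y))))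
    (germM_smul G (π.base ⁻¹ᵁ U) y hy b g)

variable {π} (hπ : π.IsNormalization) (h𝒳 : 𝒳.IsNCCurve)
include hπ

/-- Sections in `J G` have vanishing residues. -/
lemma residue_eq_zero_of_mem {G : SheafOfModules.{u} 𝒴.sheaf} (hG : IsCoherent 𝒴.str G) {U : 𝒳.space.Opens}
    (hU : IsAffineOpen U) (y : 𝒴.space) (hy : π.base y ∈ U) (g : G.val.obj (op (π.base ⁻¹ᵁ U)))
    (hg : g ∈ π.coreAbove U • (⊤ : Submodule (𝒴.sheaf.obj.obj (op (π.base ⁻¹ᵁ U))) (G.val.obj (op (π.base ⁻¹ᵁ U))))) :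
    π.residue G U y hy g = 0 :=
  ((residue_resAt hπ hG hU y hy).ker g).2 ⟨1, Submonoid.one_mem _, by rw [map_one, one_smul]; exact hg⟩

include h𝒳

/-- A functional on `∏ G_y / J_y G_y` lifts to the sections of the vector bundle `G`. -/
lemma exists_lift_functional {G : SheafOfModules.{u} 𝒴.sheaf} (hG : 𝒴.isVectorBundle G) {U : 𝒳.space.Opens}
    (hU : IsAffineOpen U) (ψ : π.restrictAbove.obj G →ₗ[π.ringS'] π.ringS') :
    ∃ φ : G.val.obj (op (π.base ⁻¹ᵁ U)) →ₗ[𝒴.sheaf.obj.obj (op (π.base ⁻¹ᵁ U))] 𝒴.sheaf.obj.obj (op (π.base ⁻¹ᵁ U)),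
      ∀ g (y : π.singAbove) (hy : π.base y.1 ∈ U),
        Ideal.Quotient.mk (π.conductorAbove y.1) (germR 𝒴.sheaf (π.base ⁻¹ᵁ U) y.1 hy (φ g)) =
          ψ (π.residues U G g) y := by
  classical
  have := hπ.finite
  let B := 𝒴.sheaf.obj.obj (op (π.base ⁻¹ᵁ U))
  have : Module.Projective B (G.val.obj (op (π.base ⁻¹ᵁ U))) :=
    NCVariety.isVectorBundle.projective hG (hU.preimage π.base)
  let Z := {y : π.singAbove // π.base y.1 ∈ U}
  let β : B →+* ∀ z : Z, ringStalk 𝒴.sheaf z.1.1 ⧸ π.conductorAbove z.1.1 :=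
    RingHom.pi fun z => (Ideal.Quotient.mk _).comp (germR 𝒴.sheaf (π.base ⁻¹ᵁ U) z.1.1 z.2)
  let _ : Module B (∀ z : Z, ringStalk 𝒴.sheaf z.1.1 ⧸ π.conductorAbove z.1.1) := Module.compHom _ β
  let β' : B →ₗ[B] ∀ z : Z, ringStalk 𝒴.sheaf z.1.1 ⧸ π.conductorAbove z.1.1 :=
    { toFun := β, map_add' := map_add _, map_smul' := fun b c => map_mul β b c }
  have hβ' : Function.Surjective β' := fun v => by
    obtain ⟨b, hb⟩ := exists_mk_germR_above_eq hπ h𝒳 hU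
      (fun y : π.singAbove => if hy : π.base y.1 ∈ U then v ⟨y, hy⟩ else 0)
    exact ⟨b, funext fun z => (hb z.1 z.2).trans (dif_pos z.2)⟩
  let χ : G.val.obj (op (π.base ⁻¹ᵁ U)) →ₗ[B] ∀ z : Z, ringStalk 𝒴.sheaf z.1.1 ⧸ π.conductorAbove z.1.1 :=
    { toFun := fun g z => ψ (π.residues U G g) z.1
      map_add' := fun g h => funext fun z =>
        congrFun ((congrArg ψ (map_add (π.residues U G) g h)).trans (map_add ψ _ _)) z.1
      map_smul' := fun b g => funext fun z => by
        let b' : π.ringS' := fun y : π.singAbove => if hy : π.base y.1 ∈ U then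
          Ideal.Quotient.mk _ (germR 𝒴.sheaf (π.base ⁻¹ᵁ U) y.1 hy b) else 0
        have hb' : ∀ (y : π.singAbove) (hy : π.base y.1 ∈ U), b' y =
            Ideal.Quotient.mk _ (germR 𝒴.sheaf (π.base ⁻¹ᵁ U) y.1 hy b) := fun y hy => dif_pos hy
        have h1 : π.residues U G (b • g : G.val.obj (op (π.base ⁻¹ᵁ U))) = b' • π.residues U G g := funext fun y : π.singAbove => by
          change _ = b' y • π.residues U G g y
          by_cases hy : π.base y.1 ∈ U
          · refine (π.residues_apply G _ y hy).trans ((π.residue_smul_above U y.1 hy b g).trans ?_)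
            exact congrArg₂ (· • ·) (hb' y hy).symm (π.residues_apply G g y hy).symm
          · rw [π.residues_apply_of_notMem G g y hy, smul_zero]
            exact π.residues_apply_of_notMem G _ y hy
        refine (congrFun ((congrArg ψ h1).trans (map_smul ψ b' _)) z.1).trans ?_
        exact congrArg (· * ψ (π.residues U G g) z.1) (hb' z.1 z.2) }
  obtain ⟨φ, hφ⟩ := Module.projective_lifting_property β' χ hβ'
  exact ⟨φ, fun g y hy => congrFun (LinearMap.congr_fun hφ g) ⟨y, hy⟩⟩

/-- Over an affine open set, the glued sections form a finitely generated projective module, which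
becomes the module of the sections of `G` after extension of scalars. -/
lemma glue_projective (T : Comma π.extend π.restrictAbove) (hT : π.isTriple T) {U : 𝒳.space.Opens} (hU : IsAffineOpen U) :
    Module.Finite (𝒳.sheaf.obj.obj (op U)) ((π.glue.obj T).val.obj (op U)) ∧
      Module.Projective (𝒳.sheaf.obj.obj (op U)) ((π.glue.obj T).val.obj (op U)) ∧
        IsBC (π.sharpApp U) (π.glueIncl T U) := by
  obtain ⟨hG, hf, hp, hi⟩ := hT
  have := hπ.finite
  have := (finite_sing hπ h𝒳).to_subtype
  have := NCVariety.module_finite hG.1 (hU.preimage π.base)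
  have := NCVariety.isVectorBundle.projective hG (hU.preimage π.base)
  -- A dual basis of `P` and its extension to the residues of `G` are lifted to sections over `U`.
  obtain ⟨n, ψ, w, ψ', h1, h2, h3⟩ := (π.isBC_tripleMap T).exists_dualBasis
  choose g hg using fun k => exists_residue_eq hπ h𝒳 hG.1 hU (π.tripleMap T (w k))
  have hgp : ∀ k, π.InPreimage T U (g k) := fun k x _ _ => ⟨w k, fun y hy _ => hg k y hy⟩
  choose v hv using fun k => π.exists_glueIncl_eq T U (g k) (hgp k)
  choose φ hφ using fun k => exists_lift_functional hπ h𝒳 hG hU (ψ' k)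
  refine isBC_of_dualBasis_mod (hπ.sharpApp_injective U) (π.glueIncl_injective T U) (π.glueIncl_smul T U)
    (π.coreAbove U) (fun b hb => core_le_range hb) (fun g hg => ?_) φ v (fun k m => ?_) fun g => ?_
  · exact π.exists_glueIncl_eq T U g fun x _ _ => ⟨0, fun y hy _ => by
      rw [map_zero, map_zero]
      exact residue_eq_zero_of_mem hπ hG.1 hU y.1 hy g hg⟩
  · obtain ⟨p, hp⟩ := (π.inPreimage_iff T _).1 (π.inPreimage_glueIncl T U m)
    obtain ⟨a, ha⟩ := exists_mk_germR_eq hπ h𝒳 hU (ψ k p)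
    have h4 : φ k (π.glueIncl T U m) - π.sharpApp U a ∈ π.coreAbove U := by
      refine mem_coreAbove_of_mk_eq_zero hπ hU _ fun y hy => ?_
      rw [map_sub, map_sub, sub_eq_zero]
      refine (hφ k _ y hy).trans ?_
      rw [← stalkMap_germ, ← π.ringSMap_apply (ψ k p) y _ (ha ⟨π.base y.1, y.2⟩ hy).symm, ← h2, ← hp]
    have h5 := add_mem (core_le_range h4) (⟨a, rfl⟩ : π.sharpApp U a ∈ (π.sharpApp U).range)
    rwa [sub_add_cancel] at h5
  · refine mem_of_residue_eq_zero hπ hG.1 hU _ fun y hy => ?_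
    have h4 : π.residue T.right U y.1 hy (∑ k, φ k g • π.glueIncl T U (v k) : T.right.val.obj (op (π.base ⁻¹ᵁ U))) =
        π.residue T.right U y.1 hy g := by
      refine (map_sum (π.residue T.right U y.1 hy) _ _).trans ?_
      have h5 := congrFun (h3 (π.residues U T.right g)) y
      refine Eq.trans ?_ (h5.trans (π.residues_apply T.right g y hy))
      refine Eq.trans ?_ (Finset.sum_apply (M := fun y : π.singAbove => Fib T.right y.1 (π.conductorAbove y.1)) y _ _).symm
      refine Finset.sum_congr rfl fun k _ => ?_
      refine (π.residue_smul_above U y.1 hy _ _).trans ?_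
      exact congrArg₂ (· • ·) (hφ k g y hy) ((congrArg (π.residue T.right U y.1 hy) (hv k)).trans (hg k y hy))
    exact (map_sub (π.residue T.right U y.1 hy) _ _).trans (sub_eq_zero.2 h4.symm)

end NCHom

/-! ### Gluing: coherence -/

namespace NCHom

variable {K : Type u} [Field K] {𝒴 𝒳 : NCVariety K} {π : NCHom 𝒴 𝒳} (hπ : π.IsNormalization) (h𝒳 : 𝒳.IsNCCurve)
include hπ h𝒳

/-- The residues of a section at the points above a zero of `f` are killed by powers of `f`. -/
lemma exists_pow_smul_residue_eq_zero {U : 𝒳.space.Opens} (hU : IsAffineOpen U) (f : Γ(𝒳.space, U))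
    (G : SheafOfModules.{u} 𝒴.sheaf) (t : G.val.obj (op (π.base ⁻¹ᵁ U))) :
    ∃ k : ℕ, ∀ x ∈ π.sing, x ∈ U → x ∉ 𝒳.space.basicOpen f → ∀ (y : π.singAbove) (hy : π.base y.1 ∈ U),
      π.base y.1 = x → π.residue G U y.1 hy (π.baseMap U (f ^ k) • t : G.val.obj (op (π.base ⁻¹ᵁ U))) = 0 := by
  have := hπ.finite
  have := (finite_sing hπ h𝒳).to_subtype
  cases nonempty_fintype π.sing
  have key : ∀ x : π.sing, ∃ k : ℕ, x.1 ∈ U → x.1 ∉ 𝒳.space.basicOpen f → ∀ (y : π.singAbove) (hy : π.base y.1 ∈ U),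
      π.base y.1 = x.1 → Ideal.Quotient.mk (π.conductorAbove y.1)
        (germR 𝒴.sheaf (π.base ⁻¹ᵁ U) y.1 hy (π.baseMap U (f ^ k))) = 0 := fun x => by
    by_cases hx : x.1 ∈ U
    · by_cases hf : x.1 ∈ 𝒳.space.basicOpen f
      · exact ⟨0, fun _ h => absurd hf h⟩
      have hf' : f ∈ ptIdeal hU x.1 hx := by
        by_contra h
        exact hf ((notMem_ptIdeal hU).1 h)
      obtain ⟨t, ht, k, h⟩ := exists_mul_pow_mem_conductorIdeal hπ h𝒳 hU hx hf'
      refine ⟨k, fun _ _ y hy hyx => Ideal.Quotient.eq_zero_iff_mem.2 ?_⟩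
      refine (mem_conductorAbove_iff hπ hU y.1 hy _).2 ⟨π.base.app U t, ?_, _, h, ?_⟩
      · refine (app_mem_nonvanishing hU hy t).2 ((mem_nonvanishing_iff hU).2 ?_)
        obtain ⟨x, hxs⟩ := x
        change π.base y.1 = x at hyx
        subst hyx
        exact ht
      · rw [map_mul (π.baseMap U), map_mul, baseMap_apply, baseMap_apply, sharpApp_str, sharpApp_str]
    · exact ⟨0, fun h => absurd h hx⟩
  choose k hk using key
  -- As there are finitely many singular points, the sum of the exponents is a common one.
  refine ⟨∑ x, k x, fun x hx hxU hxf y hy hyx => ?_⟩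
  refine (π.residue_smul_above U y.1 hy _ _).trans ?_
  have h1 : f ^ (∑ x, k x) = f ^ (∑ z, k z - k ⟨x, hx⟩) * f ^ k ⟨x, hx⟩ := by
    rw [← pow_add, Nat.sub_add_cancel (Finset.single_le_sum (f := k) (fun _ _ => Nat.zero_le _) (Finset.mem_univ _))]
  rw [h1, map_mul, map_mul, map_mul, hk ⟨x, hx⟩ hxU hxf y hy hyx, mul_zero, zero_smul]

variable (T : Comma π.extend π.restrictAbove) (hT : π.isTriple T)
include hT

omit hT in
/-- Glued sections over a basic open set extend after multiplication by a power of the function. -/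
lemma exists_glue_extension (hG : IsCoherent 𝒴.str T.right) {U : 𝒳.space.Opens} (hU : IsAffineOpen U) (f : Γ(𝒳.space, U))
    (s : (π.glue.obj T).val.obj (op (𝒳.space.basicOpen f))) :
    ∃ (n : ℕ) (m : (π.glue.obj T).val.obj (op U)), (π.glue.obj T).val.map (homOfLE (𝒳.space.basicOpen_le f)).op m =
      𝒳.sheaf.obj.map (homOfLE (𝒳.space.basicOpen_le f)).op (strApp 𝒳.str U (f ^ n)) • s := by
  have := hπ.finite
  let j : 𝒳.space.basicOpen f ⟶ U := homOfLE (𝒳.space.basicOpen_le f)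
  obtain ⟨n, t, ht⟩ := (π.push_loc hG hU f).1 (π.glueIncl T _ s)
  obtain ⟨k, hk⟩ := exists_pow_smul_residue_eq_zero hπ h𝒳 hU f T.right t
  let t' : T.right.val.obj (op (π.base ⁻¹ᵁ U)) := π.baseMap U (f ^ k) • t
  let ρ (l : ℕ) : 𝒳.sheaf.obj.obj (op (𝒳.space.basicOpen f)) := 𝒳.sheaf.obj.map j.op (strApp 𝒳.str U (f ^ l))
  have hρ : ρ (k + n) = ρ k * ρ n := (congrArg (fun z => 𝒳.sheaf.obj.map j.op (strApp 𝒳.str U z)) (pow_add f k n)).trans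
    ((congrArg (𝒳.sheaf.obj.map j.op) (map_mul (strApp 𝒳.str U) _ _)).trans (map_mul (𝒳.sheaf.obj.map j.op).hom _ _))
  have h1 : T.right.val.map ((Opens.map π.base.base).map j).op t' = π.glueIncl T _ (ρ (k + n) • s) := by
    refine (PresheafOfModules.map_smul T.right.val ((Opens.map π.base.base).map j).op _ _).trans ?_
    refine (congrArg₂ (· • ·) (π.sharpApp_res j (strApp 𝒳.str U (f ^ k))).symm ht).trans ?_
    refine (smul_smul _ _ _).trans ?_
    refine Eq.trans (congrArg (· • π.glueIncl T _ s) ?_) (π.glueIncl_smul T _ _ s).symm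
    exact (map_mul (π.sharpApp _) (ρ k) (ρ n)).symm.trans (congrArg (π.sharpApp _) hρ.symm)
  -- At the singular points in `D(f)` the residues are those of the glued section `ρ (k + n) • s`; at the others they
  -- vanish.
  have h3 : π.InPreimage T U t' := fun x' hx' hxU => by
    by_cases hxf : x' ∈ 𝒳.space.basicOpen f
    · obtain ⟨p, hp⟩ := π.inPreimage_glueIncl T _ (ρ (k + n) • s) x' hx' hxf
      refine ⟨p, fun y hy hyx => ?_⟩
      have hyf : π.base y.1 ∈ 𝒳.space.basicOpen f := hyx ▸ hxf
      refine Eq.trans ?_ (hp y hyf hyx)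
      exact (π.residue_res T.right j y.1 hyf t').symm.trans (congrArg (π.residue T.right _ y.1 hyf) h1)
    · exact ⟨0, fun y hy hyx => by
        rw [map_zero, map_zero]
        exact hk x' hx' hxU hxf y hy hyx⟩
  obtain ⟨m, hm⟩ := π.exists_glueIncl_eq T U t' h3
  exact ⟨k + n, m, π.glueIncl_injective T _ ((π.glueIncl_res T j m).trans ((congrArg _ hm).trans h1))⟩

omit h𝒳 hT in
/-- Glued sections that vanish over a basic open set are killed by a power of the function. -/
lemma exists_pow_smul_glue_eq_zero (hG : IsCoherent 𝒴.str T.right) {U : 𝒳.space.Opens} (hU : IsAffineOpen U)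
    (f : Γ(𝒳.space, U)) (m : (π.glue.obj T).val.obj (op U))
    (hm : (π.glue.obj T).val.map (homOfLE (𝒳.space.basicOpen_le f)).op m = 0) :
    ∃ n : ℕ, strApp 𝒳.str U (f ^ n) • m = 0 := by
  have := hπ.finite
  have h0 : T.right.val.map ((Opens.map π.base.base).map (homOfLE (𝒳.space.basicOpen_le f))).op (π.glueIncl T U m) = 0 :=
    congrArg (π.glueIncl T (𝒳.space.basicOpen f)) hm
  obtain ⟨n, h2⟩ := (π.push_loc hG hU f).2 (π.glueIncl T U m) h0
  exact ⟨n, π.glueIncl_injective T U h2⟩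

/-- The stalks of the glued sheaf are the localizations of the glued sections over an affine open set. -/
lemma glue_locAt {U : 𝒳.space.Opens} (hU : IsAffineOpen U) (x : 𝒳.space) (hx : x ∈ U) :
    LocAt (nonvanishing U x hx) (strApp 𝒳.str U) (germR 𝒳.sheaf U x hx) (germM (π.glue.obj T) U x hx) :=
  locAt_of_loc 𝒳.str hU (fun f => ⟨exists_glue_extension hπ h𝒳 T hT.1.1 hU f,
    exists_pow_smul_glue_eq_zero hπ T hT.1.1 hU f⟩) x hx

/-- The preimage of `θ(1 ⊗ P)` in `π_* G` is a vector bundle. -/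
lemma isVectorBundle_glue : 𝒳.isVectorBundle (π.glue.obj T) := by
  have hfin (U : 𝒳.space.affineOpens) : Module.Finite (𝒳.sheaf.obj.obj (op U.1)) ((π.glue.obj T).val.obj (op U.1)) :=
    (glue_projective hπ h𝒳 T hT U.2).1
  have hcov (x : 𝒳.space) : ∃ U : 𝒳.space.affineOpens, x ∈ U.1 := by
    obtain ⟨U, hU, hx, -⟩ := exists_isAffineOpen_mem_and_subset (X := 𝒳.space) (x := x) (U := ⊤) trivial
    exact ⟨⟨U, hU⟩, hx⟩
  have hcoh := (IsCoherent.of_cover 𝒳.str 𝒳.coherent (π.glue.obj T) (fun U : 𝒳.space.affineOpens => U.1)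
    (fun U => U.2) hcov (fun U => (π.glue.obj T).val.obj (op U.1)) (fun U => LinearMap.id)
    (fun U x hx => glue_locAt hπ h𝒳 T hT U.2 x hx)).1
  refine ⟨hcoh, fun x => ?_⟩
  obtain ⟨U, hx⟩ := hcov x
  have := hfin U
  have := (glue_projective hπ h𝒳 T hT U.2).2.1
  exact (NCVariety.isBC_germM hcoh U.2 x hx).finite_projective.2

end NCHom

/-! ### The unit: gluing recovers a vector bundle -/

section BaseChange

variable {A B : Type u} [Ring A] [Ring B] {f : A →+* B} {M N : Type u} [AddCommGroup M] [Module A M]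
  [AddCommGroup N] [Module B N] {μ : M →+ N} [Module.Finite A M] [Module.Projective A M]

/-- A finitely generated projective module embeds into its extension of scalars to a larger ring. -/
lemma IsBC.injective (h : IsBC f μ) (hf : Function.Injective f) : Function.Injective μ := by
  obtain ⟨n, φ, v, φ', h1, h2, -⟩ := h.exists_dualBasis
  refine (injective_iff_map_eq_zero μ).2 fun m hm => ?_
  rw [← h1 m]
  refine Finset.sum_eq_zero fun i _ => ?_
  have : f (φ i m) = 0 := by rw [← h2, hm, map_zero]
  rw [(map_eq_zero_iff f hf).1 this, zero_smul]

/-- If the ideal `I` of `B` is contained in `A`, then `I · (B ⊗_A M)` is contained in `M`. -/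
lemma IsBC.mem_range (h : IsBC f μ) (I : Ideal B) [I.IsTwoSided] (hI : ∀ b ∈ I, b ∈ f.range) {x : N}
    (hx : x ∈ I • (⊤ : Submodule B N)) : x ∈ μ.range := by
  obtain ⟨n, φ, v, φ', -, -, h3⟩ := h.exists_dualBasis
  have h4 : ∀ i, φ' i x ∈ I := fun i => by
    have h5 : I • (⊤ : Submodule B N) ≤ Submodule.comap (φ' i) I := Submodule.smul_le.2 fun r hr n _ => by
      rw [Submodule.mem_comap, map_smul]
      exact I.mul_mem_right _ hr
    exact h5 hx
  choose a ha using fun i => hI _ (h4 i)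
  refine ⟨∑ i, a i • v i, ?_⟩
  rw [map_sum, ← h3 x]
  exact Finset.sum_congr rfl fun i _ => by rw [h.semi, ha]

end BaseChange

/-- A morphism of sheaves of modules that is bijective over the affine open sets is an isomorphism. -/
lemma isIso_of_bijective_affine {X : Scheme.{u}} {A : Sheaf (Opens.grothendieckTopology X) RingCat.{u}}
    {F F' : SheafOfModules.{u} A} (φ : F ⟶ F')
    (h : ∀ U : X.Opens, IsAffineOpen U → Function.Bijective (φ.val.app (op U))) : IsIso φ := by
  refine isIso_of_stalkMapM φ fun x => ⟨(injective_iff_map_eq_zero (stalkMapM φ x)).2 fun m hm => ?_, fun m => ?_⟩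
  · obtain ⟨W, hxW, s, rfl⟩ := exists_germM F x m
    rw [stalkMapM_germ] at hm
    obtain ⟨W', hxW', i, h0⟩ := exists_res_eq_zero F'.val.presheaf hxW _ hm
    obtain ⟨U, hU, hxU, hUW⟩ := exists_isAffineOpen_mem_and_subset (X := X) hxW'
    have h1 : φ.val.app (op U) (F.val.map (homOfLE (hUW.trans i.le)).op s) = 0 := by
      refine (PresheafOfModules.naturality_apply φ.val (homOfLE (hUW.trans i.le)).op s).trans ?_
      have h2 := congrArg (F'.val.map (homOfLE hUW).op) h0
      refine Eq.trans ?_ (h2.trans (map_zero _))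
      exact congr(($(F'.val.presheaf.map_comp i.op (homOfLE hUW).op)) (φ.val.app (op W) s))
    have h2 : F.val.map (homOfLE (hUW.trans i.le)).op s = 0 := (h U hU).1 (h1.trans (map_zero _).symm)
    exact (germM_res F (homOfLE (hUW.trans i.le)) x hxU s).symm.trans ((congrArg (germM F U x hxU) h2).trans (map_zero _))
  · obtain ⟨W, hxW, s, rfl⟩ := exists_germM F' x m
    obtain ⟨U, hU, hxU, hUW⟩ := exists_isAffineOpen_mem_and_subset (X := X) hxW
    obtain ⟨t, ht⟩ := (h U hU).2 (F'.val.map (homOfLE hUW).op s)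
    refine ⟨germM F U x hxU t, (stalkMapM_germ φ U x hxU t).trans ?_⟩
    exact (congrArg (germM F' U x hxU) ht).trans (germM_res F' (homOfLE hUW) x hxU s)

namespace NCHom

variable {K : Type u} [Field K] {𝒴 𝒳 : NCVariety K} (π : NCHom 𝒴 𝒳)

lemma residue_pullUnit (F : SheafOfModules.{u} 𝒳.sheaf) (U : 𝒳.space.Opens) (y : 𝒴.space) (hy : π.base y ∈ U)
    (s : F.val.obj (op U)) : π.residue (π.pull.obj F) U y hy (π.pullUnit F U s) =
      π.pullFib F y (Submodule.Quotient.mk (germM F U (π.base y) hy s)) :=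
  congrArg (Submodule.mkQ _) (π.germM_pullUnit F U y hy s)

lemma tripleMap_toTriples (F : SheafOfModules.{u} 𝒳.sheaf) (v : π.restrict.obj F) :
    π.tripleMap (π.toTriples.obj F) v = π.pullFibs F v := π.theta_oneTensor F v

lemma inPreimage_pullUnit (F : SheafOfModules.{u} 𝒳.sheaf) (U : 𝒳.space.Opens) (s : F.val.obj (op U)) :
    π.InPreimage (π.toTriples.obj F) U (π.pullUnit F U s) := fun x _ _ => by
  classical
  let v : π.restrict.obj F := fun x : π.sing =>
    if hx : x.1 ∈ U then (Submodule.Quotient.mk (germM F U x.1 hx s) : Fib F x.1 (π.conductor x.1)) else 0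
  have hv : ∀ (y : 𝒴.space) (hy : π.base y ∈ U) (hys : π.base y ∈ π.sing), v ⟨π.base y, hys⟩ =
      Submodule.Quotient.mk (germM F U (π.base y) hy s) := fun y hy hys => dif_pos hy
  refine ⟨v, fun y hy _ => (π.residue_pullUnit F U y.1 hy s).trans ?_⟩
  refine Eq.trans ?_ (congrFun (π.tripleMap_toTriples F v) y).symm
  exact congrArg (π.pullFib F y.1) (hv y.1 hy y.2).symm

/-- The morphism from `F` to the sheaf glued from the triple of `F`. -/
def toGlue (F : SheafOfModules.{u} 𝒳.sheaf) : F ⟶ π.glue.obj (π.toTriples.obj F) where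
  val := PresheafOfModules.homMk
    { app := fun U => AddCommGrpCat.ofHom
        ({ toFun := fun s => ⟨π.pullUnit F U.unop s, π.inPreimage_pullUnit F U.unop s⟩
           map_zero' := Subtype.ext (map_zero (π.pullUnit F U.unop))
           map_add' := fun s t => Subtype.ext (map_add (π.pullUnit F U.unop) s t) } :
          F.val.obj U →+ (π.glue.obj (π.toTriples.obj F)).val.obj U)
      naturality := fun U V f => by
        ext s
        exact Subtype.ext (PresheafOfModules.naturality_apply
          ((SheafOfModules.pullbackPushforwardAdjunction.{u} π.sharp).unit.app F).val f s) }
    (fun U a s => Subtype.ext (π.pullUnit_smul F U.unop a s))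

lemma glueIncl_toGlue (F : SheafOfModules.{u} 𝒳.sheaf) (U : 𝒳.space.Opens) (s : F.val.obj (op U)) :
    π.glueIncl (π.toTriples.obj F) U ((π.toGlue F).val.app (op U) s) = π.pullUnit F U s := rfl

lemma toGlue_naturality {F F' : SheafOfModules.{u} 𝒳.sheaf} (φ : F ⟶ F') :
    φ ≫ π.toGlue F' = π.toGlue F ≫ π.glue.map (π.toTriples.map φ) := by
  apply SheafOfModules.hom_ext
  apply PresheafOfModules.hom_ext
  intro U
  ext s
  refine Subtype.ext ?_
  exact congrArg (fun ψ : F ⟶ π.push.obj (π.pull.obj F') => ψ.val.app U s)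
    ((SheafOfModules.pullbackPushforwardAdjunction.{u} π.sharp).unit.naturality φ)

variable {π} (hπ : π.IsNormalization) (h𝒳 : 𝒳.IsNCCurve)
include hπ h𝒳

/-- The unit `F → G(F(F))`: a section of `π^* F` whose residues come from `ι^* F` differs from a section of `F`
by an element of `J · π^* F`, which is contained in `F`. -/
lemma isIso_toGlue {F : SheafOfModules.{u} 𝒳.sheaf} (hF : 𝒳.isVectorBundle F) : IsIso (π.toGlue F) := by
  have := hπ.finite
  have := (finite_sing hπ h𝒳).to_subtype
  refine isIso_of_bijective_affine _ fun U hU => ?_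
  have := NCVariety.module_finite hF.1 hU
  have := NCVariety.isVectorBundle.projective hF hU
  have hbc := isBC_pullUnit (π := π) hF hU
  constructor
  · intro s t hst
    exact hbc.injective (hπ.sharpApp_injective U) (congrArg (π.glueIncl (π.toTriples.obj F) U) hst)
  · intro h
    obtain ⟨p, hp⟩ := (π.inPreimage_iff (π.toTriples.obj F) _).1 (π.inPreimage_glueIncl (π.toTriples.obj F) U h)
    obtain ⟨s, hs⟩ := exists_mk_germM_eq hπ h𝒳 hF.1 hU p
    let g : (π.pull.obj F).val.obj (op (π.base ⁻¹ᵁ U)) := π.glueIncl (π.toTriples.obj F) U h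
    have hmem : g - π.pullUnit F U s ∈ π.coreAbove U •
        (⊤ : Submodule (𝒴.sheaf.obj.obj (op (π.base ⁻¹ᵁ U))) ((π.pull.obj F).val.obj (op (π.base ⁻¹ᵁ U)))) := by
      refine mem_of_residue_eq_zero hπ (isVectorBundle_pull hF).1 hU _ fun y hy => ?_
      refine (map_sub (π.residue (π.pull.obj F) U y.1 hy) _ _).trans (sub_eq_zero.2 ?_)
      refine Eq.trans ?_ (π.residue_pullUnit F U y.1 hy s).symm
      refine (π.residues_apply (π.pull.obj F) _ y hy).symm.trans ((congrFun hp y).trans ?_)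
      refine (congrFun (π.tripleMap_toTriples F p) y).trans ?_
      exact congrArg (π.pullFib F y.1) (hs ⟨π.base y.1, y.2⟩ hy).symm
    obtain ⟨s', hs'⟩ := hbc.mem_range (π.coreAbove U) (fun b hb => core_le_range hb) hmem
    refine ⟨s' + s, π.glueIncl_injective (π.toTriples.obj F) U ?_⟩
    refine (π.glueIncl_toGlue F U (s' + s)).trans ?_
    rw [map_add, hs']
    exact sub_add_cancel _ _

end NCHom

/-! ### The counit: a triple is recovered from the glued vector bundle -/

namespace NCHom

variable {K : Type u} [Field K] {𝒴 𝒳 : NCVariety K} (π : NCHom 𝒴 𝒳)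

/-- The inclusion of the glued sheaf, as a morphism of sheaves of modules. -/
def glueInclHom (T : Comma π.extend π.restrictAbove) : π.glue.obj T ⟶ π.push.obj T.right where
  val := (π.gluePresheaf T).ι

lemma glueInclHom_naturality {T T' : Comma π.extend π.restrictAbove} (ψ : T ⟶ T') :
    π.glue.map ψ ≫ π.glueInclHom T' = π.glueInclHom T ≫ π.push.map ψ.right := rfl

/-- The morphism `π^* H → G` from the inverse image of the sheaf `H` glued from a triple `(G, P, θ)`. -/
def pullGlue (T : Comma π.extend π.restrictAbove) : π.pull.obj (π.glue.obj T) ⟶ T.right :=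
  ((SheafOfModules.pullbackPushforwardAdjunction.{u} π.sharp).homEquiv _ _).symm (π.glueInclHom T)

lemma pullGlue_naturality {T T' : Comma π.extend π.restrictAbove} (ψ : T ⟶ T') :
    π.pull.map (π.glue.map ψ) ≫ π.pullGlue T' = π.pullGlue T ≫ ψ.right := by
  rw [pullGlue, pullGlue, ← Adjunction.homEquiv_naturality_left_symm, ← Adjunction.homEquiv_naturality_right_symm,
    glueInclHom_naturality]

lemma pullGlue_pullUnit (T : Comma π.extend π.restrictAbove) (U : 𝒳.space.Opens) (h : (π.glue.obj T).val.obj (op U)) :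
    (π.pullGlue T).val.app (op (π.base ⁻¹ᵁ U)) (π.pullUnit (π.glue.obj T) U h) = π.glueIncl T U h := by
  let adj := SheafOfModules.pullbackPushforwardAdjunction.{u} π.sharp
  have h1 : adj.unit.app (π.glue.obj T) ≫ π.push.map (π.pullGlue T) = π.glueInclHom T :=
    (adj.homEquiv_unit _ _ _).symm.trans ((adj.homEquiv _ _).apply_symm_apply _)
  exact congrArg (fun φ : π.glue.obj T ⟶ π.push.obj T.right => φ.val.app (op U) h) h1

lemma stalkMapM_pullGlue (T : Comma π.extend π.restrictAbove) (U : 𝒳.space.Opens) (y : 𝒴.space) (hy : π.base y ∈ U)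
    (h : (π.glue.obj T).val.obj (op U)) :
    stalkMapM (π.pullGlue T) y (π.pullStalk (π.glue.obj T) y (germM (π.glue.obj T) U (π.base y) hy h)) =
      germM T.right (π.base ⁻¹ᵁ U) y hy (π.glueIncl T U h) := by
  rw [← germM_pullUnit]
  exact (stalkMapM_germ (π.pullGlue T) (π.base ⁻¹ᵁ U) y hy _).trans
    (congrArg (germM T.right (π.base ⁻¹ᵁ U) y hy) (π.pullGlue_pullUnit T U h))

/-- The map from the residues of the glued sheaf to those of `G`. -/
def glueResidues (T : Comma π.extend π.restrictAbove) : π.restrict.obj (π.glue.obj T) →+ π.restrictAbove.obj T.right :=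
  (π.restrictAbove.map (π.pullGlue T)).hom.toAddMonoidHom.comp (π.pullFibs (π.glue.obj T))

lemma glueResidues_smul (T : Comma π.extend π.restrictAbove) (s : π.ringS) (v : π.restrict.obj (π.glue.obj T)) :
    π.glueResidues T (s • v) = π.ringSMap s • π.glueResidues T v :=
  (congrArg (π.restrictAbove.map (π.pullGlue T)).hom (π.pullFibs_smul _ s v)).trans
    (map_smul (π.restrictAbove.map (π.pullGlue T)).hom _ _)

lemma glueResidues_apply (T : Comma π.extend π.restrictAbove) (v : π.restrict.obj (π.glue.obj T)) (y : π.singAbove)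
    (U : 𝒳.space.Opens) (hy : π.base y.1 ∈ U) (h : (π.glue.obj T).val.obj (op U))
    (hv : v ⟨π.base y.1, y.2⟩ = Submodule.Quotient.mk (germM (π.glue.obj T) U (π.base y.1) hy h)) :
    π.glueResidues T v y = π.residue T.right U y.1 hy (π.glueIncl T U h) := by
  have h1 : π.pullFibs (π.glue.obj T) v y = Submodule.Quotient.mk (π.pullStalk _ y.1 (germM (π.glue.obj T) U (π.base y.1) hy h)) :=
    congrArg (π.pullFib (π.glue.obj T) y.1) hv
  refine (congrArg (fibMap (π.pullGlue T) y.1 (π.conductorAbove y.1)) h1).trans ?_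
  exact congrArg (Submodule.mkQ _) (π.stalkMapM_pullGlue T U y.1 hy h)

variable {π} (hπ : π.IsNormalization) (h𝒳 : 𝒳.IsNCCurve)
include hπ

/-- The map `P → S̃ ⊗_S P` is injective, because `P` is projective and `S → S̃` is injective. -/
lemma tripleMap_injective {T : Comma π.extend π.restrictAbove} (hT : π.isTriple T) :
    Function.Injective (π.tripleMap T) := by
  obtain ⟨-, hf, hp, hi⟩ := hT
  exact (π.isBC_tripleMap T).injective (ringSMap_injective hπ)

/-- A morphism to a triple `(G, P, θ)` is determined by its component in `G`. -/
lemma comma_hom_ext {T T' : Comma π.extend π.restrictAbove} (hT' : π.isTriple T') {ψ χ : T ⟶ T'}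
    (h : ψ.right = χ.right) : ψ = χ := by
  refine CommaMorphism.ext ?_ h
  ext p
  refine tripleMap_injective hπ hT' ?_
  have key : ∀ ψ : T ⟶ T', π.tripleMap T' (ψ.left.hom p) = (π.restrictAbove.map ψ.right).hom (π.tripleMap T p) := fun ψ => by
    rw [tripleMap_apply, ← extendScalars_map_oneTensor]
    exact congrArg (fun φ => φ.hom (oneTensor π.ringSMap T.left p)) ψ.w
  refine (key ψ).trans (Eq.trans ?_ (key χ).symm)
  rw [h]

include h𝒳

/-- The morphism `π^* H → G` is an isomorphism: at `y`, both stalks are obtained from the glued sections over an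
affine open set by extension of scalars to `B_y`. -/
lemma isIso_pullGlue {T : Comma π.extend π.restrictAbove} (hT : π.isTriple T) : IsIso (π.pullGlue T) := by
  have := hπ.finite
  refine isIso_of_stalkMapM _ fun y => ?_
  obtain ⟨U, hU, hx, -⟩ := exists_isAffineOpen_mem_and_subset (X := 𝒳.space) (x := π.base y) (U := ⊤) trivial
  have h1 := (NCVariety.isBC_germM (isVectorBundle_glue hπ h𝒳 T hT).1 hU (π.base y) hx).comp
    (isBC_pullStalk π (π.glue.obj T) y)
  have h2 := (glue_projective hπ h𝒳 T hT hU).2.2.comp (NCVariety.isBC_germM hT.1.1 (hU.preimage π.base) y hx)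
  have hring : (π.stalkMap y).comp (germR 𝒳.sheaf U (π.base y) hx) =
      (germR 𝒴.sheaf (π.base ⁻¹ᵁ U) y hx).comp (π.sharpApp U) := RingHom.ext fun a => π.stalkMap_germ U y hx a
  rw [hring] at h1
  exact h1.bijective h2 _ fun h => π.stalkMapM_pullGlue T U y hx h

/-- The residues of the glued sheaf belong to `θ(1 ⊗ P)`. -/
lemma exists_tripleMap_eq_glueResidues {T : Comma π.extend π.restrictAbove} (v : π.restrict.obj (π.glue.obj T)) :
    ∃ p : T.left, π.glueResidues T v = π.tripleMap T p := by
  have := (finite_sing hπ h𝒳).to_subtype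
  refine π.exists_tripleMap_eq T _ fun x => ?_
  obtain ⟨m, hm⟩ := Submodule.Quotient.mk_surjective _ (v x)
  obtain ⟨U, hx, h, rfl⟩ := exists_germM (π.glue.obj T) x.1 m
  obtain ⟨p, hp⟩ := π.inPreimage_glueIncl T U h x.1 x.2 hx
  refine ⟨p, fun y hyx => ?_⟩
  obtain ⟨x, hxs⟩ := x
  change π.base y.1 = x at hyx
  subst hyx
  exact (π.glueResidues_apply T v y U hx h hm.symm).trans (hp y hx rfl)

/-- Every element of `θ(1 ⊗ P)` is the family of the residues of glued sections. -/
lemma exists_glueResidues_eq_tripleMap {T : Comma π.extend π.restrictAbove} (hT : π.isTriple T) (p : T.left) :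
    ∃ v : π.restrict.obj (π.glue.obj T), π.glueResidues T v = π.tripleMap T p := by
  have key : ∀ x : π.sing, ∃ (U : 𝒳.space.Opens) (_ : x.1 ∈ U) (h : (π.glue.obj T).val.obj (op U)),
      ∀ (y : π.singAbove) (hy : π.base y.1 ∈ U), π.residue T.right U y.1 hy (π.glueIncl T U h) = π.tripleMap T p y := fun x => by
    obtain ⟨U, hU, hx, -⟩ := exists_isAffineOpen_mem_and_subset (X := 𝒳.space) (x := x.1) (U := ⊤) trivial
    obtain ⟨g, hg⟩ := exists_residue_eq hπ h𝒳 hT.1.1 hU (π.tripleMap T p)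
    obtain ⟨h, hh⟩ := π.exists_glueIncl_eq T U g fun _ _ _ => ⟨p, fun y hy _ => hg y hy⟩
    exact ⟨U, hx, h, fun y hy => (congrArg (π.residue T.right U y.1 hy) hh).trans (hg y hy)⟩
  choose U hU h hh using key
  refine ⟨fun x : π.sing => Submodule.Quotient.mk (germM (π.glue.obj T) (U x) x.1 (hU x) (h x)), funext fun y : π.singAbove => ?_⟩
  exact (π.glueResidues_apply T _ y _ (hU ⟨π.base y.1, y.2⟩) (h ⟨π.base y.1, y.2⟩) rfl).trans (hh _ y _)

lemma glueResidues_injective {T : Comma π.extend π.restrictAbove} (hT : π.isTriple T) :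
    Function.Injective (π.glueResidues T) := by
  have := hπ.finite
  have := isIso_pullGlue hπ h𝒳 hT
  have h1 := tripleMap_injective hπ (isTriple_toTriples (isVectorBundle_glue hπ h𝒳 T hT) hπ h𝒳)
  have h2 : Function.Injective (π.restrictAbove.map (π.pullGlue T)).hom :=
    ((ConcreteCategory.isIso_iff_bijective (π.restrictAbove.map (π.pullGlue T))).1 inferInstance).1
  refine h2.comp fun v w hvw => h1 ?_
  exact (π.tripleMap_toTriples _ v).trans (hvw.trans (π.tripleMap_toTriples _ w).symm)

/-- The module `P` of a triple is the module of the residues of the glued sheaf. -/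
lemma exists_leftIso {T : Comma π.extend π.restrictAbove} (hT : π.isTriple T) :
    ∃ l : π.restrict.obj (π.glue.obj T) ≅ T.left, ∀ v, π.tripleMap T (l.hom.hom v) = π.glueResidues T v := by
  choose f hf using fun v => exists_tripleMap_eq_glueResidues hπ h𝒳 (T := T) v
  have hinj := tripleMap_injective hπ hT
  let f' : π.restrict.obj (π.glue.obj T) →ₗ[π.ringS] T.left :=
    { toFun := f
      map_add' := fun v w => hinj (by rw [map_add, ← hf, ← hf, ← hf, map_add])
      map_smul' := fun s v => hinj (by
        rw [RingHom.id_apply, tripleMap_smul, ← hf, ← hf, glueResidues_smul]) }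
  have hbij : Function.Bijective f' := by
    refine ⟨fun v w hvw => glueResidues_injective hπ h𝒳 hT ?_, fun p => ?_⟩
    · exact (hf v).trans ((congrArg (π.tripleMap T) hvw).trans (hf w).symm)
    · obtain ⟨v, hv⟩ := exists_glueResidues_eq_tripleMap hπ h𝒳 hT p
      exact ⟨v, hinj ((hf v).symm.trans hv)⟩
  exact ⟨(LinearEquiv.ofBijective f' hbij).toModuleIso, fun v => (hf v).symm⟩

/-- The counit: the triple of the glued sheaf is isomorphic to the original one. -/
lemma exists_counitIso {T : Comma π.extend π.restrictAbove} (hT : π.isTriple T) :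
    ∃ e : π.toTriples.obj (π.glue.obj T) ≅ T, e.hom.right = π.pullGlue T := by
  have := isIso_pullGlue hπ h𝒳 hT
  obtain ⟨l, hl⟩ := exists_leftIso hπ h𝒳 hT
  let r : π.pull.obj (π.glue.obj T) ≅ T.right := asIso (π.pullGlue T)
  refine ⟨Comma.isoMk l r ?_, rfl⟩
  refine extendScalars_hom_ext π.ringSMap fun v => ?_
  refine (congrArg T.hom.hom (extendScalars_map_oneTensor π.ringSMap l.hom v)).trans ((hl v).trans ?_)
  exact congrArg (π.restrictAbove.map (π.pullGlue T)).hom (π.theta_oneTensor (π.glue.obj T) v).symm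

end NCHom

end NCCurve

end

theorem theorem1p1 {K : Type u} [Field K] [IsAlgClosed K] {𝒳 𝒴 : NCCurve.NCVariety K}
    (h𝒳 : 𝒳.IsNCCurve) (π : NCCurve.NCHom 𝒴 𝒳) (hπ : π.IsNormalization) :
    ∃ (hF : ∀ F : 𝒳.VB, π.isTriple (π.toTriples.obj F.obj))
      (hG : ∀ T : π.Triples, 𝒳.isVectorBundle (π.glue.obj T.obj))
      (e : 𝒳.VB ≌ π.Triples),
      e.functor = π.isTriple.lift (𝒳.isVectorBundle.ι ⋙ π.toTriples) hF ∧
      e.inverse = 𝒳.isVectorBundle.lift (π.isTriple.ι ⋙ π.glue) hG := by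
  have := hπ.finite
  have hF (F : 𝒳.VB) : π.isTriple (π.toTriples.obj F.obj) := NCCurve.NCHom.isTriple_toTriples F.property hπ h𝒳
  have hG (T : π.Triples) : 𝒳.isVectorBundle (π.glue.obj T.obj) := NCCurve.NCHom.isVectorBundle_glue hπ h𝒳 T.obj T.property
  have hη (F : 𝒳.VB) : IsIso (π.toGlue F.obj) := NCCurve.NCHom.isIso_toGlue hπ h𝒳 F.property
  choose ε hε using fun T : π.Triples => NCCurve.NCHom.exists_counitIso hπ h𝒳 T.property
  let Φ : 𝒳.VB ⥤ π.Triples := π.isTriple.lift (𝒳.isVectorBundle.ι ⋙ π.toTriples) hF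
  let Ψ : π.Triples ⥤ 𝒳.VB := 𝒳.isVectorBundle.lift (π.isTriple.ι ⋙ π.glue) hG
  let η : 𝟭 𝒳.VB ≅ Φ ⋙ Ψ := NatIso.ofComponents
    (fun F => 𝒳.isVectorBundle.isoMk (X := F) (Y := Ψ.obj (Φ.obj F)) (asIso (π.toGlue F.obj)))
    fun φ => ObjectProperty.hom_ext _ (π.toGlue_naturality φ.hom)
  let ε' : Ψ ⋙ Φ ≅ 𝟭 π.Triples := NatIso.ofComponents
    (fun T => π.isTriple.isoMk (X := Φ.obj (Ψ.obj T)) (Y := T) (ε T))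
    fun {T T'} ψ => ObjectProperty.hom_ext _ <| NCCurve.NCHom.comma_hom_ext hπ T'.property <| by
      change π.pull.map (π.glue.map ψ.hom) ≫ (ε T').hom.right = (ε T).hom.right ≫ ψ.hom.right
      rw [hε, hε]
      exact π.pullGlue_naturality ψ.hom
  exact ⟨hF, hG, CategoryTheory.Equivalence.mk Φ Ψ η ε', rfl, rfl⟩
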